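/- All graphs are finite, simple and undirected. A graph is chordal if it has no chordless cycle on $k \ge 4$ vertices, and it is $H$-free if none of its induced subgraphs is isomorphic to $H$. The extended gem is the graph with vertices $a,b,c,d,m,p,q,r$ and edges $ab, bc, cd, ma, mb, mc, md, bp, cq, qr$ (that is, $a,b,c,d,m$ induce a gem consisting of the chordless path $a,b,c,d$ and a vertex $m$ adjacent to all of it, $p$ is a pendant neighbor of $b$, and $c,q,r$ is a pendant path at $c$). A vertex dominates itself and its neighbors; an efficient dominating set (e.d.s.) of $G=(V,E)$ is a set $D \subseteq V$ such that every vertex of $G$ is dominated by exactly one vertex of $D$. The Weighted Efficient Domination problem (WED) is: given a graph $G$ and vertex weights $\omega : V \to \mathbb{N} \cup \{\infty\}$, find an e.d.s. of $G$ of minimum finite total weight, or determine that $G$ contains no e.d.s. of finite total weight. Statement: WED is solvable in time $O(n^3)$ for extended-gem-free chordal graphs. That is, there is one program for a word RAM (words of $O(\log(n+W))$ bits, where $W$ is the largest finite weight; unit cost for copying, addition, subtraction, multiplication, comparison and indirect memory access) which, given the adjacency matrix and the weights of any extended-gem-free chordal graph with $n$ vertices, halts after $O(n^3)$ steps, the bound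 depending on $n$ only, with a correct solution of the WED instance. -/

import Mathlib

/-! ### Graph classes -/

namespace SimpleGraph

/-- `G` is `H`-free: no induced subgraph of `G` is isomorphic to `H`. -/
def InducedFree {U V : Type*} (H : SimpleGraph U) (G : SimpleGraph V) : Prop :=
  ¬ H.IsIndContained G

/-- A graph is chordal if it has no chordless cycle on at least four vertices. -/
def IsChordalGraph {V : Type*} (G : SimpleGraph V) : Prop :=
  ∀ k : ℕ, 4 ≤ k → (cycleGraph k).InducedFree G

/-- The extended gem, on eight vertices. The vertices `0,1,2,3,4` induce a gem: `0 - 1 - 2 - 3` is a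
chordless path and `4` is adjacent to all of its vertices. The midpoints `1` and `2` of the path
get the further neighbors `5` and `6`, respectively, and `7` is adjacent to `6` only. -/
def extendedGem : SimpleGraph (Fin 8) :=
  fromEdgeSet {s(0, 1), s(1, 2), s(2, 3), s(4, 0), s(4, 1), s(4, 2), s(4, 3),
    s(1, 5), s(2, 6), s(6, 7)}

/-- `D` is an efficient dominating set: every vertex is dominated by exactly one vertex of `D`,
where a vertex dominates itself and its neighbors. -/
def IsEfficientDominatingSet {V : Type*} (G : SimpleGraph V) (D : Finset V) : Prop :=
  ∀ v : V, ∃! d : V, d ∈ D ∧ (d = v ∨ G.Adj d v)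

/-- `D` is an efficient dominating set of minimum finite total weight. -/
def IsMinFiniteWeightEDS {V : Type*} (G : SimpleGraph V) (w : V → ℕ∞) (D : Finset V) : Prop :=
  G.IsEfficientDominatingSet D ∧ ∑ v ∈ D, w v ≠ ⊤ ∧
    ∀ D' : Finset V, G.IsEfficientDominatingSet D' → ∑ v ∈ D, w v ≤ ∑ v ∈ D', w v

/-- `G` has an efficient dominating set of finite total weight. -/
def HasFiniteWeightEDS {V : Type*} (G : SimpleGraph V) (w : V → ℕ∞) : Prop :=
  ∃ D : Finset V, G.IsEfficientDominatingSet D ∧ ∑ v ∈ D, w v ≠ ⊤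

end SimpleGraph

/-! ### Programs of a word RAM, with a step count -/

namespace RAM

/-- A configuration of the machine: the contents of the registers and of the memory cells. -/
structure State where
  reg : ℕ → ℕ
  mem : ℕ → ℕ

/-- An operand is a constant or a register. -/
inductive Operand where
  | const (c : ℕ)
  | reg (r : ℕ)

/-- The value of an operand. -/
def Operand.val (s : State) : Operand → ℕ
  | .const c => c
  | .reg r => s.reg r

/-- The right-hand side of an assignment to a register: a copy, one arithmetic operation, or
reading the memory cell with a given address. -/
inductive Rhs where
  | copy (a : Operand)
  | add (a b : Operand)
  | sub (a b : Operand)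
  | mul (a b : Operand)
  | load (a : Operand)

/-- The value of a right-hand side (subtraction is truncated at `0`). -/
def Rhs.val (s : State) : Rhs → ℕ
  | .copy a => a.val s
  | .add a b => a.val s + b.val s
  | .sub a b => a.val s - b.val s
  | .mul a b => a.val s * b.val s
  | .load a => s.mem (a.val s)

/-- A test compares two operands. -/
inductive Test where
  | lt (a b : Operand)
  | eq (a b : Operand)

/-- The test holds in the given configuration. -/
def Test.Holds (s : State) : Test → Prop
  | .lt a b => a.val s < b.val s
  | .eq a b => a.val s = b.val s

/-- Programs. A program is a finite object and mentions finitely many registers only. -/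
inductive Prog where
  /-- do nothing -/
  | skip
  /-- write the value of a right-hand side to register `r` -/
  | assign (r : ℕ) (e : Rhs)
  /-- write the value of `b` to the memory cell with address `a` -/
  | store (a b : Operand)
  /-- run two programs one after the other -/
  | seq (p q : Prog)
  /-- conditional branch -/
  | ite (c : Test) (p q : Prog)
  /-- repeat the body as long as the test holds -/
  | loop (c : Test) (p : Prog)

/-- `Exec B p s t s'`: on the machine whose words are the numbers less than `B`, the program `p`,
started in `s`, halts in `s'` after exactly `t` steps. Each assignment, each store, each evaluation
of a test and each `skip` is one step. A program that tries to write a number that does not fit into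
a word gets stuck. -/
inductive Exec (B : ℕ) : Prog → State → ℕ → State → Prop where
  | skip (s : State) : Exec B .skip s 1 s
  | assign (s : State) (r : ℕ) (e : Rhs) (h : e.val s < B) :
      Exec B (.assign r e) s 1 { s with reg := Function.update s.reg r (e.val s) }
  | store (s : State) (a b : Operand) (h : b.val s < B) :
      Exec B (.store a b) s 1 { s with mem := Function.update s.mem (a.val s) (b.val s) }
  | seq {p q : Prog} {s s' s'' : State} {t t' : ℕ}
      (hp : Exec B p s t s') (hq : Exec B q s' t' s'') : Exec B (.seq p q) s (t + t') s''
  | ite_true {c : Test} {p q : Prog} {s s' : State} {t : ℕ}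
      (hc : c.Holds s) (hp : Exec B p s t s') : Exec B (.ite c p q) s (t + 1) s'
  | ite_false {c : Test} {p q : Prog} {s s' : State} {t : ℕ}
      (hc : ¬ c.Holds s) (hq : Exec B q s t s') : Exec B (.ite c p q) s (t + 1) s'
  | loop_true {c : Test} {p : Prog} {s s' s'' : State} {t t' : ℕ}
      (hc : c.Holds s) (hp : Exec B p s t s') (hl : Exec B (.loop c p) s' t' s'') :
      Exec B (.loop c p) s (t + t' + 1) s''
  | loop_false {c : Test} {p : Prog} {s : State}
      (hc : ¬ c.Holds s) : Exec B (.loop c p) s 1 s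

end RAM

/-! ### The weighted efficient domination problem as a computational problem -/

namespace WED

/-- The machine code of a weight: `∞` is coded by `0` and `m < ∞` by `m + 1`. -/
def codeWeight : ℕ∞ → ℕ
  | ⊤ => 0
  | (m : ℕ) => m + 1

open Classical in
/-- The input: register `0` holds the number `n` of vertices, the cells `n * i + j` hold the
adjacency matrix, the next `n` cells `n * n + v` hold the weights, and all else is `0`. -/
noncomputable def input {n : ℕ} (G : SimpleGraph (Fin n)) (w : Fin n → ℕ∞) : RAM.State where
  reg r := if r = 0 then n else 0
  mem a :=
    if ∃ i j : Fin n, a = n * i.val + j.val ∧ G.Adj i j then 1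
    else if h : n * n ≤ a ∧ a - n * n < n then codeWeight (w ⟨a - n * n, h.2⟩)
    else 0

/-- The vertex set that is read off from the final configuration: `v` belongs to it if the cell
`n * n + v` holds `1`. -/
def outputSet (n : ℕ) (s : RAM.State) : Finset (Fin n) :=
  Finset.univ.filter fun v => s.mem (n * n + v.val) = 1

/-- The final configuration `s` solves the instance `(G, w)`: either register `0` holds `1` and the
output set is an efficient dominating set of minimum finite total weight, or register `0` holds `0`
and there is no efficient dominating set of finite total weight. -/
def Solves {n : ℕ} (G : SimpleGraph (Fin n)) (w : Fin n → ℕ∞) (s : RAM.State) : Prop :=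
  (s.reg 0 = 1 ∧ G.IsMinFiniteWeightEDS w (outputSet n s)) ∨
    (s.reg 0 = 0 ∧ ¬ G.HasFiniteWeightEDS w)

/-- The largest finite weight (`0` if there is none). -/
def maxFiniteWeight {n : ℕ} (w : Fin n → ℕ∞) : ℕ :=
  Finset.univ.sup fun v => (w v).toNat

/-- Weighted efficient domination is solvable in time `O(f(n))` on the graph class `𝒢`, where `n` is
the number of vertices: one program solves all instances whose graph is in `𝒢`, with a number
of steps that is bounded by a function of `n` of order `O(f(n))`, whatever the weights are.
The words of the machine have `O(log (n + W))` bits, where `W` is the largest finite weight. -/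
def SolvableInTime (𝒢 : ∀ n : ℕ, SimpleGraph (Fin n) → Prop) (f : ℕ → ℕ) : Prop :=
  ∃ (p : RAM.Prog) (k : ℕ) (T : ℕ → ℕ),
    Asymptotics.IsBigO Filter.atTop (fun n => (T n : ℝ)) (fun n => (f n : ℝ)) ∧
    ∀ (n : ℕ) (G : SimpleGraph (Fin n)) (w : Fin n → ℕ∞), 𝒢 n G →
      ∃ (t : ℕ) (s : RAM.State),
        RAM.Exec ((n + maxFiniteWeight w + 2) ^ k) p (input G w) t s ∧ t ≤ T n ∧ Solves G w s

end WED

/-! An efficient dominating set is a set of vertices whose closed neighborhoods partition the vertex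
set, that is, an independent set of the square of G that dominates everything. Choose M larger than
all finite weights together and put c(v) = M|N[v]| - w(v), or c(v) = 0 if w(v) is infinite. An
independent set J of the square with finite weights has c(J) = M·(number of dominated vertices) -
w(J), and leaving one vertex undominated costs more than any weights can save. So if a solution of
finite weight exists, an independent set of the square of maximum c-weight, without vertices of
weight 0, is an optimal one (`isMinFiniteWeightEDS_of_maxWeight`).

If G is chordal, extended-gem-free and has an efficient dominating set D, its square is chordal
(`IsChordalGraph.square`). A chordless cycle of the square would yield a sun: a cycle x in G with a
vertex u i on each edge x i, x (i+1), where non-consecutive u i are at distance at least three. A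
vertex of D that dominates u i but misses an end of the edge produces an extended gem, possibly with
the help of the vertex of D at the next u. Hence the dominator of u i dominates both ends,
consecutive u i have the same dominator, and u 0 and u 2 are too close. Chordality enters through
one tool, `exists_common_neighbor`: an edge whose ends both see a connected set forms a triangle
with a vertex of that set.

On a chordal square, Dirac's theorem provides simplicial vertices, and Frank's algorithm finds the
maximum (`maxWeight_of_elimination`). The program runs it on every input and checks the result: if
the square is not chordal, no efficient dominating set exists and the check has to fail. The square
is computed like a matrix product; afterwards simpliciality is read off from counts of private
neighbors, which cost quadratic time per round to maintain. The program is written in a small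
language of loops of length n, where static bounds control word size and loop nesting depth, here 3,
is the exponent of the running time. -/

namespace SimpleGraph

/-! ### Holes and triangles in chordal graphs -/

theorem cycleGraph_adj_iff_of_lt {k : ℕ} (hk : 2 ≤ k) {a b : Fin k} (h : a.val < b.val) :
    (cycleGraph k).Adj a b ↔ b.val = a.val + 1 ∨ (a.val = 0 ∧ b.val + 1 = k) := by
  have ha := a.2
  have hb := b.2
  rw [cycleGraph_adj', Fin.val_sub, Fin.val_sub]
  have h1 : (k - b.val + a.val) % k = k - b.val + a.val := Nat.mod_eq_of_lt (by omega)
  have h2 : (k - a.val + b.val) % k = b.val - a.val := by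
    rw [show k - a.val + b.val = b.val - a.val + k by omega, Nat.add_mod_right,
      Nat.mod_eq_of_lt (by omega)]
  rw [h1, h2]
  omega

variable {V : Type*} {G : SimpleGraph V}

/-- A sequence of distinct vertices whose only adjacencies are the cyclically consecutive ones
contradicts chordality. -/
theorem IsChordalGraph.false_of_hole (hG : G.IsChordalGraph) {k : ℕ} (hk : 4 ≤ k) (f : ℕ → V)
    (hinj : ∀ i j, i < j → j < k → f i ≠ f j)
    (hadj : ∀ i j, i < j → j < k → (G.Adj (f i) (f j) ↔ j = i + 1 ∨ (i = 0 ∧ j + 1 = k))) :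
    False := by
  refine hG k hk ⟨⟨⟨fun i => f i.val, ?_⟩, ?_⟩⟩
  · intro i j hij
    by_contra hne
    rcases lt_or_gt_of_ne (fun h => hne (Fin.ext h) : i.val ≠ j.val) with h | h
    · exact hinj _ _ h j.2 hij
    · exact hinj _ _ h i.2 hij.symm
  · intro i j
    change G.Adj (f i.val) (f j.val) ↔ _
    rcases lt_trichotomy i.val j.val with h | h | h
    · rw [hadj _ _ h j.2, cycleGraph_adj_iff_of_lt (by omega) h]
    · obtain rfl := Fin.ext h
      simp
    · rw [G.adj_comm, hadj _ _ h i.2, adj_comm, cycleGraph_adj_iff_of_lt (by omega) h]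

/-- Induction on the length of the walk: an inner neighbor of `a`, an early neighbor of `b` or a
chord allows a shorter walk. If none exists and `m > 0`, the walk closed up by `b` and `a` is a hole
with `m + 3 ≥ 4` vertices. -/
theorem IsChordalGraph.exists_common_neighbor_of_seq (hG : G.IsChordalGraph) {a b : V}
    (hab : G.Adj a b) {P : V → Prop} (ha : ¬ P a) (hb : ¬ P b) (m : ℕ) :
    ∀ c : ℕ → V, (∀ i ≤ m, P (c i)) → (∀ i < m, G.Adj (c i) (c (i + 1))) →
      G.Adj a (c 0) → G.Adj b (c m) → ∃ z, P z ∧ G.Adj a z ∧ G.Adj b z := by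
  induction m using Nat.strong_induction_on with
  | _ m ih =>
  intro c hP hc h0 hm
  rcases Nat.eq_zero_or_pos m with rfl | hpos
  · exact ⟨c 0, hP 0 le_rfl, h0, hm⟩
  by_cases h1 : ∃ i, 0 < i ∧ i ≤ m ∧ G.Adj a (c i)
  · obtain ⟨i, hi, him, hai⟩ := h1
    refine ih (m - i) (by omega) (fun t => c (t + i)) (fun t ht => hP _ (by omega)) ?_ (by simpa) ?_
    · intro t ht
      have := hc (t + i) (by omega)
      rwa [show t + i + 1 = t + 1 + i by omega] at this
    · simpa [Nat.sub_add_cancel him] using hm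
  by_cases h2 : ∃ i, i < m ∧ G.Adj b (c i)
  · obtain ⟨i, him, hbi⟩ := h2
    exact ih i him c (fun t ht => hP _ (by omega)) (fun t ht => hc t (by omega)) h0 hbi
  by_cases h3 : ∃ i j, i + 1 < j ∧ j ≤ m ∧ G.Adj (c i) (c j)
  · obtain ⟨i, j, hij, hjm, hadj⟩ := h3
    refine ih (m - (j - i - 1)) (by omega) (fun t => if t ≤ i then c t else c (t + (j - i - 1)))
      ?_ ?_ ?_ ?_
    · intro t ht
      split_ifs <;> exact hP _ (by omega)
    · intro t ht
      rcases lt_trichotomy t i with h | h | h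
      · rw [if_pos (by omega), if_pos (by omega)]
        exact hc t (by omega)
      · subst h
        rw [if_pos le_rfl, if_neg (by omega), show t + 1 + (j - t - 1) = j by omega]
        exact hadj
      · rw [if_neg (by omega), if_neg (by omega)]
        have := hc (t + (j - i - 1)) (by omega)
        rwa [show t + (j - i - 1) + 1 = t + 1 + (j - i - 1) by omega] at this
    · simpa using h0
    · rw [if_neg (by omega), show m - (j - i - 1) + (j - i - 1) = m by omega]
      exact hm
  -- A repeated vertex needs no shortcut of its own: it already yields an early neighbor of `b` or a
  -- chord.
  by_cases h4 : ∃ i j, i < j ∧ j ≤ m ∧ c i = c j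
  · obtain ⟨i, j, hij, hjm, heq⟩ := h4
    rcases Nat.eq_or_lt_of_le hjm with rfl | hjm
    · exact absurd ⟨i, hij, heq ▸ hm⟩ h2
    · have := hc j hjm
      rw [← heq] at this
      exact absurd ⟨i, j + 1, by omega, by omega, this⟩ h3
  push Not at h1 h2 h3 h4
  exfalso
  have key : ∀ i, i ≤ m → c i ≠ a ∧ c i ≠ b := fun i hi =>
    ⟨fun h => ha (h ▸ hP i hi), fun h => hb (h ▸ hP i hi)⟩
  refine hG.false_of_hole (k := m + 3) (by omega)
    (fun t => if t ≤ m then c t else if t = m + 1 then b else a) ?_ ?_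
  · intro i j hij hj
    by_cases hjm : j ≤ m
    · rw [if_pos (by omega), if_pos hjm]
      exact h4 i j hij hjm
    by_cases him : i ≤ m
    · rw [if_pos him, if_neg hjm]
      split_ifs
      · exact (key i him).2
      · exact (key i him).1
    · rw [if_neg him, if_neg hjm, if_pos (by omega), if_neg (by omega)]
      exact hab.ne'
  · intro i j hij hj
    by_cases hjm : j ≤ m
    · rw [if_pos (by omega), if_pos hjm]
      by_cases hj1 : j = i + 1
      · subst hj1
        simp only [true_or, iff_true]
        exact hc i (by omega)
      · have := h3 i j (by omega) hjm
        simp only [this, false_iff]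
        omega
    by_cases him : i ≤ m
    · rw [if_pos him, if_neg hjm]
      split_ifs with hjb
      · rw [G.adj_comm]
        by_cases hi : i = m
        · subst hi
          simp only [hm, true_iff]
          omega
        · simp only [h2 i (by omega), false_iff]
          omega
      · rw [G.adj_comm]
        by_cases hi : i = 0
        · subst hi
          simp only [h0, true_iff]
          exact Or.inr ⟨trivial, by omega⟩
        · simp only [h1 i (by omega) him, false_iff]
          omega
    · rw [if_neg him, if_neg hjm, if_pos (by omega), if_neg (by omega)]
      simp only [hab.symm, true_iff]
      omega

/-- In a chordal graph, an edge whose ends both have neighbors in a connected set of other vertices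
forms a triangle with a vertex of this set. -/
theorem IsChordalGraph.exists_common_neighbor (hG : G.IsChordalGraph) {a b c c' : V}
    (hab : G.Adj a b) {P : V → Prop} (ha : ¬ P a) (hb : ¬ P b) (hc : P c)
    (hac : G.Adj a c) (hbc : G.Adj b c')
    (hcc : Relation.ReflTransGen (fun y z => P z ∧ G.Adj y z) c c') :
    ∃ z, P z ∧ G.Adj a z ∧ G.Adj b z := by
  obtain ⟨m, f, hP, hf, h0, hm⟩ : ∃ (m : ℕ) (f : ℕ → V), (∀ i ≤ m, P (f i)) ∧
      (∀ i < m, G.Adj (f i) (f (i + 1))) ∧ f 0 = c ∧ f m = c' := by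
    clear hbc
    induction hcc with
    | refl => exact ⟨0, fun _ => c, fun _ _ => hc, by simp, rfl, rfl⟩
    | @tail y z _ hyz ih =>
      obtain ⟨m, f, hP, hf, h0, hm⟩ := ih
      refine ⟨m + 1, fun t => if t ≤ m then f t else z, ?_, ?_, by simpa, by simp⟩
      · intro i hi
        dsimp only
        split_ifs with h
        · exact hP i h
        · exact hyz.1
      · intro i hi
        dsimp only
        rcases Nat.lt_succ_iff_lt_or_eq.1 hi with h | rfl
        · rw [if_pos (by omega), if_pos (by omega)]
          exact hf i h
        · rw [if_pos le_rfl, if_neg (by omega), hm]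
          exact hyz.2
  exact hG.exists_common_neighbor_of_seq hab ha hb m f hP hf (h0 ▸ hac) (hm ▸ hbc)

end SimpleGraph

/-! ### Suns in chordal graphs and the extended gem -/

namespace SimpleGraph

variable {V : Type*} {G : SimpleGraph V}

/-- The closed neighborhoods of `a` and `b` meet, i.e. `a` and `b` have distance at most two. -/
def Close (G : SimpleGraph V) (a b : V) : Prop :=
  ∃ c, (c = a ∨ G.Adj c a) ∧ (c = b ∨ G.Adj c b)

theorem Close.symm {a b : V} (h : G.Close a b) : G.Close b a := by
  obtain ⟨c, h1, h2⟩ := h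
  exact ⟨c, h2, h1⟩

theorem Close.refl (a : V) : G.Close a a := ⟨a, Or.inl rfl, Or.inl rfl⟩

theorem Close.of_adj {a b : V} (h : G.Adj a b) : G.Close a b := ⟨a, Or.inl rfl, Or.inr h⟩

/-- A cycle `x` with vertices `u i` attached to its edges that are pairwise at distance at
least three unless consecutive; the indices are read modulo `k`. -/
structure PeriodicSun (G : SimpleGraph V) (k : ℤ) (x u : ℤ → V) : Prop where
  four_le : 4 ≤ k
  period_x : ∀ i, x (i + k) = x i
  period_u : ∀ i, u (i + k) = u i
  adj_left : ∀ i, G.Adj (u i) (x i)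
  adj_right : ∀ i, G.Adj (u i) (x (i + 1))
  not_adj : ∀ i j, i + 2 ≤ j → j ≤ i + k - 1 → ¬ G.Adj (u i) (x j)
  not_adj_u : ∀ i j, i + 1 ≤ j → j ≤ i + k - 1 → ¬ G.Adj (u i) (u j)
  not_close : ∀ i j, i + 2 ≤ j → j ≤ i + k - 2 → ¬ G.Close (u i) (u j)
  adj_x : ∀ i, G.Adj (x i) (x (i + 1))
  ne_x : ∀ i j, i + 1 ≤ j → j ≤ i + k - 1 → x i ≠ x j

namespace PeriodicSun

variable {k : ℤ} {x u : ℤ → V}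

/-- Reversal turns statements about the left end of an edge into statements about the right end.
Since `u i` sits between `x i` and `x (i + 1)`, its index is also shifted by one. -/
theorem reflect (h : G.PeriodicSun k x u) :
    G.PeriodicSun k (fun i => x (-i)) (fun i => u (-1 - i)) where
  four_le := h.four_le
  period_x i := by
    rw [← h.period_x (-(i + k))]
    congr 1
    ring
  period_u i := by
    rw [← h.period_u (-1 - (i + k))]
    congr 1
    ring
  adj_left i := by
    have := h.adj_right (-1 - i)
    rwa [show -1 - i + 1 = -i by ring] at this
  adj_right i := by
    have := h.adj_left (-1 - i)
    rwa [show -1 - i = -(i + 1) by ring] at this ⊢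
  not_adj i j h1 h2 := by
    have := h.not_adj (-1 - i) (-j + k) (by omega) (by omega)
    rwa [h.period_x] at this
  not_adj_u i j h1 h2 := by
    rw [G.adj_comm]
    exact h.not_adj_u _ _ (by omega) (by omega)
  not_close i j h1 h2 := fun hc => h.not_close (-1 - j) (-1 - i) (by omega) (by omega) hc.symm
  adj_x i := by
    have := h.adj_x (-(i + 1))
    rw [show -(i + 1) + 1 = -i by ring] at this
    exact this.symm
  ne_x i j h1 h2 := (h.ne_x (-j) (-i) (by omega) (by omega)).symm

theorem u_ne_x (h : G.PeriodicSun k x u) {i j : ℤ} (h1 : i ≤ j) (h2 : j ≤ i + k - 1) :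
    u i ≠ x j := by
  intro he
  rcases h1.eq_or_lt with rfl | h1
  · exact (h.adj_left i).ne he
  · refine h.not_adj_u i j (by omega) h2 ?_
    rw [he]
    exact (h.adj_left j).symm

theorem adj_x_period (h : G.PeriodicSun k x u) (i : ℤ) : G.Adj (x (i + k - 1)) (x i) := by
  have := h.adj_x (i + k - 1)
  rwa [show i + k - 1 + 1 = i + k by ring, h.period_x] at this

theorem reach (h : G.PeriodicSun k x u) {P : V → Prop} {i j : ℤ} (hij : i ≤ j)
    (hP : ∀ l, i + 1 ≤ l → l ≤ j → P (x l)) :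
    Relation.ReflTransGen (fun y z => P z ∧ G.Adj y z) (x i) (x j) := by
  induction j, hij using Int.leInduction with
  | base => exact .refl
  | succ j hij ih =>
    exact (ih fun l h1 h2 => hP l h1 (by omega)).tail ⟨hP _ (by omega) le_rfl, h.adj_x j⟩

/-- An edge between two vertices of the cycle forms a triangle with an inner vertex of each arc
between them. -/
theorem exists_apex (h : G.PeriodicSun k x u) (hG : G.IsChordalGraph) {i j : ℤ}
    (hij : i + 2 ≤ j) (hj : j ≤ i + k - 1) (hadj : G.Adj (x i) (x j)) :
    ∃ l, i + 1 ≤ l ∧ l ≤ j - 1 ∧ G.Adj (x i) (x l) ∧ G.Adj (x j) (x l) := by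
  obtain ⟨z, ⟨l, h1, h2, rfl⟩, h3, h4⟩ := hG.exists_common_neighbor hadj
    (P := fun z => ∃ l, i + 1 ≤ l ∧ l ≤ j - 1 ∧ z = x l)
    (by
      rintro ⟨l, h1, h2, he⟩
      exact h.ne_x i l h1 (by omega) he)
    (by
      rintro ⟨l, h1, h2, he⟩
      exact h.ne_x l j (by omega) (by omega) he.symm)
    (c := x (i + 1)) (c' := x (j - 1)) ⟨i + 1, le_rfl, by omega, rfl⟩ (h.adj_x i)
    (by
      have := h.adj_x (j - 1)
      rw [sub_add_cancel] at this
      exact this.symm)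
    (h.reach (by omega) fun l h1 h2 => ⟨l, by omega, by omega, rfl⟩)
  exact ⟨l, h1, h2, h3, h4⟩

/-- The edge `e`, `u i` sees the connected set `{u (i + 1), x (i + 1)}`, and only its second member
is adjacent to `u i`. -/
theorem adj_mid_of_adj (h : G.PeriodicSun k x u) (hG : G.IsChordalGraph) {e : V} {i : ℤ}
    (h1 : G.Adj e (u i)) (h2 : G.Adj e (u (i + 1))) : e = x (i + 1) ∨ G.Adj e (x (i + 1)) := by
  have h4 := h.four_le
  by_cases he : e = x (i + 1)
  · exact Or.inl he
  obtain ⟨z, hz | hz, h3, h5⟩ := hG.exists_common_neighbor h1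
    (P := fun z => z = u (i + 1) ∨ z = x (i + 1))
    (by
      rintro (h' | h')
      · exact h2.ne h'
      · exact he h')
    (by
      rintro (h' | h')
      · apply h.not_adj (i) (i + 2) (by omega) (by omega)
        rw [h', show i + 2 = i + 1 + 1 by ring]
        exact h.adj_right _
      · exact h.u_ne_x (by omega) (by omega) h')
    (c := u (i + 1)) (c' := x (i + 1)) (Or.inl rfl) h2 (h.adj_right i)
    (Relation.ReflTransGen.single ⟨Or.inr rfl, h.adj_left _⟩)
  · subst hz
    exact absurd h5 (h.not_adj_u _ _ (by omega) (by omega))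
  · subst hz
    exact Or.inr h3

/-- The same edge sees the long way round, `u (i + 1), x (i + 2), ..., x (i + k) = x i`. Only the
last vertex of it is adjacent to `u i`, so it is the apex of the triangle. -/
theorem adj_left_of_adj (h : G.PeriodicSun k x u) (hG : G.IsChordalGraph) {e : V} {i : ℤ}
    (h1 : G.Adj e (u i)) (h2 : G.Adj e (u (i + 1))) : e = x i ∨ G.Adj e (x i) := by
  have h4 := h.four_le
  by_cases he : e = x i
  · exact Or.inl he
  obtain ⟨z, hz | ⟨j, hj1, hj2, hz⟩, h3, h5⟩ := hG.exists_common_neighbor h1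
    (P := fun z => z = u (i + 1) ∨ ∃ j, i + 2 ≤ j ∧ j ≤ i + k ∧ z = x j)
    (by
      rintro (h' | ⟨j, hj1, hj2, h'⟩)
      · exact h2.ne h'
      · rcases hj2.eq_or_lt with rfl | hj2
        · exact he (h'.trans (h.period_x _))
        · exact h.not_adj i j hj1 (by omega) (h' ▸ h1.symm))
    (by
      rintro (h' | ⟨j, hj1, hj2, h'⟩)
      · apply h.not_adj (i) (i + 2) (by omega) (by omega)
        rw [h', show i + 2 = i + 1 + 1 by ring]
        exact h.adj_right _
      · rcases hj2.eq_or_lt with rfl | hj2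
        · exact (h.adj_left i).ne (h'.trans (h.period_x _))
        · exact h.u_ne_x (by omega) (by omega) h')
    (c := u (i + 1)) (c' := x (i + k)) (Or.inl rfl) h2
    (by
      rw [h.period_x]
      exact h.adj_left i)
    ((Relation.ReflTransGen.single ⟨Or.inr ⟨i + 2, by omega, by omega, rfl⟩, by
        have := h.adj_right (i + 1)
        rwa [show i + 1 + 1 = i + 2 by ring] at this⟩).trans
      (h.reach (by omega) fun l h1 h2 => Or.inr ⟨l, by omega, by omega, rfl⟩))
  · subst hz
    exact absurd h5 (h.not_adj_u _ _ (by omega) (by omega))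
  · subst hz
    rcases hj2.eq_or_lt with rfl | hj2
    · rw [h.period_x] at h3
      exact Or.inr h3
    · exact absurd h5 (h.not_adj i j hj1 (by omega))

/-- A neighbor of `u i` that does not dominate `x i` is not adjacent to the rest of the sun, up to
`x (i + 1)`. -/
theorem not_adj_of_not_adj_left (h : G.PeriodicSun k x u) (hG : G.IsChordalGraph) {e : V} {i : ℤ}
    (he : G.Adj e (u i)) (hx : e ≠ x i) (hx' : ¬ G.Adj e (x i)) {j : ℤ} :
    (i + 2 ≤ j → j ≤ i + k → ¬ G.Adj e (x j)) ∧
      (i + 1 ≤ j → j ≤ i + k - 1 → ¬ G.Adj e (u j)) := by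
  have h4 := h.four_le
  constructor
  · intro hj1 hj2 hj
    have ne : ∀ l, i + 2 ≤ l → l ≤ i + k → e ≠ x l := by
      intro l hl1 hl2 hl
      rcases hl2.eq_or_lt with rfl | hl2
      · exact hx (hl.trans (h.period_x _))
      · exact h.not_adj i l hl1 (by omega) (hl ▸ he.symm)
    -- On the arc from `x j` to `x (i + k) = x i` only the final vertex is adjacent to `u i`, so `e`
    -- would be adjacent to `x i`.
    obtain ⟨z, ⟨l, hl1, hl2, rfl⟩, h3, h5⟩ := hG.exists_common_neighbor he
      (P := fun z => ∃ l, j ≤ l ∧ l ≤ i + k ∧ z = x l)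
      (by
        rintro ⟨l, hl1, hl2, h'⟩
        exact ne l (by omega) hl2 h')
      (by
        rintro ⟨l, hl1, hl2, h'⟩
        rcases hl2.eq_or_lt with rfl | hl2
        · exact (h.adj_left i).ne (h'.trans (h.period_x _))
        · exact h.u_ne_x (by omega) (by omega) h')
      (c := x j) (c' := x (i + k)) ⟨j, le_rfl, hj2, rfl⟩ hj
      (by
        rw [h.period_x]
        exact h.adj_left i)
      (h.reach hj2 fun l h1 h2 => ⟨l, by omega, by omega, rfl⟩)
    rcases hl2.eq_or_lt with rfl | hl2
    · rw [h.period_x] at h3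
      exact hx' h3
    · exact h.not_adj i l (by omega) (by omega) h5
  · intro hj1 hj2 hj
    rcases hj1.eq_or_lt with rfl | hj1
    · exact (h.adj_left_of_adj hG he hj).elim hx hx'
    rcases hj2.eq_or_lt with rfl | hj2
    · have := h.adj_mid_of_adj hG hj (i := i + k - 1)
        (by rwa [show i + k - 1 + 1 = i + k by ring, h.period_u])
      rw [show i + k - 1 + 1 = i + k by ring, h.period_x] at this
      exact this.elim hx hx'
    · exact h.not_close i j (by omega) (by omega) ⟨e, Or.inr he, Or.inr hj⟩

end PeriodicSun

/-- Eight vertices with the adjacencies of the extended gem. -/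
theorem extendedGem_isIndContained (f : Fin 8 → V)
    (hf : ∀ i j, i < j → (G.Adj (f i) (f j) ↔ extendedGem.Adj i j)) :
    extendedGem.IsIndContained G := by
  have hadj : ∀ i j, G.Adj (f i) (f j) ↔ extendedGem.Adj i j := by
    intro i j
    rcases lt_trichotomy i j with h | rfl | h
    · exact hf i j h
    · simp
    · rw [G.adj_comm, extendedGem.adj_comm]
      exact hf j i h
  -- No two vertices of the extended gem have the same neighborhood, so injectivity of `f` follows
  -- from the adjacencies.
  have twins : ∀ i j : Fin 8, (∀ l, extendedGem.Adj i l ↔ extendedGem.Adj j l) → i = j := by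
    unfold extendedGem
    simp only [fromEdgeSet_adj, Set.mem_insert_iff, Set.mem_singleton_iff]
    decide
  refine ⟨⟨⟨f, fun i j hij => twins i j fun l => ?_⟩, hadj _ _⟩⟩
  rw [← hadj, ← hadj, hij]

namespace PeriodicSun

variable {k : ℤ} {x u : ℤ → V}

/-- The place where the forbidden subgraph appears. The hub is `x (i - 1)`, written `x (i + k - 1)`,
over the path `a, x j, x i, u (i - 1)`; `u (j - 1)` is pendant at `x j`, and `u i, e` is the pendant
path at `x i`. -/
theorem not_exists_common_neighbor (h : G.PeriodicSun k x u) (hG : G.IsChordalGraph)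
    (hgem : extendedGem.InducedFree G) {e : V} {i : ℤ}
    (he : G.Adj e (u i)) (hx : e ≠ x i) (hx' : ¬ G.Adj e (x i)) {j : ℤ} (hj1 : i + 2 ≤ j)
    (hj2 : j ≤ i + k - 2) : ¬ (G.Adj (x i) (x j) ∧ G.Adj (x (i + k - 1)) (x j)) := by
  intro hj
  have h4 := h.four_le
  -- The last common neighbor is taken, so that a later vertex adjacent to the hub cannot be
  -- adjacent to `x i`.
  obtain ⟨j, ⟨hj1, hj2, hji, hjk⟩, hmax⟩ : ∃ j, (i + 2 ≤ j ∧ j ≤ i + k - 2 ∧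
      G.Adj (x i) (x j) ∧ G.Adj (x (i + k - 1)) (x j)) ∧ ∀ l, (i + 2 ≤ l ∧ l ≤ i + k - 2 ∧
      G.Adj (x i) (x l) ∧ G.Adj (x (i + k - 1)) (x l)) → l ≤ j :=
    Int.exists_greatest_of_bdd ⟨i + k - 2, fun z hz => hz.2.1⟩ ⟨j, hj1, hj2, hj.1, hj.2⟩
  have hex : ∀ l, i + 2 ≤ l → l ≤ i + k → ¬ G.Adj e (x l) := fun l =>
    (h.not_adj_of_not_adj_left hG he hx hx').1
  have heu : ∀ l, i + 1 ≤ l → l ≤ i + k - 1 → ¬ G.Adj e (u l) := fun l =>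
    (h.not_adj_of_not_adj_left hG he hx hx').2
  -- The free end of the gem path: the vertex `u j` if `x j` immediately precedes the hub, otherwise
  -- the apex over the edge from `x j` to the hub, which misses `x i` by the choice of `j`.
  obtain ⟨a, haj, hak, hai, had, hap, haq, har⟩ : ∃ a, G.Adj a (x j) ∧ G.Adj a (x (i + k - 1)) ∧
      ¬ G.Adj a (x i) ∧ ¬ G.Adj a (u (i + k - 1)) ∧ ¬ G.Adj a (u (j - 1)) ∧ ¬ G.Adj a (u i) ∧
      ¬ G.Adj a e := by
    by_cases hjk2 : j = i + k - 2
    · subst hjk2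
      refine ⟨u (i + k - 2), h.adj_left _, ?_, ?_, ?_, ?_, ?_, ?_⟩
      · have := h.adj_right (i + k - 2)
        rwa [show i + k - 2 + 1 = i + k - 1 by ring] at this
      · rw [← h.period_x i]
        exact h.not_adj _ _ (by omega) (by omega)
      · exact h.not_adj_u _ _ (by omega) (by omega)
      · rw [G.adj_comm]
        exact h.not_adj_u _ _ (by omega) (by omega)
      · rw [G.adj_comm]
        exact h.not_adj_u _ _ (by omega) (by omega)
      · rw [G.adj_comm]
        exact heu _ (by omega) (by omega)
    · obtain ⟨l, hl1, hl2, hlj, hlk⟩ := h.exists_apex hG (i := j) (j := i + k - 1) (by omega)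
        (by omega) hjk.symm
      refine ⟨x l, hlj.symm, hlk.symm, ?_, ?_, ?_, ?_, ?_⟩
      · intro hli
        have := hmax l ⟨by omega, by omega, hli.symm, hlk⟩
        omega
      · rw [G.adj_comm, show i + k - 1 = i - 1 + k by ring, h.period_u]
        exact h.not_adj _ _ (by omega) (by omega)
      · rw [G.adj_comm]
        exact h.not_adj _ _ (by omega) (by omega)
      · rw [G.adj_comm]
        exact h.not_adj _ _ (by omega) (by omega)
      · rw [G.adj_comm]
        exact hex _ (by omega) (by omega)
  have hik : x (i + k - 1 + 1) = x i := by rw [show i + k - 1 + 1 = i + k by ring, h.period_x]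
  have f03 := had
  have f12 := hji.symm
  have f13 : ¬ G.Adj (x j) (u (i + k - 1)) := by
    rw [G.adj_comm, show i + k - 1 = i - 1 + k by ring, h.period_u]
    exact h.not_adj _ _ (by omega) (by omega)
  have f15 : G.Adj (x j) (u (j - 1)) := by
    have := h.adj_right (j - 1)
    rw [sub_add_cancel] at this
    exact this.symm
  have f16 : ¬ G.Adj (x j) (u i) := by
    rw [G.adj_comm]
    exact h.not_adj _ _ (by omega) (by omega)
  have f17 : ¬ G.Adj (x j) e := by
    rw [G.adj_comm]
    exact hex _ (by omega) (by omega)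
  have f23 : G.Adj (x i) (u (i + k - 1)) := hik ▸ (h.adj_right (i + k - 1)).symm
  have f24 : G.Adj (x i) (x (i + k - 1)) := (h.adj_x_period i).symm
  have f25 : ¬ G.Adj (x i) (u (j - 1)) := by
    rw [G.adj_comm, ← h.period_x i]
    exact h.not_adj _ _ (by omega) (by omega)
  have f26 := (h.adj_left i).symm
  have f27 : ¬ G.Adj (x i) e := by rwa [G.adj_comm]
  have f34 := h.adj_left (i + k - 1)
  have f35 : ¬ G.Adj (u (i + k - 1)) (u (j - 1)) := by
    rw [G.adj_comm]
    exact h.not_adj_u _ _ (by omega) (by omega)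
  have f36 : ¬ G.Adj (u (i + k - 1)) (u i) := by
    rw [G.adj_comm]
    exact h.not_adj_u _ _ (by omega) (by omega)
  have f37 : ¬ G.Adj (u (i + k - 1)) e := by
    rw [G.adj_comm]
    exact heu _ (by omega) (by omega)
  have f45 : ¬ G.Adj (x (i + k - 1)) (u (j - 1)) := by
    rw [G.adj_comm]
    exact h.not_adj _ _ (by omega) (by omega)
  have f46 : ¬ G.Adj (x (i + k - 1)) (u i) := by
    rw [G.adj_comm]
    exact h.not_adj _ _ (by omega) (by omega)
  have f47 : ¬ G.Adj (x (i + k - 1)) e := by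
    rw [G.adj_comm]
    exact hex _ (by omega) (by omega)
  have f56 : ¬ G.Adj (u (j - 1)) (u i) := by
    rw [G.adj_comm]
    exact h.not_adj_u _ _ (by omega) (by omega)
  have f57 : ¬ G.Adj (u (j - 1)) e := by
    rw [G.adj_comm]
    exact heu _ (by omega) (by omega)
  refine hgem (extendedGem_isIndContained
    ![a, x j, x i, u (i + k - 1), x (i + k - 1), u (j - 1), u i, e] ?_)
  intro p q hpq
  fin_cases p <;> fin_cases q <;> first
    | exact absurd hpq (by decide)
    | (simp [extendedGem, *]; done)
    | simp [extendedGem, *, hjk.symm, he.symm]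

end PeriodicSun
end SimpleGraph

/-! ### Efficient domination of suns and chordality of the square -/

namespace SimpleGraph

variable {V : Type*} {G : SimpleGraph V}

namespace PeriodicSun

variable {k : ℤ} {x u : ℤ → V}

/-- The edge `x (i - 1)`, `x i` has an apex on the long arc, and `not_exists_common_neighbor` leaves
only `x (i + 1)`. -/
theorem adj_around_of_not_adj_left (h : G.PeriodicSun k x u) (hG : G.IsChordalGraph)
    (hgem : extendedGem.InducedFree G) {e : V} {i : ℤ}
    (he : G.Adj e (u i)) (hx : e ≠ x i) (hx' : ¬ G.Adj e (x i)) :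
    G.Adj (x (i + k - 1)) (x (i + 1)) := by
  have h4 := h.four_le
  obtain ⟨l, h1, h2, h3, h5⟩ := h.exists_apex hG (i := i) (j := i + k - 1) (by omega) le_rfl
    (h.adj_x_period i).symm
  rcases h1.eq_or_lt with rfl | h1
  · exact h5
  · exact absurd ⟨h3, h5⟩
      (h.not_exists_common_neighbor hG hgem he hx hx' (by omega) (by omega))

theorem adj_around_of_not_adj_right (h : G.PeriodicSun k x u) (hG : G.IsChordalGraph)
    (hgem : extendedGem.InducedFree G) {e : V} {i : ℤ}
    (he : G.Adj e (u i)) (hx : e ≠ x (i + 1)) (hx' : ¬ G.Adj e (x (i + 1))) :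
    G.Adj (x i) (x (i + 2)) := by
  have h1 : -(-1 - i) = i + 1 := by ring
  have h2 : -1 - (-1 - i) = i := by ring
  have := h.reflect.adj_around_of_not_adj_left hG hgem (e := e) (i := -1 - i)
    (by rwa [h2]) (by rwa [h1]) (by rwa [h1])
  rw [show -(-1 - i + 1) = i by ring, ← h.period_x,
    show -(-1 - i + k - 1) + k = i + 2 by ring] at this
  exact this.symm

/-- The chord bypasses `x (i + 1)`: the arc from `x (i + 2)` to `x (i - 2)` alone provides an apex
for the edge `x (i - 1)`, `x i`, which is excluded. -/
theorem not_of_adj_around (h : G.PeriodicSun k x u) (hG : G.IsChordalGraph)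
    (hgem : extendedGem.InducedFree G) {e : V} {i : ℤ}
    (he : G.Adj e (u i)) (hx : e ≠ x i) (hx' : ¬ G.Adj e (x i)) :
    ¬ G.Adj (x i) (x (i + 2)) := by
  intro h2
  have h4 := h.four_le
  obtain ⟨z, ⟨l, hl1, hl2, rfl⟩, h3, h5⟩ := hG.exists_common_neighbor (h.adj_x_period i).symm
    (P := fun z => ∃ l, i + 2 ≤ l ∧ l ≤ i + k - 2 ∧ z = x l)
    (by
      rintro ⟨l, h1, h2, he⟩
      exact h.ne_x i l (by omega) (by omega) he)
    (by
      rintro ⟨l, h1, h2, he⟩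
      exact h.ne_x l (i + k - 1) (by omega) (by omega) he.symm)
    (c := x (i + 2)) (c' := x (i + k - 2)) ⟨i + 2, le_rfl, by omega, rfl⟩ h2
    (by
      have := h.adj_x (i + k - 2)
      rw [show i + k - 2 + 1 = i + k - 1 by ring] at this
      exact this.symm)
    (h.reach (by omega) fun l h1 h2 => ⟨l, by omega, by omega, rfl⟩)
  exact h.not_exists_common_neighbor hG hgem he hx hx' hl1 hl2 ⟨h3, h5⟩

/-- In an extended-gem-free chordal graph, an efficient dominating set dominates each `u i` by a
vertex that dominates `x i`. -/
theorem dominates_left (h : G.PeriodicSun k x u) (hG : G.IsChordalGraph)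
    (hgem : extendedGem.InducedFree G) {D : Finset V} (hD : G.IsEfficientDominatingSet D)
    {d : V} (hd : d ∈ D) {i : ℤ} (hdu : d = u i ∨ G.Adj d (u i)) :
    d = x i ∨ G.Adj d (x i) := by
  by_contra hcon
  push Not at hcon
  obtain ⟨hx, hx'⟩ := hcon
  have he : G.Adj d (u i) := hdu.resolve_left fun h' => hx' (h' ▸ h.adj_left i)
  -- In both cases the chord `x i`, `x (i + 2)` arises. If `d` misses `x (i + 1)`, it comes from `u
  -- i`. Otherwise efficiency prevents the dominator `f` of `u (i + 1)` from dominating `x (i + 1)`,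
  -- and it comes from `u (i + 1)`.
  by_cases hR : d = x (i + 1) ∨ G.Adj d (x (i + 1))
  · obtain ⟨f, ⟨hf, hfu⟩, -⟩ := hD (u (i + 1))
    have hfd : f = x (i + 1) ∨ G.Adj f (x (i + 1)) → f = d := fun h' =>
      (hD (x (i + 1))).unique ⟨hf, h'⟩ ⟨hd, hR⟩
    have hfx : ¬ (f = x (i + 1) ∨ G.Adj f (x (i + 1))) := by
      intro h'
      obtain rfl := hfd h'
      rcases hfu with rfl | hfu
      · exact h.not_adj_u i (i + 1) le_rfl (by have := h.four_le; omega) he.symm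
      · exact (h.adj_left_of_adj hG he hfu).elim hx hx'
    rw [not_or] at hfx
    have hfu' : G.Adj f (u (i + 1)) := hfu.resolve_left fun h' =>
      hfx.2 (h' ▸ h.adj_left (i + 1))
    have := h.adj_around_of_not_adj_left hG hgem hfu' hfx.1 hfx.2
    rw [show i + 1 + k - 1 = i + k by ring, h.period_x, show i + 1 + 1 = i + 2 by ring] at this
    exact h.not_of_adj_around hG hgem he hx hx' this
  · rw [not_or] at hR
    exact h.not_of_adj_around hG hgem he hx hx'
      (h.adj_around_of_not_adj_right hG hgem he hR.1 hR.2)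

theorem dominates_right (h : G.PeriodicSun k x u) (hG : G.IsChordalGraph)
    (hgem : extendedGem.InducedFree G) {D : Finset V} (hD : G.IsEfficientDominatingSet D)
    {d : V} (hd : d ∈ D) {i : ℤ} (hdu : d = u i ∨ G.Adj d (u i)) :
    d = x (i + 1) ∨ G.Adj d (x (i + 1)) := by
  have h1 : -(-1 - i) = i + 1 := by ring
  have h2 : -1 - (-1 - i) = i := by ring
  have := h.reflect.dominates_left hG hgem hD hd (i := -1 - i) (by rwa [h2])
  rwa [h1] at this

/-- The dominators of `u i` and `u (i + 1)` both dominate `x (i + 1)` and so coincide. Then one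
vertex dominates `u 0` and `u 2`, which are far apart because `k ≥ 4`. -/
theorem not_isEfficientDominatingSet (h : G.PeriodicSun k x u) (hG : G.IsChordalGraph)
    (hgem : extendedGem.InducedFree G) (D : Finset V) : ¬ G.IsEfficientDominatingSet D := by
  intro hD
  have h4 := h.four_le
  have step : ∀ i d d', d ∈ D → d' ∈ D → (d = u i ∨ G.Adj d (u i)) →
      (d' = u (i + 1) ∨ G.Adj d' (u (i + 1))) → d = d' := fun i d d' hd hd' hdu hdu' =>
    (hD (x (i + 1))).unique ⟨hd, h.dominates_right hG hgem hD hd hdu⟩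
      ⟨hd', h.dominates_left hG hgem hD hd' hdu'⟩
  obtain ⟨d0, ⟨hd0, h0⟩, -⟩ := hD (u 0)
  obtain ⟨d1, ⟨hd1, h1⟩, -⟩ := hD (u (0 + 1))
  obtain ⟨d2, ⟨hd2, h2⟩, -⟩ := hD (u (0 + 1 + 1))
  obtain rfl := step _ _ _ hd0 hd1 h0 h1
  obtain rfl := step _ _ _ hd0 hd2 h1 h2
  exact h.not_close 0 (0 + 1 + 1) (by omega) (by omega) ⟨d0, h0, h2⟩

end PeriodicSun

/-- The square of a graph. -/
def square (G : SimpleGraph V) : SimpleGraph V where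
  Adj a b := a ≠ b ∧ G.Close a b
  symm := ⟨fun _ _ h => ⟨h.1.symm, h.2.symm⟩⟩
  loopless := ⟨fun _ h => h.1 rfl⟩

/-- A chordless cycle of the square of a chordal graph gives rise to a sun. -/
theorem exists_periodicSun (hG : G.IsChordalGraph) {k : ℤ} (hk : 4 ≤ k) {v : ℤ → V}
    (hper : ∀ i, v (i + k) = v i) (hclose : ∀ i, G.Close (v i) (v (i + 1)))
    (hfar : ∀ i j, i + 2 ≤ j → j ≤ i + k - 2 → ¬ G.Close (v i) (v j)) :
    ∃ x u, G.PeriodicSun k x u := by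
  -- The common dominator is chosen as a function of the two vertices, not of the index, so `x`
  -- inherits the period of `v`.
  have hch : ∀ a b, ∃ c, G.Close a b → (c = a ∨ G.Adj c a) ∧ (c = b ∨ G.Adj c b) := by
    intro a b
    by_cases h : G.Close a b
    · obtain ⟨c, hc⟩ := h
      exact ⟨c, fun _ => hc⟩
    · exact ⟨a, fun h' => absurd h' h⟩
  choose f hf using hch
  set x : ℤ → V := fun i => f (v i) (v (i + 1)) with hx
  have hx1 : ∀ i, x i = v i ∨ G.Adj (x i) (v i) := fun i => (hf _ _ (hclose i)).1
  have hx2 : ∀ i, x i = v (i + 1) ∨ G.Adj (x i) (v (i + 1)) := fun i => (hf _ _ (hclose i)).2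
  have hxper : ∀ i, x (i + k) = x i := by
    intro i
    simp only [hx]
    rw [hper, show i + k + 1 = i + 1 + k by ring, hper]
  -- a vertex dominating both `v i` and `x j` cannot exist for far `i`, `j`
  have hvx : ∀ i j, i + 1 ≤ j → j ≤ i + k - 2 → ¬ (x j = v i ∨ G.Adj (x j) (v i)) := by
    intro i j h1 h2 h
    rcases h1.eq_or_lt with rfl | h1
    · exact hfar i (i + 1 + 1) (by omega) (by omega) ⟨_, h, hx2 _⟩
    · exact hfar i j (by omega) (by omega) ⟨_, h, hx1 _⟩
  have hxx : ∀ i j, i + 1 ≤ j → j ≤ i + k - 1 → x i ≠ x j := by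
    intro i j h1 h2 h
    rcases h2.eq_or_lt with rfl | h2
    · exact hvx (i + 1) (i + k - 1) (by omega) (by omega) (h ▸ hx2 i)
    · exact hvx i j (by omega) (by omega) (h ▸ hx1 i)
  have hvne : ∀ i j, i + 1 ≤ j → j ≤ i + k - 1 → v i ≠ v j := by
    intro i j h1 h2 h
    rcases h2.eq_or_lt with rfl | h2
    · refine hvx (i + k - 1) (i + k) (by omega) (by omega) ?_
      rw [hxper, ← h]
      exact hx1 i
    · exact hvx i j h1 (by omega) (h ▸ hx1 j)
  -- the walk `v i, x i, v (i + 1), ...`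
  have reach : ∀ (P : V → Prop) i j, i ≤ j → (∀ l, i ≤ l → l ≤ j → P (x l)) →
      (∀ l, i + 1 ≤ l → l ≤ j → P (v l)) →
      Relation.ReflTransGen (fun y z => P z ∧ G.Adj y z) (x i) (x j) := by
    intro P i j hij
    induction j, hij using Int.leInduction with
    | base => exact fun _ _ => .refl
    | succ j hij ih =>
      intro h1 h2
      have e1 : Relation.ReflTransGen (fun y z => P z ∧ G.Adj y z) (x j) (v (j + 1)) := by
        rcases hx2 j with h | h
        · rw [h]
        · exact .single ⟨h2 _ (by omega) le_rfl, h⟩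
      have e2 : Relation.ReflTransGen (fun y z => P z ∧ G.Adj y z) (v (j + 1)) (x (j + 1)) := by
        rcases hx1 (j + 1) with h | h
        · rw [h]
        · exact .single ⟨h1 _ (by omega) le_rfl, h.symm⟩
      exact ((ih (fun l h3 h4 => h1 l h3 (by omega)) fun l h3 h4 => h2 l h3 (by omega)).trans
        e1).trans e2
  -- An edge `v i`, `v (i + 1)` would form a triangle with a vertex of the rest of the closed walk,
  -- which would bring one of its ends close to a far `v l`.
  have hnadj1 : ∀ i, ¬ G.Adj (v i) (v (i + 1)) := by
    intro i hadj
    have hne1 : x (i + 1) ≠ v (i + 1) := fun h' =>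
      hfar i (i + 1 + 1) (by omega) (by omega) ⟨_, Or.inr (h' ▸ hadj.symm), hx2 (i + 1)⟩
    have hne2 : x (i + k - 1) ≠ v i := by
      intro h'
      have := hx1 (i + k - 1)
      refine hfar (i + 1) (i + k - 1) (by omega) (by omega) ⟨x (i + k - 1), Or.inr ?_, this⟩
      rw [h']
      exact hadj
    obtain ⟨z, hz, h3, h5⟩ := hG.exists_common_neighbor hadj.symm
      (P := fun z => (∃ l, i + 1 ≤ l ∧ l ≤ i + k - 1 ∧ z = x l) ∨
        ∃ l, i + 2 ≤ l ∧ l ≤ i + k - 1 ∧ z = v l)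
      (by
        rintro (⟨l, h1, h2, h'⟩ | ⟨l, h1, h2, h'⟩)
        · rcases h1.eq_or_lt with rfl | h1
          · exact hne1 h'.symm
          · exact hvx (i + 1) l (by omega) (by omega) (Or.inl h'.symm)
        · exact hvne (i + 1) l (by omega) (by omega) h')
      (by
        rintro (⟨l, h1, h2, h'⟩ | ⟨l, h1, h2, h'⟩)
        · rcases h2.eq_or_lt with rfl | h2
          · exact hne2 h'.symm
          · exact hvx i l (by omega) (by omega) (Or.inl h'.symm)
        · exact hvne i l (by omega) (by omega) h')
      (c := x (i + 1)) (c' := x (i + k - 1)) (Or.inl ⟨_, le_rfl, by omega, rfl⟩)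
      ((hx1 (i + 1)).resolve_left hne1).symm
      (by
        have := hx2 (i + k - 1)
        rw [show i + k - 1 + 1 = i + k by ring, hper] at this
        exact (this.resolve_left hne2).symm)
      (reach _ _ _ (by omega) (fun l h1 h2 => Or.inl ⟨l, by omega, by omega, rfl⟩)
        (fun l h1 h2 => Or.inr ⟨l, by omega, by omega, rfl⟩))
    rcases hz with ⟨l, h1, h2, rfl⟩ | ⟨l, h1, h2, rfl⟩
    · rcases h2.eq_or_lt with rfl | h2
      · exact hvx (i + 1) (i + k - 1) (by omega) (by omega) (Or.inr h3.symm)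
      · exact hvx i l (by omega) (by omega) (Or.inr h5.symm)
    · rcases h2.eq_or_lt with rfl | h2
      · exact hfar (i + 1) (i + k - 1) (by omega) (by omega) (.of_adj h3)
      · exact hfar i l (by omega) (by omega) (.of_adj h5)
  have hA1 : ∀ i, G.Adj (v i) (x i) := by
    intro i
    refine ((hx1 i).resolve_left fun h' => ?_).symm
    rcases hx2 i with h | h
    · exact hvne i (i + 1) le_rfl (by omega) (h'.symm.trans h)
    · exact hnadj1 i (h' ▸ h)
  have hA2 : ∀ i, G.Adj (v (i + 1)) (x i) := by
    intro i
    refine ((hx2 i).resolve_left fun h' => ?_).symm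
    rcases hx1 i with h | h
    · exact hvne i (i + 1) le_rfl (by omega) (h.symm.trans h')
    · exact hnadj1 i (h' ▸ h).symm
  have hnadj : ∀ i j, i + 1 ≤ j → j ≤ i + k - 1 → ¬ G.Adj (v i) (v j) := by
    intro i j h1 h2 h
    rcases h1.eq_or_lt with rfl | h1
    · exact hnadj1 i h
    rcases h2.eq_or_lt with rfl | h2
    · refine hnadj1 (i + k - 1) ?_
      rw [show i + k - 1 + 1 = i + k by ring, hper]
      exact h.symm
    · exact hfar i j (by omega) (by omega) (.of_adj h)
  -- The vertex attached to the edge `x i`, `x (i + 1)` is `v (i + 1)`, which both of its ends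
  -- dominate.
  refine ⟨x, fun i => v (i + 1), ⟨hk, hxper, ?_, hA2, fun i => hA1 (i + 1), ?_, ?_, ?_, ?_, hxx⟩⟩
  · intro i
    rw [show i + k + 1 = i + 1 + k by ring, hper]
  · intro i j h1 h2 h
    exact hvx (i + 1) j (by omega) (by omega) (Or.inr h.symm)
  · exact fun i j h1 h2 => hnadj _ _ (by omega) (by omega)
  · exact fun i j h1 h2 => hfar _ _ (by omega) (by omega)
  · intro i
    -- The edge `x (i + 1)`, `v (i + 1)` sees the walk from `v (i + 2)` round to `x (i + k) = x i`,
    -- where only `x i` is adjacent to `v (i + 1)`.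
    obtain ⟨z, hz, h3, h5⟩ := hG.exists_common_neighbor (hA1 (i + 1)).symm
      (P := fun z => (∃ l, i + 2 ≤ l ∧ l ≤ i + k ∧ z = x l) ∨
        ∃ l, i + 2 ≤ l ∧ l ≤ i + k ∧ z = v l)
      (by
        rintro (⟨l, h1, h2, h'⟩ | ⟨l, h1, h2, h'⟩)
        · exact hxx (i + 1) l (by omega) (by omega) h'
        · rcases h1.eq_or_lt with rfl | h1
          · have := hA2 (i + 1)
            rw [show i + 1 + 1 = i + 2 by ring] at this
            exact this.ne h'.symm
          · refine hvx l (i + 1 + k) (by omega) (by omega) (Or.inl ?_)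
            rw [hxper]
            exact h')
      (by
        rintro (⟨l, h1, h2, h'⟩ | ⟨l, h1, h2, h'⟩)
        · rcases h2.eq_or_lt with rfl | h2
          · rw [hxper] at h'
            exact (hA2 i).ne h'
          · exact hvx (i + 1) l (by omega) (by omega) (Or.inl h'.symm)
        · exact hvne (i + 1) l (by omega) (by omega) h')
      (c := v (i + 2)) (c' := x (i + k)) (Or.inr ⟨_, le_rfl, by omega, rfl⟩)
      (by
        have := hA2 (i + 1)
        rw [show i + 1 + 1 = i + 2 by ring] at this
        exact this.symm)
      (by
        rw [hxper]
        exact hA2 i)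
      (Relation.ReflTransGen.trans (.single ⟨Or.inl ⟨_, le_rfl, by omega, rfl⟩, hA1 (i + 2)⟩)
        (reach _ _ _ (by omega) (fun l h1 h2 => Or.inl ⟨l, by omega, by omega, rfl⟩)
          (fun l h1 h2 => Or.inr ⟨l, by omega, by omega, rfl⟩)))
    rcases hz with ⟨l, h1, h2, rfl⟩ | ⟨l, h1, h2, rfl⟩
    · rcases h2.eq_or_lt with rfl | h2
      · rw [hxper] at h3
        exact h3.symm
      · exact absurd (Or.inr h5.symm) (hvx (i + 1) l (by omega) (by omega))
    · exact absurd h5 (hnadj (i + 1) l (by omega) (by omega))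

/-- The square of an extended-gem-free chordal graph with an efficient dominating set is
chordal. -/
theorem IsChordalGraph.square (hG : G.IsChordalGraph) (hgem : extendedGem.InducedFree G)
    {D : Finset V} (hD : G.IsEfficientDominatingSet D) : G.square.IsChordalGraph := by
  rintro k hk ⟨φ⟩
  have hk0 : (0 : ℤ) < k := by omega
  have hlt : ∀ i : ℤ, (i % k).toNat < k := fun i => by
    have := Int.emod_lt_of_pos i hk0
    omega
  have hnn : ∀ i : ℤ, 0 ≤ i % (k : ℤ) := fun i => Int.emod_nonneg i hk0.ne'
  set v : ℤ → V := fun i => φ ⟨(i % k).toNat, hlt i⟩ with hv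
  have hadj : ∀ i j : ℤ, i < j → j < i + k →
      (v i ≠ v j ∧ (G.Close (v i) (v j) ↔ j = i + 1 ∨ j + 1 = i + k)) := by
    intro i j hij hj
    have hi1 := hnn i
    have hi2 := Int.emod_lt_of_pos i hk0
    have hne : v i ≠ v j ∧ (G.square.Adj (v i) (v j) ↔ j = i + 1 ∨ j + 1 = i + k) := by
      -- Since `0 < j - i < k`, the residue either advances by `j - i` or wraps around once.
      have hmod : (j % k = i % k + (j - i) ∧ i % k + (j - i) < k) ∨
          (j % k = i % k + (j - i) - k ∧ (k : ℤ) ≤ i % k + (j - i)) := by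
        have e : j % (k : ℤ) = (i % k + (j - i)) % k := by
          rw [Int.emod_add_emod]
          congr 1
          ring
        rcases lt_or_ge (i % (k : ℤ) + (j - i)) k with h | h
        · left
          rw [e, Int.emod_eq_of_lt (by omega) h]
          exact ⟨rfl, h⟩
        · right
          rw [e, ← Int.sub_emod_right, Int.emod_eq_of_lt (by omega) (by omega)]
          exact ⟨rfl, h⟩
      have hj1 := hnn j
      have hj2 := Int.emod_lt_of_pos j hk0
      constructor
      · intro h
        have := congrArg Fin.val (φ.injective h)
        simp only at this
        omega
      · change G.square.Adj (φ _) (φ _) ↔ _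
        rw [φ.map_adj_iff]
        rcases hmod with ⟨h1, h2⟩ | ⟨h1, h2⟩
        · rw [cycleGraph_adj_iff_of_lt (by omega) (by simp only; omega)]
          simp only
          omega
        · rw [adj_comm, cycleGraph_adj_iff_of_lt (by omega) (by simp only; omega)]
          simp only
          omega
    refine ⟨hne.1, ?_⟩
    rw [← hne.2]
    exact ⟨fun h => ⟨hne.1, h⟩, fun h => h.2⟩
  obtain ⟨x, u, hs⟩ := exists_periodicSun hG (k := k) (v := v) (by omega)
    (by
      intro i
      simp only [hv, Int.add_emod_right])
    (fun i => (hadj i (i + 1) (by omega) (by omega)).2.2 (Or.inl rfl))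
    (fun i j h1 h2 h => by
      have := (hadj i j (by omega) (by omega)).2.1 h
      omega)
  exact hs.not_isEfficientDominatingSet hG hgem D hD

end SimpleGraph

/-! ### Simplicial vertices of chordal graphs -/

namespace SimpleGraph

variable {V : Type*} {G : SimpleGraph V}

/-- The neighbors of `v` in `S` are pairwise adjacent. -/
def SimplicialIn (G : SimpleGraph V) (S : Finset V) (v : V) : Prop :=
  ∀ a ∈ S, ∀ b ∈ S, G.Adj v a → G.Adj v b → a ≠ b → G.Adj a b

theorem reflTransGen_adj_symm {P : V → Prop} {a b : V} (ha : P a)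
    (h : Relation.ReflTransGen (fun y z => P z ∧ G.Adj y z) a b) :
    Relation.ReflTransGen (fun y z => P z ∧ G.Adj y z) b a := by
  induction h using Relation.ReflTransGen.head_induction_on with
  | refl => exact .refl
  | head hac _ ih => exact (ih hac.1).tail ⟨ha, hac.2.symm⟩

/-- The second claim strengthens the induction. Let `C` be the component of `w` among the
non-neighbors of `v`, and `B` the set of neighbors of `v` that see `C`. A vertex of `C` has all its
neighbors in `C ∪ B`, so it suffices to find one that is simplicial there. -/
theorem IsChordalGraph.exists_simplicialIn_aux (hG : G.IsChordalGraph) (m : ℕ) :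
    ∀ S : Finset V, S.card = m → (S.Nonempty → ∃ u ∈ S, G.SimplicialIn S u) ∧
      ∀ v ∈ S, (∃ w ∈ S, w ≠ v ∧ ¬ G.Adj v w) →
        ∃ u ∈ S, u ≠ v ∧ ¬ G.Adj v u ∧ G.SimplicialIn S u := by
  classical
  induction m using Nat.strong_induction_on with
  | _ m ih =>
  intro S hS
  have second : ∀ v ∈ S, (∃ w ∈ S, w ≠ v ∧ ¬ G.Adj v w) →
      ∃ u ∈ S, u ≠ v ∧ ¬ G.Adj v u ∧ G.SimplicialIn S u := by
    rintro v hv ⟨w, hw, hwv, hadj⟩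
    set N : V → Prop := fun z => z ∈ S ∧ z ≠ v ∧ ¬ G.Adj v z with hN
    set C : Finset V := S.filter fun z =>
      N z ∧ Relation.ReflTransGen (fun y z => N z ∧ G.Adj y z) w z with hC
    set B : Finset V := S.filter fun b => G.Adj v b ∧ ∃ c ∈ C, G.Adj b c with hB
    have memC : ∀ z, z ∈ C ↔ N z ∧ Relation.ReflTransGen (fun y z => N z ∧ G.Adj y z) w z := by
      intro z
      simp only [hC, hN, Finset.mem_filter]
      tauto
    have memB : ∀ z, z ∈ B ↔ z ∈ S ∧ G.Adj v z ∧ ∃ c ∈ C, G.Adj z c := by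
      intro z
      simp only [hB, Finset.mem_filter]
    have hwN : N w := ⟨hw, hwv, hadj⟩
    have hwC : w ∈ C := (memC w).2 ⟨hwN, .refl⟩
    have hCB : ∀ c ∈ C, ∀ z ∈ S, G.Adj c z → z ∈ C ∪ B := by
      intro c hc z hz hcz
      rw [Finset.mem_union]
      by_cases hvz : G.Adj v z
      · exact Or.inr ((memB z).2 ⟨hz, hvz, c, hc, hcz.symm⟩)
      · have hc' := (memC c).1 hc
        have hzN : N z := ⟨hz, fun h => hc'.1.2.2 (h ▸ hcz.symm), hvz⟩
        exact Or.inl ((memC z).2 ⟨hzN, hc'.2.tail ⟨hzN, hcz⟩⟩)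
    have hreach : ∀ c ∈ C, Relation.ReflTransGen (fun y z => z ∈ C ∧ G.Adj y z) w c := by
      intro c hc
      have h2 := ((memC c).1 hc).2
      clear hc
      induction h2 with
      | refl => exact .refl
      | @tail y z hy hyz ih' => exact ih'.tail ⟨(memC z).2 ⟨hyz.1, hy.tail hyz⟩, hyz.2⟩
    -- For non-adjacent `a`, `b` in `B`, the edge `a`, `v` sees the connected set `C ∪ {b}`. No
    -- vertex of `C` is adjacent to `v`, so the apex would be `b`.
    have clique : ∀ a ∈ B, ∀ b ∈ B, a ≠ b → G.Adj a b := by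
      intro a ha b hb hab
      by_contra hnadj
      obtain ⟨-, hva, c, hc, hac⟩ := (memB a).1 ha
      obtain ⟨-, hvb, c', hc', hbc⟩ := (memB b).1 hb
      have path : Relation.ReflTransGen (fun y z => (z ∈ C ∨ z = b) ∧ G.Adj y z) c b := by
        have h1 := (reflTransGen_adj_symm hwC (hreach c hc)).trans (hreach c' hc')
        have h2 : Relation.ReflTransGen (fun y z => (z ∈ C ∨ z = b) ∧ G.Adj y z) c c' :=
          Relation.ReflTransGen.mono (fun y z h => ⟨Or.inl h.1, h.2⟩) _ _ h1
        exact h2.tail ⟨Or.inr rfl, hbc.symm⟩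
      obtain ⟨z, hz | hz, h1, h2⟩ := hG.exists_common_neighbor hva.symm
        (P := fun z => z ∈ C ∨ z = b)
        (by
          rintro (h | h)
          · exact ((memC a).1 h).1.2.2 hva
          · exact hab h)
        (by
          rintro (h | h)
          · exact ((memC v).1 h).1.2.1 rfl
          · exact hvb.ne h)
        (Or.inl hc) hac hvb path
      · exact ((memC z).1 hz).1.2.2 h2
      · exact hnadj (hz ▸ h1)
    have hsub : C ∪ B ⊆ S.erase v := by
      intro z hz
      rw [Finset.mem_erase]
      rcases Finset.mem_union.1 hz with h | h
      · exact ⟨((memC z).1 h).1.2.1, ((memC z).1 h).1.1⟩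
      · exact ⟨((memB z).1 h).2.1.ne', ((memB z).1 h).1⟩
    have hcard : (C ∪ B).card < m := by
      have h1 := Finset.card_le_card hsub
      have h2 := Finset.card_erase_lt_of_mem hv
      omega
    obtain ⟨u, huC, hu⟩ : ∃ u ∈ C, G.SimplicialIn (C ∪ B) u := by
      -- If some `b` in `B` has a non-neighbor, the second claim for `b` gives a vertex not adjacent
      -- to `b`, hence outside the clique `B`. Otherwise `B` is complete to `C ∪ B`, and a
      -- simplicial vertex of `C` remains simplicial.
      by_cases hex : ∃ b ∈ B, ∃ z ∈ C ∪ B, z ≠ b ∧ ¬ G.Adj b z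
      · obtain ⟨b, hb, hex⟩ := hex
        obtain ⟨u, hu, hub, hbu, hsimp⟩ :=
          (ih _ hcard _ rfl).2 b (Finset.mem_union_right _ hb) hex
        rcases Finset.mem_union.1 hu with h | h
        · exact ⟨u, h, hsimp⟩
        · exact absurd (clique b hb u h hub.symm) hbu
      · push Not at hex
        obtain ⟨u, hu, hsimp⟩ := (ih C.card
          ((Finset.card_le_card Finset.subset_union_left).trans_lt hcard) C rfl).1 ⟨w, hwC⟩
        refine ⟨u, hu, fun a ha b hb hua hub hab => ?_⟩
        rcases Finset.mem_union.1 ha with h | h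
        · rcases Finset.mem_union.1 hb with h' | h'
          · exact hsimp a h b h' hua hub hab
          · exact (hex b h' a ha hab).symm
        · exact hex a h b hb hab.symm
    have huN := ((memC u).1 huC).1
    exact ⟨u, huN.1, huN.2.1, huN.2.2, fun a ha b hb hua hub hab =>
      hu a (hCB u huC a ha hua) b (hCB u huC b hb hub) hua hub hab⟩
  refine ⟨fun ⟨v, hv⟩ => ?_, second⟩
  by_cases hex : ∃ v ∈ S, ∃ w ∈ S, w ≠ v ∧ ¬ G.Adj v w
  · obtain ⟨v, hv, hw⟩ := hex
    obtain ⟨u, hu, -, -, hsimp⟩ := second v hv hw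
    exact ⟨u, hu, hsimp⟩
  · push Not at hex
    exact ⟨v, hv, fun a ha b hb _ _ hab => hex a ha b hb hab.symm⟩

/-- Dirac's theorem: every nonempty vertex set of a chordal graph has a simplicial vertex. -/
theorem IsChordalGraph.exists_simplicialIn (hG : G.IsChordalGraph) {S : Finset V}
    (hS : S.Nonempty) : ∃ u ∈ S, G.SimplicialIn S u :=
  (hG.exists_simplicialIn_aux _ S rfl).1 hS

end SimpleGraph

/-! ### Maximum weight independent sets and the reduction -/

namespace SimpleGraph

variable {V : Type*}

open Finset in
/-- Frank's algorithm: a maximum weight independent set is found by subtracting the weight of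
simplicial vertices from the weights of their neighbors, and adding positive vertices greedily in
reverse order. -/
theorem maxWeight_of_elimination [Fintype V] [DecidableEq V] {H : SimpleGraph V} {h : V → V → ℕ}
    (hone : ∀ a b, a = b ∨ H.Adj a b → h a b = 1)
    (hzero : ∀ a b, a ≠ b → ¬ H.Adj a b → h a b = 0) {N : ℕ} {u : ℕ → V} {A : ℕ → Finset V}
    (hA : ∀ t v, v ∈ A t ↔ ∀ s < t, u s ≠ v) (hmem : ∀ t < N, u t ∈ A t) (hN : A N = ∅)
    (hsimp : ∀ t < N, H.SimplicialIn (A t) (u t)) {r : ℕ → V → ℕ}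
    (hr : ∀ t < N, ∀ v, r (t + 1) v = r t v - h (u t) v * r t (u t)) {X : ℕ → Finset V}
    (hXN : X N = ∅)
    (hX : ∀ t < N, ∀ v, v ∈ X t ↔ v ∈ X (t + 1) ∨
      (v = u t ∧ 0 < r t (u t) ∧ ∀ z ∈ X (t + 1), h (u t) z = 0)) :
    (∀ a ∈ X 0, ∀ b ∈ X 0, ¬ H.Adj a b) ∧ (∀ a ∈ X 0, 0 < r 0 a) ∧
      ∀ J : Finset V, (∀ a ∈ J, ∀ b ∈ J, ¬ H.Adj a b) → ∑ v ∈ J, r 0 v ≤ ∑ v ∈ X 0, r 0 v := by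
  -- Induction from the last round backwards: `X t` is optimal for the residual weights `r t` on the
  -- vertices `A t` left before round `t`.
  have main : ∀ i ≤ N, X (N - i) ⊆ A (N - i) ∧ (∀ a ∈ X (N - i), ∀ b ∈ X (N - i), ¬ H.Adj a b) ∧
      (∀ a ∈ X (N - i), 0 < r (N - i) a) ∧ ∀ J ⊆ A (N - i), (∀ a ∈ J, ∀ b ∈ J, ¬ H.Adj a b) →
        ∑ v ∈ J, r (N - i) v ≤ ∑ v ∈ X (N - i), r (N - i) v := by
    intro i
    induction i with
    | zero =>
      intro _
      simp only [Nat.sub_zero, hXN, hN]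
      refine ⟨by simp, by simp, by simp, fun J hJ _ => ?_⟩
      rw [Finset.subset_empty.1 hJ]
    | succ i ih =>
      intro hi
      obtain ⟨ih1, ih2, ih3, ih4⟩ := ih (by omega)
      obtain ⟨t, ht, ht1⟩ : ∃ t, N - (i + 1) = t ∧ N - i = t + 1 := ⟨_, rfl, by omega⟩
      have htN : t < N := by omega
      rw [ht1] at ih1 ih2 ih3 ih4
      rw [ht]
      have hAs : ∀ v, v ∈ A (t + 1) ↔ v ∈ A t ∧ v ≠ u t := by
        intro v
        rw [hA, hA]
        constructor
        · exact fun h' => ⟨fun s hs => h' s (by omega), (h' t (by omega)).symm⟩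
        · rintro ⟨h1, h2⟩ s hs
          rcases Nat.lt_succ_iff_lt_or_eq.1 hs with h' | rfl
          · exact h1 s h'
          · exact h2.symm
      have h01 : ∀ v, h (u t) v = 0 ∨ h (u t) v = 1 := by
        intro v
        by_cases h1 : u t = v ∨ H.Adj (u t) v
        · exact Or.inr (hone _ _ h1)
        · rw [not_or] at h1
          exact Or.inl (hzero _ _ h1.1 h1.2)
      have hadj1 : ∀ v, h (u t) v ≠ 0 → u t = v ∨ H.Adj (u t) v := by
        intro v hv
        by_contra hcon
        rw [not_or] at hcon
        exact hv (hzero _ _ hcon.1 hcon.2)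
      -- The closed neighborhood of a simplicial vertex is a clique, so an independent set meets it
      -- at most once. Hence the subtraction in round `t` lowers its weight by at most `r t (u t)`.
      have hsumle : ∀ J ⊆ A t, (∀ a ∈ J, ∀ b ∈ J, ¬ H.Adj a b) → ∑ v ∈ J, h (u t) v ≤ 1 := by
        intro J hJA hJ
        by_contra hcon
        have hcard : 1 < (J.filter fun v => h (u t) v ≠ 0).card := by
          refine (not_le.1 hcon).trans_le ?_
          rw [Finset.card_filter]
          refine Finset.sum_le_sum fun v _ => ?_
          rcases h01 v with h' | h' <;> simp [h']
        obtain ⟨a, ha, b, hb, hab⟩ := Finset.one_lt_card.1 hcard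
        rw [Finset.mem_filter] at ha hb
        rcases hadj1 a ha.2 with rfl | h1
        · rcases hadj1 b hb.2 with rfl | h2
          · exact hab rfl
          · exact hJ _ ha.1 _ hb.1 h2
        · rcases hadj1 b hb.2 with rfl | h2
          · exact hJ _ hb.1 _ ha.1 h1
          · exact hJ _ ha.1 _ hb.1
              (hsimp t htN a (hJA ha.1) b (hJA hb.1) h1 h2 hab)
      have hXsub : X t ⊆ A t := by
        intro v hv
        rcases (hX t htN v).1 hv with h' | ⟨rfl, -⟩
        · exact ((hAs v).1 (ih1 h')).1
        · exact hmem t htN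
      have huX : u t ∉ X (t + 1) := fun h' => ((hAs _).1 (ih1 h')).2 rfl
      have hXind : ∀ a ∈ X t, ∀ b ∈ X t, ¬ H.Adj a b := by
        intro a ha b hb hab
        rcases (hX t htN a).1 ha with h1 | ⟨rfl, -, h1⟩
        · rcases (hX t htN b).1 hb with h2 | ⟨rfl, -, h2⟩
          · exact ih2 a h1 b h2 hab
          · have := h2 a h1
            rw [hone _ _ (Or.inr hab.symm)] at this
            omega
        · rcases (hX t htN b).1 hb with h2 | ⟨rfl, -⟩
          · have := h1 b h2
            rw [hone _ _ (Or.inr hab)] at this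
            omega
          · exact hab.ne rfl
      refine ⟨hXsub, hXind, ?_, ?_⟩
      · intro a ha
        rcases (hX t htN a).1 ha with h' | ⟨rfl, h', -⟩
        · have := ih3 a h'
          rw [hr t htN] at this
          omega
        · exact h'
      · intro J hJA hJ
        have hle : ∑ v ∈ J, r t v ≤ ∑ v ∈ J, r (t + 1) v + r t (u t) := by
          calc ∑ v ∈ J, r t v ≤ ∑ v ∈ J, (r (t + 1) v + h (u t) v * r t (u t)) := by
                refine Finset.sum_le_sum fun v _ => ?_
                rw [hr t htN]
                omega
            _ = ∑ v ∈ J, r (t + 1) v + (∑ v ∈ J, h (u t) v) * r t (u t) := by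
                rw [Finset.sum_add_distrib, Finset.sum_mul]
            _ ≤ ∑ v ∈ J, r (t + 1) v + r t (u t) := by
                have := Nat.mul_le_mul_right (r t (u t)) (hsumle J hJA hJ)
                omega
        have hru : r (t + 1) (u t) = 0 := by
          rw [hr t htN, hone _ _ (Or.inl rfl)]
          omega
        have hJ' : ∑ v ∈ J, r (t + 1) v ≤ ∑ v ∈ X (t + 1), r (t + 1) v := by
          have e : ∑ v ∈ J.erase (u t), r (t + 1) v = ∑ v ∈ J, r (t + 1) v := by
            refine Finset.sum_subset (Finset.erase_subset _ _) fun v hv hv' => ?_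
            rw [Finset.mem_erase, not_and', ne_eq, not_not] at hv'
            rw [hv' hv, hru]
          rw [← e]
          refine ih4 _ (fun v hv => ?_) fun a ha b hb =>
            hJ a (Finset.mem_of_mem_erase ha) b (Finset.mem_of_mem_erase hb)
          rw [Finset.mem_erase] at hv
          exact (hAs v).2 ⟨hJA hv.2, hv.1⟩
        -- Chosen vertices have positive residual weight, so the truncated subtraction was exact on
        -- them.
        have hXr : ∀ v ∈ X (t + 1), r t v = r (t + 1) v + h (u t) v * r t (u t) := by
          intro v hv
          have := ih3 v hv
          rw [hr t htN] at this ⊢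
          omega
        have hXs : ∑ v ∈ X (t + 1), r t v =
            ∑ v ∈ X (t + 1), r (t + 1) v + (∑ v ∈ X (t + 1), h (u t) v) * r t (u t) := by
          rw [Finset.sum_congr rfl hXr, Finset.sum_add_distrib, Finset.sum_mul]
        -- `X t` has to regain the whole of `r t (u t)`. It does so by containing `u t` or a
        -- neighbor of `u t`, unless this weight is zero.
        suffices hs : ∑ v ∈ X (t + 1), r (t + 1) v + r t (u t) ≤ ∑ v ∈ X t, r t v by omega
        by_cases hsel : 0 < r t (u t) ∧ ∀ z ∈ X (t + 1), h (u t) z = 0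
        · have hXt : X t = insert (u t) (X (t + 1)) := by
            ext v
            rw [hX t htN, Finset.mem_insert]
            tauto
          rw [hXt, Finset.sum_insert huX, hXs]
          omega
        · have hXt : X t = X (t + 1) := by
            ext v
            rw [hX t htN]
            tauto
          rw [hXt, hXs]
          by_cases hz : ∀ z ∈ X (t + 1), h (u t) z = 0
          · have : r t (u t) = 0 := by
              by_contra h'
              exact hsel ⟨Nat.pos_of_ne_zero h', hz⟩
            omega
          · push Not at hz
            obtain ⟨z, hz, hz'⟩ := hz
            have h1 : 1 ≤ ∑ v ∈ X (t + 1), h (u t) v :=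
              (Nat.one_le_iff_ne_zero.2 hz').trans
                (Finset.single_le_sum (f := fun v => h (u t) v) (fun _ _ => Nat.zero_le _) hz)
            have := Nat.mul_le_mul_right (r t (u t)) h1
            omega
  have h0 := main N le_rfl
  rw [Nat.sub_self] at h0
  obtain ⟨-, h2, h3, h4⟩ := h0
  refine ⟨h2, h3, fun J hJ => h4 J (fun v _ => ?_) hJ⟩
  rw [hA]
  intro s hs
  omega

/-- The closed neighborhood. -/
noncomputable def closedNbhd [Fintype V] (G : SimpleGraph V) (v : V) : Finset V := by
  classical exact Finset.univ.filter fun b => b = v ∨ G.Adj v b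

theorem mem_closedNbhd [Fintype V] {G : SimpleGraph V} {v b : V} :
    b ∈ G.closedNbhd v ↔ b = v ∨ G.Adj v b := by
  simp [closedNbhd]

theorem IsEfficientDominatingSet.not_square_adj {G : SimpleGraph V} {D : Finset V}
    (hD : G.IsEfficientDominatingSet D) : ∀ a ∈ D, ∀ b ∈ D, ¬ G.square.Adj a b := by
  rintro a ha b hb ⟨hne, c, hca, hcb⟩
  refine hne ((hD c).unique ⟨ha, ?_⟩ ⟨hb, ?_⟩)
  · exact hca.imp Eq.symm Adj.symm
  · exact hcb.imp Eq.symm Adj.symm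

/-- Independence in the square means that the closed neighborhoods are disjoint, so the sum counts
the dominated vertices. -/
theorem sum_card_closedNbhd [Fintype V] {G : SimpleGraph V} {J : Finset V}
    (hJ : ∀ a ∈ J, ∀ b ∈ J, ¬ G.square.Adj a b) :
    ∑ v ∈ J, (G.closedNbhd v).card ≤ Fintype.card V ∧
      (∑ v ∈ J, (G.closedNbhd v).card = Fintype.card V ↔ G.IsEfficientDominatingSet J) := by
  classical
  have key : ∀ c, ∀ a ∈ J, ∀ b ∈ J, c ∈ G.closedNbhd a → c ∈ G.closedNbhd b → a = b := by
    intro c a ha b hb hca hcb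
    by_contra hne
    rw [mem_closedNbhd] at hca hcb
    exact hJ a ha b hb ⟨hne, c, hca.imp id Adj.symm, hcb.imp id Adj.symm⟩
  have hdisj : (J : Set V).PairwiseDisjoint G.closedNbhd := by
    intro a ha b hb hne
    rw [Function.onFun, Finset.disjoint_left]
    exact fun c hca hcb => hne (key c a ha b hb hca hcb)
  rw [← Finset.card_biUnion hdisj]
  refine ⟨Finset.card_le_univ _, ?_⟩
  rw [Finset.card_eq_iff_eq_univ, Finset.eq_univ_iff_forall]
  refine forall_congr' fun c => ?_
  rw [Finset.mem_biUnion]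
  constructor
  · rintro ⟨a, ha, hca⟩
    refine ⟨a, ⟨ha, (mem_closedNbhd.1 hca).imp Eq.symm id⟩, fun b hb => ?_⟩
    exact key c b hb.1 a ha (mem_closedNbhd.2 (hb.2.imp Eq.symm id)) hca
  · rintro ⟨a, ⟨ha, hca⟩, -⟩
    exact ⟨a, ha, mem_closedNbhd.2 (hca.imp Eq.symm id)⟩

open WED in
theorem codeWeight_eq_zero_iff {x : ℕ∞} : codeWeight x = 0 ↔ x = ⊤ := by
  induction x using ENat.recTopCoe with
  | top => exact ⟨fun _ => rfl, fun _ => rfl⟩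
  | coe m => simp [codeWeight]

open WED in
theorem coe_codeWeight_sub_one {x : ℕ∞} (hx : x ≠ ⊤) : ((codeWeight x - 1 : ℕ) : ℕ∞) = x := by
  induction x using ENat.recTopCoe with
  | top => exact absurd rfl hx
  | coe m => simp [codeWeight]

open WED in
/-- Minimum weight efficient domination reduces to maximum weight independent sets of the
square. -/
theorem isMinFiniteWeightEDS_of_maxWeight [Fintype V] {G : SimpleGraph V} {w : V → ℕ∞}
    {c : V → ℕ} {M : ℕ} (hM : ∑ v, codeWeight (w v) < M)
    (hc0 : ∀ v, w v = ⊤ → c v = 0)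
    (hc : ∀ v, w v ≠ ⊤ → c v + codeWeight (w v) = M * (G.closedNbhd v).card + 1)
    (hfin : G.HasFiniteWeightEDS w) {X : Finset V}
    (hX : ∀ a ∈ X, ∀ b ∈ X, ¬ G.square.Adj a b) (hpos : ∀ a ∈ X, 0 < c a)
    (hmax : ∀ J : Finset V, (∀ a ∈ J, ∀ b ∈ J, ¬ G.square.Adj a b) →
      ∑ v ∈ J, c v ≤ ∑ v ∈ X, c v) : G.IsMinFiniteWeightEDS w X := by
  set wn : V → ℕ := fun v => codeWeight (w v) - 1 with hwn
  -- The code of a finite weight exceeds the weight by one, which cancels the `+ 1` in `hc`.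
  have hsum : ∀ J : Finset V, (∀ v ∈ J, w v ≠ ⊤) →
      ∑ v ∈ J, c v + ∑ v ∈ J, wn v = M * ∑ v ∈ J, (G.closedNbhd v).card := by
    intro J hJ
    rw [← Finset.sum_add_distrib, Finset.mul_sum]
    refine Finset.sum_congr rfl fun v hv => ?_
    have h1 := hc v (hJ v hv)
    have h2 : codeWeight (w v) ≠ 0 := fun h => hJ v hv (codeWeight_eq_zero_iff.1 h)
    simp only [hwn]
    omega
  have hcoe : ∀ J : Finset V, (∀ v ∈ J, w v ≠ ⊤) →
      ∑ v ∈ J, w v = ((∑ v ∈ J, wn v : ℕ) : ℕ∞) := by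
    intro J hJ
    rw [Nat.cast_sum]
    exact Finset.sum_congr rfl fun v hv => (coe_codeWeight_sub_one (hJ v hv)).symm
  have htop : ∀ J : Finset V, ∑ v ∈ J, w v ≠ ⊤ → ∀ v ∈ J, w v ≠ ⊤ := by
    intro J hJ v hv h
    refine hJ (top_le_iff.1 ?_)
    rw [← h]
    exact Finset.single_le_sum (f := w) (fun _ _ => zero_le) hv
  have hXfin : ∀ v ∈ X, w v ≠ ⊤ := by
    intro v hv h
    have := hpos v hv
    rw [hc0 v h] at this
    omega
  have hwM : ∀ J : Finset V, ∑ v ∈ J, wn v < M := by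
    intro J
    refine lt_of_le_of_lt ?_ hM
    refine (Finset.sum_le_sum fun v _ => Nat.sub_le _ 1).trans ?_
    exact Finset.sum_le_sum_of_subset (Finset.subset_univ _)
  have hXcard := sum_card_closedNbhd hX
  have hXsum := hsum X hXfin
  have hcmp : ∀ D, G.IsEfficientDominatingSet D → ∑ v ∈ D, w v ≠ ⊤ →
      ∑ v ∈ D, c v + ∑ v ∈ D, wn v = M * Fintype.card V ∧ ∑ v ∈ D, c v ≤ ∑ v ∈ X, c v := by
    intro D hD hDf
    refine ⟨?_, hmax D hD.not_square_adj⟩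
    rw [← (sum_card_closedNbhd hD.not_square_adj).2.2 hD]
    exact hsum D (htop D hDf)
  -- An undominated vertex would cost `X` at least `M` against `D`, while the weight of `D` is less
  -- than `M`.
  have hXeds : G.IsEfficientDominatingSet X := by
    rw [← hXcard.2]
    by_contra hne
    obtain ⟨D, hD, hDf⟩ := hfin
    obtain ⟨h1, h2⟩ := hcmp D hD hDf
    have h3 := hwM D
    have h4 : M * (∑ v ∈ X, (G.closedNbhd v).card + 1) ≤ M * Fintype.card V :=
      Nat.mul_le_mul_left _ (by omega)
    rw [mul_add] at h4
    omega
  refine ⟨hXeds, ?_, fun D hD => ?_⟩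
  · rw [hcoe X hXfin]
    exact ENat.natCast_ne_top _
  · by_cases hDf : ∑ v ∈ D, w v = ⊤
    · rw [hDf]
      exact le_top
    · obtain ⟨h1, h2⟩ := hcmp D hD hDf
      rw [hXcard.2.2 hXeds] at hXsum
      rw [hcoe X hXfin, hcoe D (htop D hDf), Nat.cast_le]
      omega

end SimpleGraph

/-! ### Total correctness with step bounds -/

namespace RAM

/-- From `s` the program `p` halts within `t` steps in a state with the property `Q`. -/
def Post (B : ℕ) (p : Prog) (s : State) (t : ℕ) (Q : State → Prop) : Prop :=
  ∃ t' s', Exec B p s t' s' ∧ t' ≤ t ∧ Q s'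

namespace Post

variable {B : ℕ} {p q : Prog} {s : State} {t t₁ t₂ : ℕ} {Q R : State → Prop}

theorem mono (h : Post B p s t Q) (ht : t ≤ t₁) (hQ : ∀ s', Q s' → R s') : Post B p s t₁ R := by
  obtain ⟨t', s', h1, h2, h3⟩ := h
  exact ⟨t', s', h1, h2.trans ht, hQ s' h3⟩

theorem seq (h : Post B p s t₁ fun s' => Post B q s' t₂ Q) (ht : t₁ + t₂ ≤ t) :
    Post B (.seq p q) s t Q := by
  obtain ⟨t', s', h1, h2, t'', s'', h3, h4, h5⟩ := h
  exact ⟨_, s'', .seq h1 h3, by omega, h5⟩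

theorem assign {r : ℕ} {e : Rhs} (h : e.val s < B)
    (hQ : Q { s with reg := Function.update s.reg r (e.val s) }) (ht : 1 ≤ t) :
    Post B (.assign r e) s t Q :=
  ⟨1, _, .assign s r e h, ht, hQ⟩

theorem store {a b : Operand} (h : b.val s < B)
    (hQ : Q { s with mem := Function.update s.mem (a.val s) (b.val s) }) (ht : 1 ≤ t) :
    Post B (.store a b) s t Q :=
  ⟨1, _, .store s a b h, ht, hQ⟩

theorem assign_seq {r : ℕ} {e : Rhs} (h : e.val s < B)
    (hQ : Post B q { s with reg := Function.update s.reg r (e.val s) } t Q) (ht : t + 1 ≤ t₁) :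
    Post B (.seq (.assign r e) q) s t₁ Q :=
  seq (assign h hQ le_rfl) (by omega)

/-- The new state is known only through equations, so straight-line code does not pile up nested
updates. -/
theorem assign_next {r : ℕ} {e : Rhs} (h : e.val s < B)
    (hQ : ∀ s' : State, s'.mem = s.mem → s'.reg r = e.val s → (∀ r' ≠ r, s'.reg r' = s.reg r') →
      Post B q s' t Q) (ht : t + 1 ≤ t₁) : Post B (.seq (.assign r e) q) s t₁ Q :=
  assign_seq h (hQ _ rfl (Function.update_self _ _ _)
    fun _ hr => Function.update_of_ne hr _ _) ht

/-- A loop that counts register `a` up to the content of register `0`. -/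
theorem count {a n : ℕ} (I : ℕ → State → Prop)
    (hI : ∀ i s, I i s → s.reg a = i ∧ s.reg 0 = n)
    (hstep : ∀ i s, i < n → I i s → Post B p s t₁ (I (i + 1))) (h0 : I 0 s)
    (hQ : ∀ s', I n s' → Q s') (ht : n * (t₁ + 1) + 1 ≤ t) :
    Post B (.loop (.lt (.reg a) (.reg 0)) p) s t Q := by
  have main : ∀ m i s, i + m = n → I i s →
      Post B (.loop (.lt (.reg a) (.reg 0)) p) s (m * (t₁ + 1) + 1) (I n) := by
    intro m
    induction m with
    | zero =>
      intro i s hi hs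
      obtain rfl : i = n := by omega
      obtain ⟨h1, h2⟩ := hI _ _ hs
      refine ⟨1, s, .loop_false ?_, by omega, hs⟩
      simp [Test.Holds, Operand.val, h1, h2]
    | succ m ih =>
      intro i s hi hs
      obtain ⟨h1, h2⟩ := hI _ _ hs
      obtain ⟨t', s', e1, l1, hs'⟩ := hstep i s (by omega) hs
      obtain ⟨t'', s'', e2, l2, hs''⟩ := ih (i + 1) s' (by omega) hs'
      refine ⟨_, s'', .loop_true ?_ e1 e2, ?_, hs''⟩
      · simp only [Test.Holds, Operand.val, h1, h2]
        omega
      · rw [Nat.succ_mul]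
        omega
  exact (main n 0 s (by omega) h0).mono ht hQ

end Post

end RAM

/-! ### A language of bounded loops and its compilation -/

namespace Calc

/-- The state of a calculation: variables and two-dimensional arrays. -/
structure Store where
  v : ℕ → ℕ
  a : ℕ → ℕ → ℕ → ℕ

def Store.setV (s : Store) (x k : ℕ) : Store := { s with v := Function.update s.v x k }

def Store.setA (s : Store) (j p q k : ℕ) : Store :=
  { s with a := fun j' p' q' => if j' = j ∧ p' = p ∧ q' = q then k else s.a j' p' q' }

/-- Expressions; `arr j x y` reads array `j` at the position given by the variables `x` and `y`,
and `sum x e` is the sum of the values of `e` over `x < n`. -/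
inductive Ex where
  | const (c : ℕ)
  | size
  | var (x : ℕ)
  | arr (j x y : ℕ)
  | add (a b : Ex)
  | sub (a b : Ex)
  | mul (a b : Ex)
  | sum (x : ℕ) (e : Ex)

def Ex.eval (n : ℕ) : Ex → Store → ℕ
  | .const c, _ => c
  | .size, _ => n
  | .var x, s => s.v x
  | .arr j x y, s => s.a j (s.v x) (s.v y)
  | .add a b, s => a.eval n s + b.eval n s
  | .sub a b, s => a.eval n s - b.eval n s
  | .mul a b, s => a.eval n s * b.eval n s
  | .sum x e, s => ∑ i ∈ Finset.range n, e.eval n (s.setV x i)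

/-- Statements; `each x p` runs `p` for `x = 0, ..., n - 1`. -/
inductive St where
  | assign (x : ℕ) (e : Ex)
  | store (j x y : ℕ) (e : Ex)
  | seq (p q : St)
  | each (x : ℕ) (p : St)

def iter (f : ℕ → Store → Store) : ℕ → Store → Store
  | 0, s => s
  | i + 1, s => f i (iter f i s)

def St.run (n : ℕ) : St → Store → Store
  | .assign x e, s => s.setV x (e.eval n s)
  | .store j x y e, s => s.setA j (s.v x) (s.v y) (e.eval n s)
  | .seq p q, s => q.run n (p.run n s)
  | .each x p, s => iter (fun i s' => p.run n (s'.setV x i)) n s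

/-! ### Static bounds -/

/-- Variables from `16` on are bounded by powers of the word parameter with these exponents. -/
def varExp (x : ℕ) : ℕ := if x = 16 then 3 else 7

/-- The exponents of the bounds on the array entries. -/
def arrExp : ℕ → ℕ
  | 1 => 1
  | 2 => 1
  | 3 => 7
  | 6 => 1
  | 8 => 7
  | _ => 0

/-- For `2 ≤ P` and `n ≤ P`, an addition or a sum over `n` terms costs one factor `P`. A truncated
difference is bounded by its left operand, so `1 - e` has exponent `0` whatever `e` is. -/
def Ex.exp : Ex → ℕ
  | .const _ => 0
  | .size => 1
  | .var x => if x < 16 then 1 else varExp x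
  | .arr j _ _ => arrExp j
  | .add a b => max a.exp b.exp + 1
  | .sub a _ => a.exp
  | .mul a b => a.exp + b.exp
  | .sum _ e => e.exp + 1

def arrOk (j x y : ℕ) : Bool :=
  (j = 0 && x < 8 && y < 8) || (j = 1 && x < 8 && y = x) || (2 ≤ j && j < 16 && x < 16 && y < 16)

/-- Variables below `8` run over `0, ..., n - 1`, and those from `8` to `15` over `0, ..., n`. -/
def Ex.ok : Ex → Bool
  | .const c => c ≤ 1
  | .size => true
  | .var x => x < 30
  | .arr j x y => arrOk j x y
  | .add a b => a.ok && b.ok && (max a.exp b.exp + 1 ≤ 20)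
  | .sub a b => a.ok && b.ok
  | .mul a b => a.ok && b.ok && (a.exp + b.exp ≤ 20)
  | .sum x e => e.ok && x < 8 && (e.exp + 1 ≤ 20)

/-- The value is at most `n`. -/
def Ex.leSize : Ex → Bool
  | .size => true
  | .var x => x < 16
  | .sub a _ => a.leSize
  | .sum _ e => e.exp = 0
  | _ => false

def St.ok : St → Bool
  | .assign x e => e.ok && ((8 ≤ x && x < 16 && e.leSize) ||
      (16 ≤ x && x < 30 && e.exp ≤ varExp x))
  | .store j x y e => e.ok && arrOk j x y && j ≠ 0 && e.exp ≤ arrExp j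
  | .seq p q => p.ok && q.ok
  | .each x p => x < 8 && p.ok

/-- The positions of the arrays: `0` is the adjacency matrix, `1` holds the weights on its
diagonal. -/
def Valid (n j p q : ℕ) : Prop :=
  (j = 0 ∧ p < n ∧ q < n) ∨ (j = 1 ∧ p < n ∧ q = p) ∨ (2 ≤ j ∧ j < 16 ∧ p ≤ n ∧ q ≤ n)

/-- Even idle loop variables have to be less than `n`, so the empty graph is left to a separate
branch of the final program. -/
structure Bounded (n P : ℕ) (s : Store) : Prop where
  lt_size : ∀ x < 8, s.v x < n
  le_size : ∀ x, 8 ≤ x → x < 16 → s.v x ≤ n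
  var_le : ∀ x, 16 ≤ x → x < 30 → s.v x ≤ P ^ varExp x
  arr_le : ∀ j p q, Valid n j p q → s.a j p q ≤ P ^ arrExp j

variable {n P : ℕ}

theorem Bounded.var_le_size {s : Store} (h : Bounded n P s) {x : ℕ} (hx : x < 16) :
    s.v x ≤ n := by
  by_cases h8 : x < 8
  · exact (h.lt_size x h8).le
  · exact h.le_size x (by omega) hx

theorem Bounded.setV_loop {s : Store} (h : Bounded n P s) {x i : ℕ} (hx : x < 8) (hi : i < n) :
    Bounded n P (s.setV x i) where
  lt_size y hy := by
    simp only [Store.setV, Function.update_apply]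
    split_ifs
    exacts [hi, h.lt_size y hy]
  le_size y hy hy' := by
    simp only [Store.setV, Function.update_apply]
    rw [if_neg (by omega)]
    exact h.le_size y hy hy'
  var_le y hy hy' := by
    simp only [Store.setV, Function.update_apply]
    rw [if_neg (by omega)]
    exact h.var_le y hy hy'
  arr_le := h.arr_le

theorem Bounded.valid {s : Store} (h : Bounded n P s) {j x y : ℕ} (hok : arrOk j x y = true) :
    Valid n j (s.v x) (s.v y) := by
  simp only [arrOk, Bool.or_eq_true, Bool.and_eq_true, decide_eq_true_eq] at hok
  rcases hok with (⟨⟨rfl, hx⟩, hy⟩ | ⟨⟨rfl, hx⟩, rfl⟩) | ⟨⟨⟨hj, hj'⟩, hx⟩, hy⟩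
  · exact Or.inl ⟨rfl, h.lt_size x hx, h.lt_size y hy⟩
  · exact Or.inr (Or.inl ⟨rfl, h.lt_size y hx, rfl⟩)
  · exact Or.inr (Or.inr ⟨hj, hj', h.var_le_size hx, h.var_le_size hy⟩)

theorem Ex.eval_le (hP : n + 2 ≤ P) (e : Ex) : ∀ s, e.ok = true → Bounded n P s →
    e.eval n s ≤ P ^ e.exp := by
  have h1P : 1 ≤ P := by omega
  induction e with
  | const c =>
    intro s hok _
    simp only [Ex.ok, decide_eq_true_eq] at hok
    simpa [Ex.eval, Ex.exp] using hok
  | size =>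
    intro s _ _
    simp only [Ex.eval, Ex.exp, pow_one]
    omega
  | var x =>
    intro s hok hs
    simp only [Ex.ok, decide_eq_true_eq] at hok
    simp only [Ex.eval, Ex.exp]
    split_ifs with hx
    · have := hs.var_le_size hx
      rw [pow_one]
      omega
    · exact hs.var_le x (by omega) hok
  | arr j x y =>
    intro s hok hs
    exact hs.arr_le _ _ _ (hs.valid hok)
  | add a b iha ihb =>
    intro s hok hs
    simp only [Ex.ok, Bool.and_eq_true, decide_eq_true_eq] at hok
    have ha := (iha s hok.1.1 hs).trans (Nat.pow_le_pow_right h1P (le_max_left a.exp b.exp))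
    have hb := (ihb s hok.1.2 hs).trans (Nat.pow_le_pow_right h1P (le_max_right a.exp b.exp))
    simp only [Ex.eval, Ex.exp, pow_succ]
    have := Nat.mul_le_mul_left (P ^ max a.exp b.exp) (show 2 ≤ P by omega)
    omega
  | sub a b iha ihb =>
    intro s hok hs
    simp only [Ex.ok, Bool.and_eq_true] at hok
    exact (Nat.sub_le _ _).trans (iha s hok.1 hs)
  | mul a b iha ihb =>
    intro s hok hs
    simp only [Ex.ok, Bool.and_eq_true, decide_eq_true_eq] at hok
    simp only [Ex.eval, Ex.exp, pow_add]
    exact Nat.mul_le_mul (iha s hok.1.1 hs) (ihb s hok.1.2 hs)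
  | sum x e ih =>
    intro s hok hs
    simp only [Ex.ok, Bool.and_eq_true, decide_eq_true_eq] at hok
    simp only [Ex.eval, Ex.exp]
    calc ∑ i ∈ Finset.range n, e.eval n (s.setV x i) ≤ ∑ i ∈ Finset.range n, P ^ e.exp :=
          Finset.sum_le_sum fun i hi => ih _ hok.1.1 (hs.setV_loop hok.1.2 (Finset.mem_range.1 hi))
      _ = n * P ^ e.exp := by simp
      _ ≤ P * P ^ e.exp := Nat.mul_le_mul_right _ (by omega)
      _ = P ^ (e.exp + 1) := by rw [pow_succ, mul_comm]

theorem Ex.eval_le_size (hP : n + 2 ≤ P) (e : Ex) : ∀ s, e.ok = true → e.leSize = true →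
    Bounded n P s → e.eval n s ≤ n := by
  induction e with
  | size => exact fun _ _ _ _ => le_rfl
  | var x =>
    intro s _ hx hs
    exact hs.var_le_size (by simpa [Ex.leSize] using hx)
  | sub a b iha _ =>
    intro s hok hl hs
    simp only [Ex.ok, Bool.and_eq_true] at hok
    exact (Nat.sub_le _ _).trans (iha s hok.1 hl hs)
  | sum x e _ =>
    intro s hok hl hs
    simp only [Ex.ok, Bool.and_eq_true, decide_eq_true_eq] at hok
    simp only [Ex.leSize, decide_eq_true_eq] at hl
    calc (Ex.sum x e).eval n s = ∑ i ∈ Finset.range n, e.eval n (s.setV x i) := rfl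
      _ ≤ ∑ i ∈ Finset.range n, 1 := Finset.sum_le_sum fun i hi => by
          have := e.eval_le hP _ hok.1.1 (hs.setV_loop hok.1.2 (Finset.mem_range.1 hi))
          rwa [hl, pow_zero] at this
      _ = n := by simp
  | _ =>
    intro s _ hl
    simp [Ex.leSize] at hl

theorem Ex.exp_le {e : Ex} (hok : e.ok = true) : e.exp ≤ 20 := by
  induction e with
  | arr j x y =>
    simp only [Ex.exp, arrExp]
    split <;> omega
  | var x =>
    simp only [Ex.exp, varExp]
    split_ifs <;> omega
  | sub a b iha _ =>
    simp only [Ex.ok, Bool.and_eq_true] at hok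
    exact iha hok.1
  | _ =>
    simp only [Ex.ok, Bool.and_eq_true, decide_eq_true_eq] at hok
    simp only [Ex.exp]
    omega

theorem Ex.eval_lt (hP : n + 2 ≤ P) {e : Ex} {s : Store} (hok : e.ok = true)
    (hs : Bounded n P s) : e.eval n s < P ^ 30 :=
  (e.eval_le hP s hok hs).trans_lt
    (Nat.pow_lt_pow_right (by omega) ((Ex.exp_le hok).trans_lt (by omega)))

/-- Running a well-formed statement preserves the bounds. -/
theorem Bounded.run (hP : n + 2 ≤ P) (p : St) : ∀ s, p.ok = true → Bounded n P s →
    Bounded n P (p.run n s) := by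
  induction p with
  | assign x e =>
    intro s hok hs
    simp only [St.ok, Bool.and_eq_true, Bool.or_eq_true, decide_eq_true_eq] at hok
    obtain ⟨hok, hx⟩ := hok
    refine ⟨fun y hy => ?_, fun y hy hy' => ?_, fun y hy hy' => ?_, hs.arr_le⟩
    · simp only [St.run, Store.setV, Function.update_apply]
      rw [if_neg (by omega)]
      exact hs.lt_size y hy
    · simp only [St.run, Store.setV, Function.update_apply]
      split_ifs with h
      · subst h
        rcases hx with hx | hx
        · exact e.eval_le_size hP s hok hx.2 hs
        · omega
      · exact hs.le_size y hy hy'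
    · simp only [St.run, Store.setV, Function.update_apply]
      split_ifs with h
      · subst h
        rcases hx with hx | hx
        · omega
        · exact (e.eval_le hP s hok hs).trans (Nat.pow_le_pow_right (by omega) hx.2)
      · exact hs.var_le y hy hy'
  | store j x y e =>
    intro s hok hs
    simp only [St.ok, Bool.and_eq_true, decide_eq_true_eq] at hok
    refine ⟨hs.lt_size, hs.le_size, hs.var_le, fun j' p q hv => ?_⟩
    simp only [St.run, Store.setA]
    split_ifs with h
    · obtain ⟨rfl, -, -⟩ := h
      exact (e.eval_le hP s hok.1.1.1 hs).trans (Nat.pow_le_pow_right (by omega) hok.2)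
    · exact hs.arr_le _ _ _ hv
  | seq p q ihp ihq =>
    intro s hok hs
    simp only [St.ok, Bool.and_eq_true] at hok
    exact ihq _ hok.2 (ihp _ hok.1 hs)
  | each x p ih =>
    intro s hok hs
    simp only [St.ok, Bool.and_eq_true, decide_eq_true_eq] at hok
    simp only [St.run]
    have : ∀ i ≤ n, Bounded n P (iter (fun i s' => p.run n (s'.setV x i)) i s) := by
      intro i
      induction i with
      | zero => exact fun _ => hs
      | succ i ih' => exact fun hi => ih _ hok.2 ((ih' (by omega)).setV_loop hok.1 (by omega))
    exact this n le_rfl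

/-! ### Compilation -/

/-- The address of an array entry. -/
def addr (n j p q : ℕ) : ℕ :=
  if j = 0 then n * p + q
  else if j = 1 then n * n + p
  else 16 * ((n + 1) * p + q) + j + n * n + n

theorem mul_add_inj {m p q p' q' : ℕ} (hq : q < m) (hq' : q' < m)
    (h : m * p + q = m * p' + q') : p = p' ∧ q = q' := by
  have hp : p = p' := by
    have h1 := congrArg (· / m) h
    simpa [Nat.mul_add_div (Nat.zero_lt_of_lt hq), Nat.div_eq_of_lt hq,
      Nat.div_eq_of_lt hq'] using h1
  subst hp
  exact ⟨rfl, by omega⟩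

theorem mul_add_lt_mul {m p q : ℕ} (hp : p < m) (hq : q < m) : m * p + q < m * m := by
  have := Nat.mul_le_mul_left m (Nat.succ_le_of_lt hp)
  rw [Nat.mul_succ] at this
  omega

/-- The matrix fills the first `n * n` cells and the weights the next `n`. Behind them the arrays
`2` to `15` are interleaved with stride `16`: the remainder identifies the array, the quotient
encodes the position in base `n + 1`. -/
theorem addr_inj {j p q j' p' q' : ℕ} (h : Valid n j p q) (h' : Valid n j' p' q')
    (heq : addr n j p q = addr n j' p' q') : j = j' ∧ p = p' ∧ q = q' := by
  unfold addr at heq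
  rcases h with ⟨rfl, hp, hq⟩ | ⟨rfl, hp, rfl⟩ | ⟨h2, h3, hp, hq⟩ <;>
    rcases h' with ⟨rfl, hp', hq'⟩ | ⟨rfl, hp', rfl⟩ | ⟨h2', h3', hp', hq'⟩
  · simp only [if_true] at heq
    exact ⟨rfl, mul_add_inj hq hq' heq⟩
  · have := mul_add_lt_mul hp hq
    simp at heq
    omega
  · have := mul_add_lt_mul hp hq
    rw [if_pos rfl, if_neg (by omega), if_neg (by omega)] at heq
    omega
  · have := mul_add_lt_mul hp' hq'
    simp at heq
    omega
  · simp at heq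
    simp [heq]
  · rw [if_neg (by omega), if_pos rfl, if_neg (by omega), if_neg (by omega)] at heq
    omega
  · have := mul_add_lt_mul hp' hq'
    rw [if_neg (by omega), if_neg (by omega), if_pos rfl] at heq
    omega
  · rw [if_neg (by omega), if_neg (by omega), if_neg (by omega), if_pos rfl] at heq
    omega
  · rw [if_neg (by omega), if_neg (by omega), if_neg (by omega), if_neg (by omega)] at heq
    obtain ⟨h4, rfl⟩ : (n + 1) * p + q = (n + 1) * p' + q' ∧ j = j' := by omega
    exact ⟨rfl, mul_add_inj (by omega) (by omega) h4⟩

open RAM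

/-- Code that computes the address of an entry of array `j` in register `d`. -/
def addrCode (d j x y : ℕ) : Prog :=
  if j = 0 then
    .seq (.assign d (.mul (.reg 0) (.reg (x + 1)))) (.assign d (.add (.reg d) (.reg (y + 1))))
  else if j = 1 then
    .seq (.assign d (.mul (.reg 0) (.reg 0))) (.assign d (.add (.reg d) (.reg (x + 1))))
  else
    .seq (.assign d (.add (.reg 0) (.const 1))) <|
    .seq (.assign d (.mul (.reg d) (.reg (x + 1)))) <|
    .seq (.assign d (.add (.reg d) (.reg (y + 1)))) <|
    .seq (.assign d (.mul (.const 16) (.reg d))) <|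
    .seq (.assign d (.add (.reg d) (.const j))) <|
    .seq (.assign (d + 1) (.mul (.reg 0) (.reg 0))) <|
    .seq (.assign d (.add (.reg d) (.reg (d + 1)))) <|
    .assign d (.add (.reg d) (.reg 0))

/-- Code that computes the value of an expression in register `d`, with working registers from `d`
on. -/
def Ex.compile : Ex → ℕ → Prog
  | .const c, d => .assign d (.copy (.const c))
  | .size, d => .assign d (.copy (.reg 0))
  | .var x, d => .assign d (.copy (.reg (x + 1)))
  | .arr j x y, d => .seq (addrCode d j x y) (.assign d (.load (.reg d)))
  | .add a b, d => .seq (a.compile d) <| .seq (b.compile (d + 1)) <|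
      .assign d (.add (.reg d) (.reg (d + 1)))
  | .sub a b, d => .seq (a.compile d) <| .seq (b.compile (d + 1)) <|
      .assign d (.sub (.reg d) (.reg (d + 1)))
  | .mul a b, d => .seq (a.compile d) <| .seq (b.compile (d + 1)) <|
      .assign d (.mul (.reg d) (.reg (d + 1)))
  -- The summation variable is saved in `d` and restored at the end, so evaluation has no side
  -- effects on variables. Variable `x` lives in register `x + 1`, as register `0` holds `n`.
  | .sum x e, d =>
    .seq (.assign d (.copy (.reg (x + 1)))) <|
    .seq (.assign (d + 1) (.copy (.const 0))) <|
    .seq (.assign (x + 1) (.copy (.const 0))) <|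
    .seq (.loop (.lt (.reg (x + 1)) (.reg 0)) <|
      .seq (e.compile (d + 2)) <|
      .seq (.assign (d + 1) (.add (.reg (d + 1)) (.reg (d + 2)))) <|
      .assign (x + 1) (.add (.reg (x + 1)) (.const 1))) <|
    .seq (.assign (x + 1) (.copy (.reg d))) <|
    .assign d (.copy (.reg (d + 1)))

def St.compile : St → ℕ → Prog
  | .assign x e, d => .seq (e.compile d) (.assign (x + 1) (.copy (.reg d)))
  | .store j x y e, d => .seq (e.compile d) <| .seq (addrCode (d + 1) j x y) <|
      .store (.reg (d + 1)) (.reg d)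
  | .seq p q, d => .seq (p.compile d) (q.compile d)
  -- The counter is kept in `d`: it reaches `n`, while the variable `x` never does, and the body may
  -- reuse `x`.
  | .each x p, d =>
    .seq (.assign d (.copy (.const 0))) <|
    .loop (.lt (.reg d) (.reg 0)) <|
      .seq (.assign (x + 1) (.copy (.reg d))) <|
      .seq (p.compile (d + 1)) <|
      .assign d (.add (.reg d) (.const 1))

def Ex.cost (n : ℕ) : Ex → ℕ
  | .const _ => 1
  | .size => 1
  | .var _ => 1
  | .arr _ _ _ => 9
  | .add a b => a.cost n + b.cost n + 1
  | .sub a b => a.cost n + b.cost n + 1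
  | .mul a b => a.cost n + b.cost n + 1
  | .sum _ e => n * (e.cost n + 3) + 6

def St.cost (n : ℕ) : St → ℕ
  | .assign _ e => e.cost n + 1
  | .store _ _ _ e => e.cost n + 9
  | .seq p q => p.cost n + q.cost n
  | .each _ p => n * (p.cost n + 3) + 2

/-- The machine state represents the state of the calculation. -/
structure Rep (n : ℕ) (s : State) (S : Store) : Prop where
  size : s.reg 0 = n
  var : ∀ x < 30, s.reg (x + 1) = S.v x
  arr : ∀ j p q, Valid n j p q → s.mem (addr n j p q) = S.a j p q

theorem Rep.congr {s s' : State} {S : Store} (h : Rep n s S) (hm : s'.mem = s.mem)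
    (hr : ∀ r < 40, s'.reg r = s.reg r) : Rep n s' S where
  size := (hr 0 (by omega)).trans h.size
  var x hx := (hr _ (by omega)).trans (h.var x hx)
  arr j p q hv := by
    rw [hm]
    exact h.arr j p q hv

/-- The address is of the order of `P * P`; the factor `2 ^ 28 ≤ P ^ 28` absorbs the constants. -/
theorem addr_bound (hP : n + 2 ≤ P) {p q j : ℕ} (hp : p ≤ n) (hq : q ≤ n) (hj : j < 16) :
    16 * ((n + 1) * p + q) + j + n * n + n < P ^ 30 := by
  have h1 : n * n + n + ((n + 1) * p + q + 1) ≤ 3 * (P * P) := by nlinarith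
  have h2 : 2 ^ 28 ≤ P ^ 28 := Nat.pow_le_pow_left (by omega) 28
  have h3 : P ^ 30 = P ^ 28 * (P * P) := by ring
  have h4 : 2 ^ 28 * (P * P) ≤ P ^ 30 := by
    rw [h3]
    exact Nat.mul_le_mul_right _ h2
  have h5 : 0 < P * P := Nat.mul_pos (by omega) (by omega)
  generalize (n + 1) * p + q = z at *
  generalize n * n = y at *
  generalize P ^ 30 = w at *
  generalize P * P = x at *
  omega

end Calc

/-! ### Correctness of the compilation -/

namespace Calc

open RAM

variable {n P : ℕ}

theorem addrCode_post (hP : n + 2 ≤ P) {s : State} {S : Store} (h : Rep n s S)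
    (hS : Bounded n P S) {d j x y : ℕ} (hd : 40 ≤ d) (hok : arrOk j x y = true) :
    Post (P ^ 30) (addrCode d j x y) s 8 fun s' => s'.mem = s.mem ∧
      (∀ r < d, s'.reg r = s.reg r) ∧ s'.reg d = addr n j (S.v x) (S.v y) := by
  have hv := hS.valid hok
  have hx : x < 30 ∧ y < 30 := by
    simp only [arrOk, Bool.or_eq_true, Bool.and_eq_true, decide_eq_true_eq] at hok
    omega
  have hsx := h.var x hx.1
  have hsy := h.var y hx.2
  have hs0 := h.size
  have hple : S.v x ≤ n ∧ S.v y ≤ n ∧ j < 16 := by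
    rcases hv with h | h | h <;> omega
  have hb := addr_bound hP hple.1 hple.2.1 hple.2.2
  have hnx : n * S.v x ≤ n * n := Nat.mul_le_mul_left _ hple.1
  have hnx' : (n + 1) * S.v x = n * S.v x + S.v x := Nat.succ_mul _ _
  have h1P : P ≤ P ^ 30 := Nat.le_self_pow (by omega) P
  unfold addrCode addr
  split_ifs with h0 h1
  · refine .assign_seq ?_ (.assign ?_ ⟨rfl, fun r hr => ?_, ?_⟩ le_rfl) (by omega) <;>
      simp (disch := omega) only [Operand.val, Rhs.val, Function.update_self,
        Function.update_of_ne, hsx, hsy, hs0] <;> omega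
  · refine .assign_seq ?_ (.assign ?_ ⟨rfl, fun r hr => ?_, ?_⟩ le_rfl) (by omega) <;>
      simp (disch := omega) only [Operand.val, Rhs.val, Function.update_self,
        Function.update_of_ne, hsx, hs0] <;> omega
  · refine .assign_next (by simp only [Rhs.val, Operand.val]; omega) (fun s1 m1 v1 k1 => ?_)
      (t := 7) le_rfl
    simp only [Rhs.val, Operand.val, hs0] at v1
    refine .assign_next (by
      simp (disch := omega) only [Rhs.val, Operand.val, v1, k1, hsx]; omega)
      (fun s2 m2 v2 k2 => ?_) (t := 6) le_rfl
    simp (disch := omega) only [Rhs.val, Operand.val, v1, k1, hsx] at v2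
    refine .assign_next (by
      simp (disch := omega) only [Rhs.val, Operand.val, v2, k2, k1, hsy]; omega)
      (fun s3 m3 v3 k3 => ?_) (t := 5) le_rfl
    simp (disch := omega) only [Rhs.val, Operand.val, v2, k2, k1, hsy] at v3
    refine .assign_next (by simp (disch := omega) only [Rhs.val, Operand.val, v3]; omega)
      (fun s4 m4 v4 k4 => ?_) (t := 4) le_rfl
    simp (disch := omega) only [Rhs.val, Operand.val, v3] at v4
    refine .assign_next (by simp (disch := omega) only [Rhs.val, Operand.val, v4]; omega)
      (fun s5 m5 v5 k5 => ?_) (t := 3) le_rfl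
    simp (disch := omega) only [Rhs.val, Operand.val, v4] at v5
    refine .assign_next (by
      simp (disch := omega) only [Rhs.val, Operand.val, k5, k4, k3, k2, k1, hs0]; omega)
      (fun s6 m6 v6 k6 => ?_) (t := 2) le_rfl
    simp (disch := omega) only [Rhs.val, Operand.val, k5, k4, k3, k2, k1, hs0] at v6
    refine .assign_next (by
      simp (disch := omega) only [Rhs.val, Operand.val, v6, k6, v5]; omega)
      (fun s7 m7 v7 k7 => ?_) (t := 1) le_rfl
    simp (disch := omega) only [Rhs.val, Operand.val, v6, k6, v5] at v7
    have e0 : s7.reg 0 = n := by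
      simp (disch := omega) only [k7, k6, k5, k4, k3, k2, k1, hs0]
    refine .assign ?_ ⟨?_, fun r hr => ?_, ?_⟩ le_rfl
    · simp only [Rhs.val, Operand.val, v7, e0]
      omega
    · simp only [m7, m6, m5, m4, m3, m2, m1]
    · simp (disch := omega) only [Function.update_of_ne, k7, k6, k5, k4, k3, k2, k1]
    · simp only [Function.update_self, Rhs.val, Operand.val, v7, e0]

/-- Registers below `d` are preserved, so a left operand in `d` survives the evaluation of the right
one in `d + 1`. -/
theorem Ex.compile_post (hP : n + 2 ≤ P) (e : Ex) : ∀ (d : ℕ) (s : State) (S : Store), 40 ≤ d →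
    e.ok = true → Bounded n P S → Rep n s S → Post (P ^ 30) (e.compile d) s (e.cost n)
      fun s' => s'.mem = s.mem ∧ (∀ r < d, s'.reg r = s.reg r) ∧ s'.reg d = e.eval n S := by
  have h1P : P ≤ P ^ 30 := Nat.le_self_pow (by omega) P
  have bin : ∀ (a b c : Ex) (r : Rhs) (d : ℕ) (s : State) (S : Store),
      (∀ (d : ℕ) (s : State) (S : Store), 40 ≤ d → a.ok = true → Bounded n P S → Rep n s S →
        Post (P ^ 30) (a.compile d) s (a.cost n) fun s' => s'.mem = s.mem ∧
          (∀ r < d, s'.reg r = s.reg r) ∧ s'.reg d = a.eval n S) →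
      (∀ (d : ℕ) (s : State) (S : Store), 40 ≤ d → b.ok = true → Bounded n P S → Rep n s S →
        Post (P ^ 30) (b.compile d) s (b.cost n) fun s' => s'.mem = s.mem ∧
          (∀ r < d, s'.reg r = s.reg r) ∧ s'.reg d = b.eval n S) →
      40 ≤ d → a.ok = true → b.ok = true → c.ok = true → Bounded n P S → Rep n s S →
      (∀ s' : State, s'.reg d = a.eval n S → s'.reg (d + 1) = b.eval n S →
        r.val s' = c.eval n S) →
      Post (P ^ 30) (.seq (a.compile d) (.seq (b.compile (d + 1)) (.assign d r))) s
        (a.cost n + b.cost n + 1) fun s' => s'.mem = s.mem ∧ (∀ r < d, s'.reg r = s.reg r) ∧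
          s'.reg d = c.eval n S := by
    intro a b c r d s S iha ihb hd ha hb hc hS hs hr
    refine .seq ((iha d s S hd ha hS hs).mono le_rfl fun s1 h1 => ?_)
      (t₂ := b.cost n + 1) (by omega)
    refine .seq ((ihb (d + 1) s1 S (by omega) hb hS
      (hs.congr h1.1 fun r hr => h1.2.1 r (by omega))).mono le_rfl fun s2 h2 => ?_) le_rfl
    have hval := hr s2 ((h2.2.1 d (by omega)).trans h1.2.2) h2.2.2
    refine .assign ?_ ⟨h2.1.trans h1.1, fun r hr => ?_, ?_⟩ le_rfl
    · rw [hval]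
      exact Ex.eval_lt hP hc hS
    · dsimp only
      rw [Function.update_of_ne (by omega), h2.2.1 r (by omega), h1.2.1 r hr]
    · dsimp only
      rw [Function.update_self, hval]
  induction e with
  | const c =>
    intro d s S hd hok hS hs
    refine .assign (Ex.eval_lt hP hok hS) ⟨rfl, fun r hr => ?_, ?_⟩ le_rfl
    · exact Function.update_of_ne (by omega) _ _
    · exact Function.update_self _ _ _
  | size =>
    intro d s S hd hok hS hs
    refine .assign ?_ ⟨rfl, fun r hr => ?_, ?_⟩ le_rfl
    · simp only [Rhs.val, Operand.val, hs.size]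
      omega
    · exact Function.update_of_ne (by omega) _ _
    · exact (Function.update_self _ _ _).trans hs.size
  | var x =>
    intro d s S hd hok hS hs
    have hx : x < 30 := by simpa [Ex.ok] using hok
    refine .assign ?_ ⟨rfl, fun r hr => ?_, ?_⟩ le_rfl
    · simp only [Rhs.val, Operand.val, hs.var x hx]
      exact Ex.eval_lt hP hok hS
    · exact Function.update_of_ne (by omega) _ _
    · exact (Function.update_self _ _ _).trans (hs.var x hx)
  | arr j x y =>
    intro d s S hd hok hS hs
    refine .seq ((addrCode_post hP hs hS hd hok).mono le_rfl fun s1 h1 => ?_) (t₂ := 1) le_rfl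
    have hval : (Rhs.load (.reg d)).val s1 = (Ex.arr j x y).eval n S := by
      simp only [Rhs.val, Operand.val, h1.2.2, h1.1]
      exact hs.arr _ _ _ (hS.valid hok)
    refine .assign ?_ ⟨h1.1, fun r hr => ?_, ?_⟩ le_rfl
    · rw [hval]
      exact Ex.eval_lt hP hok hS
    · dsimp only
      rw [Function.update_of_ne (by omega), h1.2.1 r hr]
    · dsimp only
      rw [Function.update_self, hval]
  | add a b iha ihb =>
    intro d s S hd hok hS hs
    have hok' := hok
    simp only [Ex.ok, Bool.and_eq_true] at hok'
    exact bin a b (.add a b) _ d s S iha ihb hd hok'.1.1 hok'.1.2 hok hS hs fun s' h1 h2 => by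
      simp only [Rhs.val, Operand.val, h1, h2, Ex.eval]
  | sub a b iha ihb =>
    intro d s S hd hok hS hs
    have hok' := hok
    simp only [Ex.ok, Bool.and_eq_true] at hok'
    exact bin a b (.sub a b) _ d s S iha ihb hd hok'.1 hok'.2 hok hS hs fun s' h1 h2 => by
      simp only [Rhs.val, Operand.val, h1, h2, Ex.eval]
  | mul a b iha ihb =>
    intro d s S hd hok hS hs
    have hok' := hok
    simp only [Ex.ok, Bool.and_eq_true] at hok'
    exact bin a b (.mul a b) _ d s S iha ihb hd hok'.1.1 hok'.1.2 hok hS hs fun s' h1 h2 => by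
      simp only [Rhs.val, Operand.val, h1, h2, Ex.eval]
  | sum x e ih =>
    intro d s S hd hok hS hs
    have hok' := hok
    simp only [Ex.ok, Bool.and_eq_true, decide_eq_true_eq] at hok'
    obtain ⟨⟨heok, hx⟩, -⟩ := hok'
    have htot : ∀ i ≤ n, ∑ l ∈ Finset.range i, e.eval n (S.setV x l) < P ^ 30 := fun i hi =>
      (Finset.sum_le_sum_of_subset (Finset.range_mono hi)).trans_lt (Ex.eval_lt hP hok hS)
    have hx1 := hs.var x (by omega)
    have hSx := hS.lt_size x hx
    refine .assign_seq (t := n * (e.cost n + 3) + 5) ?_ (.assign_seq (t := n * (e.cost n + 3) + 4)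
      ?_ (.assign_seq (t := n * (e.cost n + 3) + 3) ?_ (.seq (t₁ := n * (e.cost n + 3) + 1)
      (t₂ := 2) (.count (a := x + 1) (n := n) (t₁ := e.cost n + 2)
      (fun i s' => s'.mem = s.mem ∧ (∀ r < d, r ≠ x + 1 → s'.reg r = s.reg r) ∧
        s'.reg d = S.v x ∧ s'.reg (x + 1) = i ∧
        s'.reg (d + 1) = ∑ l ∈ Finset.range i, e.eval n (S.setV x l)) ?_ ?_ ?_ ?_ le_rfl)
      le_rfl) le_rfl) le_rfl) le_rfl
    · simp only [Rhs.val, Operand.val, hx1]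
      omega
    · simp only [Rhs.val, Operand.val]
      omega
    · simp only [Rhs.val, Operand.val]
      omega
    · rintro i s' ⟨h1, h2, h3, h4, h5⟩
      exact ⟨h4, (h2 0 (by omega) (by omega)).trans hs.size⟩
    · rintro i s' hi ⟨h1, h2, h3, h4, h5⟩
      have hrep : Rep n s' (S.setV x i) := by
        refine ⟨(h2 0 (by omega) (by omega)).trans hs.size, fun y hy => ?_, ?_⟩
        · by_cases hyx : y = x
          · subst hyx
            simp [Store.setV, h4]
          · rw [h2 _ (by omega) (by omega), hs.var y hy]
            simp [Store.setV, hyx]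
        · rw [h1]
          exact hs.arr
      refine .seq ((ih (d + 2) s' _ (by omega) heok (hS.setV_loop hx hi) hrep).mono le_rfl
        fun s1 hs1 => ?_) (t₂ := 2) le_rfl
      obtain ⟨k1, k2, k3⟩ := hs1
      have e1 : s1.reg (d + 1) = ∑ l ∈ Finset.range i, e.eval n (S.setV x l) := by
        rw [k2 _ (by omega), h5]
      have e2 : s1.reg (x + 1) = i := by rw [k2 _ (by omega), h4]
      have e3 : s1.reg d = S.v x := by rw [k2 _ (by omega), h3]
      refine .assign_seq (t := 1) ?_ (.assign ?_ ⟨k1.trans h1, fun r hr hr' => ?_, ?_, ?_, ?_⟩ le_rfl)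
        le_rfl
      · simp only [Rhs.val, Operand.val, e1, k3, ← Finset.sum_range_succ]
        exact htot _ (by omega)
      · simp (disch := omega) only [Rhs.val, Operand.val, Function.update_of_ne, e2]
        omega
      · simp (disch := omega) only [Function.update_of_ne, k2, h2]
      · simp (disch := omega) only [Function.update_of_ne, e3]
      · simp (disch := omega) only [Rhs.val, Operand.val, Function.update_of_ne,
          Function.update_self, e2]
      · simp (disch := omega) only [Rhs.val, Operand.val, Function.update_of_ne,
          Function.update_self, e1, k3, Finset.sum_range_succ]
    · refine ⟨rfl, fun r hr hr' => ?_, ?_, ?_, ?_⟩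
      · simp (disch := omega) only [Function.update_of_ne]
      · simp (disch := omega) only [Rhs.val, Operand.val, Function.update_of_ne,
          Function.update_self, hx1]
      · simp (disch := omega) only [Rhs.val, Operand.val, 
          Function.update_self]
      · simp (disch := omega) only [Rhs.val, Operand.val, Function.update_of_ne,
          Function.update_self, Finset.sum_range_zero]
    · rintro s' ⟨h1, h2, h3, h4, h5⟩
      refine .assign_seq (t := 1) ?_ (.assign ?_ ⟨h1, fun r hr => ?_, ?_⟩ le_rfl) le_rfl
      · simp only [Rhs.val, Operand.val, h3]
        omega
      · simp (disch := omega) only [Rhs.val, Operand.val, Function.update_of_ne, h5]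
        exact htot _ le_rfl
      · by_cases hrx : r = x + 1
        · subst hrx
          simp (disch := omega) only [Rhs.val, Operand.val, Function.update_of_ne,
            Function.update_self, h3, hx1]
        · simp (disch := omega) only [Function.update_of_ne, h2]
      · simp (disch := omega) only [Rhs.val, Operand.val, Function.update_of_ne,
          Function.update_self, h5, Ex.eval]

/-- Of the working registers only those below `d` are preserved; they hold the counters of the
enclosing loops. -/
theorem St.compile_post (hP : n + 2 ≤ P) (p : St) : ∀ (d : ℕ) (s : State) (S : Store), 40 ≤ d →
    p.ok = true → Bounded n P S → Rep n s S → Post (P ^ 30) (p.compile d) s (p.cost n)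
      fun s' => Rep n s' (p.run n S) ∧ ∀ r, 40 ≤ r → r < d → s'.reg r = s.reg r := by
  have h1P : P ≤ P ^ 30 := Nat.le_self_pow (by omega) P
  induction p with
  | assign x e =>
    intro d s S hd hok hS hs
    simp only [St.ok, Bool.and_eq_true, Bool.or_eq_true, decide_eq_true_eq] at hok
    obtain ⟨hok, hx⟩ := hok
    have hx30 : x < 30 := by omega
    refine .seq ((e.compile_post hP d s S hd hok hS hs).mono le_rfl fun s1 h1 => ?_)
      (t₂ := 1) le_rfl
    obtain ⟨h1, h2, h3⟩ := h1
    have hs1 := hs.congr h1 fun r hr => h2 r (by omega)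
    refine .assign ?_ ⟨⟨?_, fun y hy => ?_, hs1.arr⟩, fun r hr hr' => ?_⟩ le_rfl
    · simp only [Rhs.val, Operand.val, h3]
      exact Ex.eval_lt hP hok hS
    · simp (disch := omega) only [Function.update_of_ne, hs1.size]
    · by_cases hyx : y = x
      · subst hyx
        simp [Rhs.val, Operand.val, St.run, Store.setV, h3]
      · simp (disch := omega) only [Function.update_of_ne, hs1.var, St.run, Store.setV]
    · simp (disch := omega) only [Function.update_of_ne, h2]
  | store j x y e =>
    intro d s S hd hok hS hs
    simp only [St.ok, Bool.and_eq_true, decide_eq_true_eq] at hok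
    obtain ⟨⟨⟨hok, harr⟩, -⟩, -⟩ := hok
    refine .seq ((e.compile_post hP d s S hd hok hS hs).mono le_rfl fun s1 h1 => ?_)
      (t₂ := 9) le_rfl
    obtain ⟨h1, h2, h3⟩ := h1
    have hs1 := hs.congr h1 fun r hr => h2 r (by omega)
    refine .seq ((addrCode_post hP hs1 hS (d := d + 1) (by omega) harr).mono le_rfl
      fun s2 hs2 => ?_) (t₂ := 1) le_rfl
    obtain ⟨k1, k2, k3⟩ := hs2
    have hs2 := hs1.congr k1 fun r hr => k2 r (by omega)
    have e1 : s2.reg d = e.eval n S := (k2 d (by omega)).trans h3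
    refine .store ?_ ⟨⟨hs2.size, hs2.var, fun j' p q hv => ?_⟩, fun r hr hr' => ?_⟩ le_rfl
    · simp only [Operand.val, e1]
      exact Ex.eval_lt hP hok hS
    · simp only [Operand.val, e1, k3, St.run, Store.setA, Function.update_apply]
      by_cases hc : j' = j ∧ p = S.v x ∧ q = S.v y
      · obtain ⟨rfl, rfl, rfl⟩ := hc
        simp
      · rw [if_neg hc, if_neg fun he => hc (addr_inj hv (hS.valid harr) he)]
        exact hs2.arr _ _ _ hv
    · simp only [k2 r (by omega), h2 r hr']
  | seq p q ihp ihq =>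
    intro d s S hd hok hS hs
    simp only [St.ok, Bool.and_eq_true] at hok
    refine .seq ((ihp d s S hd hok.1 hS hs).mono le_rfl fun s1 h1 => ?_) le_rfl
    refine (ihq d s1 _ hd hok.2 (hS.run hP p S hok.1) h1.1).mono le_rfl fun s2 h2 => ?_
    exact ⟨h2.1, fun r hr hr' => (h2.2 r hr hr').trans (h1.2 r hr hr')⟩
  | each x p ih =>
    intro d s S hd hok hS hs
    simp only [St.ok, Bool.and_eq_true, decide_eq_true_eq] at hok
    obtain ⟨hx, hok⟩ := hok
    have hSx := hS.lt_size x hx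
    set f : ℕ → Store → Store := fun i s' => p.run n (s'.setV x i) with hf
    have hb : ∀ i ≤ n, Bounded n P (iter f i S) := by
      intro i
      induction i with
      | zero => exact fun _ => hS
      | succ i ih' =>
        exact fun hi => Bounded.run hP p _ hok ((ih' (by omega)).setV_loop hx (by omega))
    refine .assign_seq (t := n * (p.cost n + 3) + 1) ?_ (.count (a := d) (n := n)
      (t₁ := p.cost n + 2) (fun i s' => Rep n s' (iter f i S) ∧ s'.reg d = i ∧
        ∀ r, 40 ≤ r → r < d → s'.reg r = s.reg r) ?_ ?_ ?_ ?_ le_rfl) le_rfl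
    · simp only [Rhs.val, Operand.val]
      omega
    · rintro i s' ⟨h1, h2, -⟩
      exact ⟨h2, h1.size⟩
    · rintro i s' hi ⟨h1, h2, h3⟩
      refine .assign_seq (t := p.cost n + 1) ?_ (.seq ((ih (d + 1) _ ((iter f i S).setV x i)
        (by omega) hok ((hb i hi.le).setV_loop hx hi) ?_).mono le_rfl fun s1 hs1 => ?_)
        (t₂ := 1) le_rfl) le_rfl
      · simp only [Rhs.val, Operand.val, h2]
        omega
      · refine ⟨?_, fun y hy => ?_, h1.arr⟩
        · simp (disch := omega) only [Function.update_of_ne, h1.size]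
        · by_cases hyx : y = x
          · subst hyx
            simp [Rhs.val, Operand.val, Store.setV, h2]
          · simp (disch := omega) only [Function.update_of_ne, h1.var, Store.setV]
      · obtain ⟨k1, k2⟩ := hs1
        have e1 : s1.reg d = i := by
          rw [k2 d hd (by omega)]
          simp (disch := omega) only [Function.update_of_ne, h2]
        refine .assign ?_ ⟨⟨?_, fun y hy => ?_, k1.arr⟩, ?_, fun r hr hr' => ?_⟩ le_rfl
        · simp only [Rhs.val, Operand.val, e1]
          omega
        · simp (disch := omega) only [Function.update_of_ne, k1.size]
        · simp (disch := omega) only [Function.update_of_ne, k1.var]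
          rfl
        · simp only [Function.update_self, Rhs.val, Operand.val, e1]
        · dsimp only
          rw [Function.update_of_ne (by omega), k2 r hr (by omega)]
          simp (disch := omega) only [Function.update_of_ne, h3]
    · refine ⟨hs.congr rfl fun r hr => ?_, ?_, fun r hr hr' => ?_⟩
      · simp (disch := omega) only [Function.update_of_ne]
      · simp only [Function.update_self, Rhs.val, Operand.val]
      · simp (disch := omega) only [Function.update_of_ne]
    · rintro s' ⟨h1, -, h3⟩
      exact ⟨h1, h3⟩

/-! ### Running time -/

/-- The cost is at most `weight * (n + 1) ^ depth`. Sums count as loops, and only the exponent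
matters for the result. -/
def Ex.depth : Ex → ℕ
  | .add a b => max a.depth b.depth
  | .sub a b => max a.depth b.depth
  | .mul a b => max a.depth b.depth
  | .sum _ e => e.depth + 1
  | _ => 0

def Ex.weight : Ex → ℕ
  | .add a b => a.weight + b.weight + 1
  | .sub a b => a.weight + b.weight + 1
  | .mul a b => a.weight + b.weight + 1
  | .sum _ e => e.weight + 9
  | _ => 9

def St.depth : St → ℕ
  | .assign _ e => e.depth
  | .store _ _ _ e => e.depth
  | .seq p q => max p.depth q.depth
  | .each _ p => p.depth + 1

def St.weight : St → ℕ
  | .assign _ e => e.weight + 1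
  | .store _ _ _ e => e.weight + 9
  | .seq p q => p.weight + q.weight
  | .each _ p => p.weight + 9

theorem cost_loop_le {c w k : ℕ} (h : c ≤ w * (n + 1) ^ k) :
    n * (c + 3) + 6 ≤ (w + 9) * (n + 1) ^ (k + 1) := by
  have h1 : 1 ≤ (n + 1) ^ k := Nat.one_le_pow _ _ (by omega)
  have h2 : n * (c + 3) ≤ n * (w * (n + 1) ^ k + 3 * (n + 1) ^ k) := Nat.mul_le_mul_left _ (by omega)
  calc n * (c + 3) + 6 ≤ n * (w * (n + 1) ^ k + 3 * (n + 1) ^ k) + 6 * (n + 1) ^ k := by omega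
    _ ≤ (w + 9) * (n + 1) ^ (k + 1) := by
      rw [pow_succ]
      generalize (n + 1) ^ k = z
      nlinarith [Nat.zero_le (w * z), Nat.zero_le (n * z), Nat.zero_le z]

theorem cost_add_le {a b w w' c k k' : ℕ} (h : a ≤ w * (n + 1) ^ k) (h' : b ≤ w' * (n + 1) ^ k') :
    a + b + c ≤ (w + w' + c) * (n + 1) ^ max k k' := by
  have h1 : 1 ≤ (n + 1) ^ max k k' := Nat.one_le_pow _ _ (by omega)
  have h2 : (n + 1) ^ k ≤ (n + 1) ^ max k k' := Nat.pow_le_pow_right (by omega) (le_max_left _ _)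
  have h3 : (n + 1) ^ k' ≤ (n + 1) ^ max k k' := Nat.pow_le_pow_right (by omega) (le_max_right _ _)
  have h4 := Nat.mul_le_mul_left w h2
  have h5 := Nat.mul_le_mul_left w' h3
  have h6 := Nat.mul_le_mul_left c h1
  rw [add_mul, add_mul]
  omega

theorem Ex.cost_le (e : Ex) : e.cost n ≤ e.weight * (n + 1) ^ e.depth := by
  induction e with
  | add a b iha ihb => exact cost_add_le iha ihb
  | sub a b iha ihb => exact cost_add_le iha ihb
  | mul a b iha ihb => exact cost_add_le iha ihb
  | sum x e ih => exact cost_loop_le ih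
  | _ => simp [Ex.cost, Ex.weight, Ex.depth]

theorem St.cost_le (p : St) : p.cost n ≤ p.weight * (n + 1) ^ p.depth := by
  induction p with
  | assign x e =>
    have := cost_add_le (n := n) (c := 1) e.cost_le (Nat.zero_le (0 * (n + 1) ^ e.depth))
    simp only [add_zero, max_self] at this
    exact this
  | store j x y e =>
    have := cost_add_le (n := n) (c := 9) e.cost_le (Nat.zero_le (0 * (n + 1) ^ e.depth))
    simp only [add_zero, max_self] at this
    exact this
  | seq p q ihp ihq => exact cost_add_le (c := 0) ihp ihq
  | each x p ih => exact (Nat.add_le_add_left (by omega) _).trans (cost_loop_le ih)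

end Calc

/-! ### Effects of loops that fill an array -/

namespace Calc

variable {n P : ℕ}

theorem iter_induction {f : ℕ → Store → Store} (I : ℕ → Store → Prop) {s : Store} (h0 : I 0 s)
    (hstep : ∀ i < n, ∀ s', I i s' → I (i + 1) (f i s')) : I n (iter f n s) := by
  have : ∀ i ≤ n, I i (iter f i s) := by
    intro i
    induction i with
    | zero => exact fun _ => h0
    | succ i ih => exact fun hi => hstep i (by omega) _ (ih (by omega))
  exact this n le_rfl

/-- A loop that stores values at distinct positions of one array. -/
theorem run_each_store {x j y z : ℕ} {e : Ex} {s : Store} (pos : ℕ → ℕ × ℕ) (F : ℕ → ℕ)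
    (hpos : ∀ i k, pos i = pos k → i = k)
    (hy : ∀ i (s' : Store), s'.v x = i → (∀ w ≠ x, s'.v w = s.v w) → (s'.v y, s'.v z) = pos i)
    (hF : ∀ i < n, ∀ s', s'.v x = i → (∀ w ≠ x, s'.v w = s.v w) → (∀ j' ≠ j, s'.a j' = s.a j') →
      s'.a j (pos i).1 (pos i).2 = s.a j (pos i).1 (pos i).2 → e.eval n s' = F i) :
    ∃ s', (St.each x (.store j y z e)).run n s = s' ∧ (∀ w ≠ x, s'.v w = s.v w) ∧
      (∀ j' ≠ j, s'.a j' = s.a j') ∧ (∀ i < n, s'.a j (pos i).1 (pos i).2 = F i) ∧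
      ∀ p q, (∀ i < n, pos i ≠ (p, q)) → s'.a j p q = s.a j p q := by
  refine ⟨_, rfl, ?_⟩
  refine iter_induction (n := n) (fun m s' => (∀ w ≠ x, s'.v w = s.v w) ∧
    (∀ j' ≠ j, s'.a j' = s.a j') ∧ (∀ i < m, s'.a j (pos i).1 (pos i).2 = F i) ∧
      ∀ p q, (∀ i < m, pos i ≠ (p, q)) → s'.a j p q = s.a j p q) (by simp) ?_
  rintro i hi s' ⟨h1, h2, h3, h4⟩
  have hv : ∀ w ≠ x, (s'.setV x i).v w = s.v w := by
    intro w hw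
    simp [Store.setV, hw, h1 w hw]
  have hx : (s'.setV x i).v x = i := by simp [Store.setV]
  have hp := hy i _ hx hv
  have he := hF i hi _ hx hv h2 (h4 _ _ fun k hk h => by
    have := hpos _ _ h
    omega)
  simp only [St.run, Store.setA]
  rw [he]
  refine ⟨hv, ?_, ?_, ?_⟩
  · intro j' hj'
    rw [← h2 j' hj']
    funext p q
    rw [if_neg fun h => hj' h.1]
    rfl
  · intro k hk
    by_cases hki : k = i
    · subst hki
      rw [← hp]
      simp
    · rw [if_neg, ← h3 k (by omega)]
      · rfl
      · rintro ⟨-, h5, h6⟩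
        exact hki (hpos _ _ ((Prod.ext h5 h6 : pos k = _).trans hp))
  · intro p q hpq
    rw [if_neg, ← h4 p q fun k hk => hpq k (by omega)]
    · rfl
    · rintro ⟨-, rfl, rfl⟩
      exact hpq i (by omega) hp.symm

/-- The expression may rely on the old value of the cell being written, which allows updates in
place. -/
theorem run_each_store_diag {x j : ℕ} {e : Ex} {s : Store} (F : ℕ → ℕ)
    (hF : ∀ i < n, ∀ s', s'.v x = i → (∀ w ≠ x, s'.v w = s.v w) → (∀ j' ≠ j, s'.a j' = s.a j') →
      s'.a j i i = s.a j i i → e.eval n s' = F i) :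
    ∃ s', (St.each x (.store j x x e)).run n s = s' ∧ (∀ w ≠ x, s'.v w = s.v w) ∧
      (∀ j' ≠ j, s'.a j' = s.a j') ∧ (∀ i < n, s'.a j i i = F i) ∧
      ∀ p, n ≤ p → s'.a j p p = s.a j p p := by
  obtain ⟨s', h1, h2, h3, h4, h5⟩ := run_each_store (n := n) (x := x) (j := j) (y := x) (z := x)
    (e := e) (s := s) (fun i => (i, i)) F (fun i k h => congrArg Prod.fst h)
    (fun i s' h _ => by rw [h]) hF
  refine ⟨s', h1, h2, h3, h4, fun p hp => h5 p p fun i hi h => ?_⟩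
  have := congrArg Prod.fst h
  simp only at this
  omega

theorem run_each_store_row {x j y : ℕ} (hyx : y ≠ x) {e : Ex} {s : Store} (F : ℕ → ℕ)
    (hF : ∀ i < n, ∀ s', s'.v x = i → (∀ w ≠ x, s'.v w = s.v w) → (∀ j' ≠ j, s'.a j' = s.a j') →
      s'.a j (s.v y) i = s.a j (s.v y) i → e.eval n s' = F i) :
    ∃ s', (St.each x (.store j y x e)).run n s = s' ∧ (∀ w ≠ x, s'.v w = s.v w) ∧
      (∀ j' ≠ j, s'.a j' = s.a j') ∧ (∀ i < n, s'.a j (s.v y) i = F i) ∧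
      ∀ p q, p ≠ s.v y → s'.a j p q = s.a j p q := by
  obtain ⟨s', h1, h2, h3, h4, h5⟩ := run_each_store (n := n) (x := x) (j := j) (y := y) (z := x)
    (e := e) (s := s) (fun i => (s.v y, i)) F (fun i k h => congrArg Prod.snd h)
    (fun i s' h h' => by rw [h, h' y hyx]) hF
  exact ⟨s', h1, h2, h3, h4, fun p q hp => h5 p q fun i hi h => hp (congrArg Prod.fst h).symm⟩

theorem run_each_each_store {x y j : ℕ} (hxy : x ≠ y) {e : Ex} {s : Store} (F : ℕ → ℕ → ℕ)
    (hF : ∀ i < n, ∀ k < n, ∀ s', s'.v x = i → s'.v y = k →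
      (∀ w, w ≠ x → w ≠ y → s'.v w = s.v w) → (∀ j' ≠ j, s'.a j' = s.a j') →
      s'.a j i k = s.a j i k → e.eval n s' = F i k) :
    ∃ s', (St.each x (.each y (.store j x y e))).run n s = s' ∧
      (∀ w, w ≠ x → w ≠ y → s'.v w = s.v w) ∧
      (∀ j' ≠ j, s'.a j' = s.a j') ∧ (∀ i < n, ∀ k < n, s'.a j i k = F i k) := by
  refine ⟨_, rfl, ?_⟩
  have := iter_induction (n := n) (s := s)
    (f := fun i s' => (St.each y (.store j x y e)).run n (s'.setV x i)) (fun m s' =>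
    (∀ w, w ≠ x → w ≠ y → s'.v w = s.v w) ∧
    (∀ j' ≠ j, s'.a j' = s.a j') ∧ (∀ i < m, ∀ k < n, s'.a j i k = F i k) ∧
      ∀ i, m ≤ i → ∀ k, s'.a j i k = s.a j i k) (by simp) ?_
  · exact ⟨this.1, this.2.1, this.2.2.1⟩
  rintro i hi s' ⟨h1, h2, h3, h4⟩
  have hv : ∀ w, w ≠ x → w ≠ y → (s'.setV x i).v w = s.v w := by
    intro w hw hw'
    simp [Store.setV, hw, h1 w hw hw']
  have hx : (s'.setV x i).v x = i := by simp [Store.setV]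
  obtain ⟨s2, e2, k1, k2, k3, k4⟩ := run_each_store_row (n := n) (x := y) (j := j) (y := x) hxy
    (e := e) (s := s'.setV x i) (F i) (by
      rw [hx]
      intro k hk s3 l1 l2 l3 l4
      exact hF i hi k hk s3 ((l2 x hxy).trans hx) l1
        (fun w hw hw' => (l2 w hw').trans (hv w hw hw')) (fun j' hj' => (l3 j' hj').trans (h2 j' hj'))
        (l4.trans (h4 i le_rfl k)))
  rw [hx] at k3 k4
  rw [e2]
  refine ⟨fun w hw hw' => (k1 w hw').trans (hv w hw hw'), fun j' hj' => (k2 j' hj').trans (h2 j' hj'),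
    fun l hl k hk => ?_, fun l hl k => ?_⟩
  · by_cases hli : l = i
    · subst hli
      exact k3 k hk
    · exact (k4 l k hli).trans (h3 l (by omega) k hk)
  · exact (k4 l k (by omega)).trans (h4 l (by omega) k)

end Calc

namespace Calc

/-! ### The program

Array `2` is the closed adjacency matrix, `3` holds the residual weights, `4` is the closed
adjacency matrix of the square, `5` marks eliminated vertices, `6` counts for two vertices the
remaining neighbors of the second one that are not neighbors of the first one, row `t` of `7` marks
the vertices that are simplicial in round `t`, `8` holds the residual weights of the eliminated
vertices, and `9` marks the chosen vertices. -/

/-- Zero becomes one and everything else zero; applied twice, it is the indicator of being nonzero.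
-/
def Ex.not (e : Ex) : Ex := .sub (.const 1) e

/-- The first vertex that is marked in row `x` of array `7`. -/
def Ex.first (x : ℕ) : Ex :=
  -- The inner sum vanishes exactly if no marked index is at most the outer one. The number of such
  -- outer indices is the first marked index, or `n` if there is none.
  .sum 0 (.not (.sum 1 (.mul (.arr 7 x 1) (.not (.sub (.var 1) (.var 0))))))

def St.closedAdj : St :=
  .each 0 (.each 1 (.store 2 0 1 (.add
    (.not (.add (.sub (.var 0) (.var 1)) (.sub (.var 1) (.var 0)))) (.arr 0 0 1))))

def St.bigWeight : St := .assign 16 (.add (.const 1) (.sum 0 (.arr 1 0 0)))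

/-- The first factor removes vertices of infinite weight, whose code is `0`; otherwise the value is
M|N[v]| - w(v). -/
def St.initWeight : St :=
  .each 0 (.store 3 0 0 (.mul (.not (.not (.arr 1 0 0)))
    (.sub (.add (.mul (.var 16) (.sum 1 (.arr 2 0 1))) (.const 1)) (.arr 1 0 0))))

def St.squareAdj : St :=
  .each 0 (.each 1 (.store 4 0 1 (.not (.not (.sum 2 (.mul (.arr 2 0 2) (.arr 2 1 2)))))))

def St.initCount : St :=
  .each 0 (.each 1 (.store 6 0 1 (.sum 2 (.mul (.arr 4 1 2) (.not (.arr 4 0 2))))))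

/-- A live vertex is simplicial if each live vertex `q` of its closed neighborhood leaves none of
its live neighbors uncovered, that is, if the count in array `6` is zero. With the counts at hand a
round takes quadratic time. -/
def St.markSimplicial : St :=
  .each 0 (.store 7 3 0 (.not (.add (.arr 5 0 0)
    (.sum 1 (.mul (.mul (.not (.arr 5 1 1)) (.arr 4 0 1)) (.arr 6 1 0))))))

def St.updateWeight : St :=
  .each 0 (.store 3 0 0 (.sub (.arr 3 0 0) (.mul (.arr 4 8 0) (.var 17))))

/-- Only the eliminated vertex leaves the counted sets, so each count drops by at most one and is
never recomputed. -/
def St.updateCount : St :=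
  .each 0 (.each 1 (.store 6 0 1 (.sub (.arr 6 0 1) (.mul (.arr 4 1 8) (.not (.arr 4 0 8))))))

/-- One round of the elimination. -/
def St.eliminate : St :=
  -- The weight of the pivot is copied first, because the update in place also reduces that of the
  -- pivot itself to zero.
  .seq .markSimplicial <| .seq (.assign 8 (.first 3)) <| .seq (.assign 17 (.arr 3 8 8)) <|
  .seq (.store 8 3 3 (.var 17)) <| .seq .updateWeight <| .seq .updateCount <|
  .store 5 8 8 (.const 1)

/-- One round of the selection. -/
def St.select : St :=
  -- Rounds are revisited in reverse order; the pivot is recovered from its row of array `7`.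
  .seq (.assign 9 (.sub (.sub .size (.var 3)) (.const 1))) <| .seq (.assign 8 (.first 9)) <|
  .store 9 8 8 (.mul (.not (.not (.arr 8 9 9))) (.not (.sum 0 (.mul (.arr 9 0 0) (.arr 4 8 0)))))

/-- The number of chosen vertices that dominate vertex `0`. -/
def Ex.dominators : Ex := .sum 1 (.mul (.arr 9 1 1) (.arr 2 1 0))

/-- The first sum adds the distances from one of the numbers of dominators, the second counts chosen
vertices of infinite weight. The check is needed because the elimination is meaningless on a square
that is not chordal. -/
def St.verify : St :=
  .seq (.assign 18 (.add
    (.sum 0 (.add (.sub .dominators (.const 1)) (.sub (.const 1) .dominators)))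
    (.sum 0 (.mul (.arr 9 0 0) (.not (.arr 1 0 0)))))) <|
  .assign 19 (.not (.var 18))

def St.output : St := .each 0 (.store 1 0 0 (.arr 9 0 0))

def St.prepare : St :=
  .seq .closedAdj <| .seq .bigWeight <| .seq .initWeight <| .seq .squareAdj .initCount

def St.main : St :=
  .seq .prepare <| .seq (.each 3 .eliminate) <| .seq (.each 3 .select) <| .seq .verify .output

theorem St.main_ok : St.main.ok = true := by decide

theorem St.main_depth : St.main.depth = 3 := by decide

variable {n P : ℕ}

/-- The least index at which `g` does not vanish, written as a sum. -/
theorem first_spec (g : ℕ → ℕ) (h : ∃ k < n, g k ≠ 0) :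
    let u := ∑ i ∈ Finset.range n, (1 - ∑ k ∈ Finset.range n, g k * (1 - (k - i)))
    u < n ∧ g u ≠ 0 := by
  classical
  intro u
  have hu : u = Nat.find h := by
    have hm := Nat.find_spec h
    have e : ∀ i ∈ Finset.range n, (1 - ∑ k ∈ Finset.range n, g k * (1 - (k - i))) =
        if i < Nat.find h then 1 else 0 := by
      intro i _
      split_ifs with hi
      · suffices hz : ∑ k ∈ Finset.range n, g k * (1 - (k - i)) = 0 by rw [hz]
        refine Finset.sum_eq_zero fun k hk => ?_
        rw [Finset.mem_range] at hk
        by_cases hki : k ≤ i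
        · have := Nat.find_min h (hki.trans_lt hi)
          rw [not_and, not_not] at this
          rw [this hk, zero_mul]
        · rw [show 1 - (k - i) = 0 by omega, mul_zero]
      · have h1 := Finset.single_le_sum (f := fun k => g k * (1 - (k - i)))
          (fun _ _ => Nat.zero_le _) (Finset.mem_range.2 hm.1)
        have h2 : 1 - (Nat.find h - i) = 1 := by omega
        simp only [h2, mul_one] at h1
        have := hm.2
        omega
    change ∑ i ∈ Finset.range n, _ = _
    rw [Finset.sum_congr rfl e, Finset.sum_ite, Finset.sum_const_zero, add_zero, Finset.sum_const,
      smul_eq_mul, mul_one]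
    have : (Finset.range n).filter (· < Nat.find h) = Finset.range (Nat.find h) := by
      ext i
      simp only [Finset.mem_filter, Finset.mem_range]
      exact ⟨fun h => h.2, fun h' => ⟨h'.trans hm.1, h'⟩⟩
    rw [this, Finset.card_range]
  rw [hu]
  exact Nat.find_spec h

/-- The first marked vertex of a row of array `7`. -/
def Store.first (n : ℕ) (s : Store) (t : ℕ) : ℕ :=
  ∑ i ∈ Finset.range n, (1 - ∑ k ∈ Finset.range n, s.a 7 t k * (1 - (k - i)))

theorem Store.first_congr {s s' : Store} {t : ℕ} (h : s.a 7 t = s'.a 7 t) :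
    s.first n t = s'.first n t := by
  simp only [Store.first, h]

theorem eval_first (s : Store) {x : ℕ} (h0 : x ≠ 0) (h1 : x ≠ 1) :
    (Ex.first x).eval n s = s.first n (s.v x) := by
  simp [Ex.first, Ex.not, Ex.eval, Store.setV, Store.first, h0, h1]

theorem run_closedAdj (s : Store) : ∃ s', St.closedAdj.run n s = s' ∧
    (∀ w, w ≠ 0 → w ≠ 1 → s'.v w = s.v w) ∧ (∀ j ≠ 2, s'.a j = s.a j) ∧
    ∀ p < n, ∀ q < n, s'.a 2 p q = (1 - ((p - q) + (q - p))) + s.a 0 p q := by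
  refine run_each_each_store (by decide) _ ?_
  intro i _ k _ s' h0 h1 _ ha _
  simp [Ex.not, Ex.eval, h0, h1, ha]

theorem run_initWeight (s : Store) : ∃ s', St.initWeight.run n s = s' ∧
    (∀ w ≠ 0, s'.v w = s.v w) ∧ (∀ j ≠ 3, s'.a j = s.a j) ∧
    (∀ p < n, s'.a 3 p p = (1 - (1 - s.a 1 p p)) *
      (s.v 16 * (∑ q ∈ Finset.range n, s.a 2 p q) + 1 - s.a 1 p p)) ∧
      ∀ p, n ≤ p → s'.a 3 p p = s.a 3 p p := by
  refine run_each_store_diag _ ?_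
  intro i _ s' h0 hv ha _
  simp [Ex.not, Ex.eval, Store.setV, h0, hv, ha]

theorem run_squareAdj (s : Store) : ∃ s', St.squareAdj.run n s = s' ∧
    (∀ w, w ≠ 0 → w ≠ 1 → s'.v w = s.v w) ∧ (∀ j ≠ 4, s'.a j = s.a j) ∧
    ∀ p < n, ∀ q < n,
      s'.a 4 p q = 1 - (1 - ∑ k ∈ Finset.range n, s.a 2 p k * s.a 2 q k) := by
  refine run_each_each_store (by decide) _ ?_
  intro i _ k _ s' h0 h1 _ ha _
  simp [Ex.not, Ex.eval, Store.setV, h0, h1, ha]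

theorem run_initCount (s : Store) : ∃ s', St.initCount.run n s = s' ∧
    (∀ w, w ≠ 0 → w ≠ 1 → s'.v w = s.v w) ∧ (∀ j ≠ 6, s'.a j = s.a j) ∧
    ∀ p < n, ∀ q < n,
      s'.a 6 p q = ∑ k ∈ Finset.range n, s.a 4 q k * (1 - s.a 4 p k) := by
  refine run_each_each_store (by decide) _ ?_
  intro i _ k _ s' h0 h1 _ ha _
  simp [Ex.not, Ex.eval, Store.setV, h0, h1, ha]

theorem run_markSimplicial (s : Store) : ∃ s', St.markSimplicial.run n s = s' ∧
    (∀ w ≠ 0, s'.v w = s.v w) ∧ (∀ j ≠ 7, s'.a j = s.a j) ∧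
    (∀ p < n, s'.a 7 (s.v 3) p = 1 - (s.a 5 p p +
      ∑ q ∈ Finset.range n, (1 - s.a 5 q q) * s.a 4 p q * s.a 6 q p)) ∧
    ∀ p q, p ≠ s.v 3 → s'.a 7 p q = s.a 7 p q := by
  refine run_each_store_row (by decide) _ ?_
  intro i _ s' h0 hv ha _
  simp [Ex.not, Ex.eval, Store.setV, h0, ha]

theorem run_updateWeight (s : Store) : ∃ s', St.updateWeight.run n s = s' ∧
    (∀ w ≠ 0, s'.v w = s.v w) ∧ (∀ j ≠ 3, s'.a j = s.a j) ∧
    (∀ p < n, s'.a 3 p p = s.a 3 p p - s.a 4 (s.v 8) p * s.v 17) ∧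
    ∀ p, n ≤ p → s'.a 3 p p = s.a 3 p p := by
  refine run_each_store_diag _ ?_
  intro i _ s' h0 hv ha h
  simp [Ex.eval, h0, hv, ha, h]

theorem run_updateCount (s : Store) : ∃ s', St.updateCount.run n s = s' ∧
    (∀ w, w ≠ 0 → w ≠ 1 → s'.v w = s.v w) ∧ (∀ j ≠ 6, s'.a j = s.a j) ∧
    ∀ p < n, ∀ q < n,
      s'.a 6 p q = s.a 6 p q - s.a 4 q (s.v 8) * (1 - s.a 4 p (s.v 8)) := by
  refine run_each_each_store (by decide) _ ?_
  intro i _ k _ s' h0 h1 hv ha h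
  simp [Ex.not, Ex.eval, h0, h1, hv, ha, h]

/-- The effect of a round of the elimination. -/
structure Eliminates (n t : ℕ) (s s' : Store) : Prop where
  frame : ∀ j, j ≠ 3 → j ≠ 5 → j ≠ 6 → j ≠ 7 → j ≠ 8 → s'.a j = s.a j
  mark : ∀ p < n, s'.a 7 t p = 1 - (s.a 5 p p +
      ∑ q ∈ Finset.range n, (1 - s.a 5 q q) * s.a 4 p q * s.a 6 q p)
  mark_ne : ∀ p q, p ≠ t → s'.a 7 p q = s.a 7 p q
  pivot : s'.a 8 t t = s.a 3 (s'.first n t) (s'.first n t)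
  pivot_ne : ∀ p, p ≠ t → s'.a 8 p p = s.a 8 p p
  weight : ∀ p < n, s'.a 3 p p = s.a 3 p p -
    s.a 4 (s'.first n t) p * s.a 3 (s'.first n t) (s'.first n t)
  count : ∀ p < n, ∀ q < n, s'.a 6 p q = s.a 6 p q -
    s.a 4 q (s'.first n t) * (1 - s.a 4 p (s'.first n t))
  dead : ∀ p, s'.a 5 p p = if p = s'.first n t then 1 else s.a 5 p p

theorem run_eliminate (s : Store) (t : ℕ) :
    Eliminates n t s (St.eliminate.run n (s.setV 3 t)) := by
  obtain ⟨s1, e1, v1, a1, f1, g1⟩ := run_markSimplicial (n := n) (s.setV 3 t)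
  have hs3 : (s.setV 3 t).v 3 = t := by simp [Store.setV]
  have hsa : (s.setV 3 t).a = s.a := rfl
  rw [hs3, hsa] at f1
  rw [hs3, hsa] at g1
  rw [hsa] at a1
  have h3 : s1.v 3 = t := (v1 3 (by decide)).trans hs3
  set u := s1.first n t with hu
  set s4 := ((s1.setV 8 u).setV 17 (s1.a 3 u u)).setA 8 t t (s1.a 3 u u) with hs4
  obtain ⟨s5, e5, v5, a5, f5, -⟩ := run_updateWeight (n := n) s4
  obtain ⟨s6, e6, v6, a6, f6⟩ := run_updateCount (n := n) s5
  have w8 : s4.v 8 = u := by simp [hs4, Store.setV, Store.setA]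
  have w17 : s4.v 17 = s1.a 3 u u := by simp [hs4, Store.setV, Store.setA]
  have a4 : ∀ j ≠ 8, s4.a j = s1.a j := by
    intro j hj
    simp [hs4, Store.setV, Store.setA, hj]
  have w8' : s5.v 8 = u := (v5 8 (by decide)).trans w8
  have w8'' : s6.v 8 = u := (v6 8 (by decide) (by decide)).trans w8'
  have hrun : St.eliminate.run n (s.setV 3 t) = s6.setA 5 u u 1 := by
    simp only [St.eliminate, St.run, e1]
    rw [eval_first _ (by decide) (by decide), h3, ← hu]
    have e4 : (((s1.setV 8 u).setV 17 ((Ex.arr 3 8 8).eval n (s1.setV 8 u))).setA 8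
        (((s1.setV 8 u).setV 17 ((Ex.arr 3 8 8).eval n (s1.setV 8 u))).v 3)
        (((s1.setV 8 u).setV 17 ((Ex.arr 3 8 8).eval n (s1.setV 8 u))).v 3)
        ((Ex.var 17).eval n ((s1.setV 8 u).setV 17 ((Ex.arr 3 8 8).eval n (s1.setV 8 u))))) = s4 := by
      simp [hs4, Ex.eval, Store.setV, h3]
    rw [e4, e5, e6, w8'']
    rfl
  rw [hrun]
  have a7 : (s6.setA 5 u u 1).a 7 = s1.a 7 := by
    have : (s6.setA 5 u u 1).a 7 = s6.a 7 := by simp [Store.setA]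
    rw [this, a6 7 (by decide), a5 7 (by decide), a4 7 (by decide)]
  have hfirst : (s6.setA 5 u u 1).first n t = u := by
    exact Store.first_congr (by rw [a7])
  have ane : ∀ j ≠ 5, (s6.setA 5 u u 1).a j = s6.a j := by
    intro j hj
    simp [Store.setA, hj]
  refine ⟨?_, ?_, ?_, ?_, ?_, ?_, ?_, ?_⟩
  · intro j h3 h5 h6 h7 h8
    rw [ane j h5, a6 j h6, a5 j h3, a4 j h8, a1 j h7]
  · intro p hp
    rw [a7, f1 p hp]
  · intro p q hp
    rw [a7, g1 p q hp]
  · rw [hfirst, ane 8 (by decide), a6 8 (by decide), a5 8 (by decide), hs4]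
    simp [Store.setA, a1]
  · intro p hp
    rw [ane 8 (by decide), a6 8 (by decide), a5 8 (by decide), hs4]
    simp [Store.setA, Store.setV, hp, a1]
  · intro p hp
    rw [hfirst, ane 3 (by decide), a6 3 (by decide), f5 p hp, w8, w17, a4 3 (by decide),
      a4 4 (by decide), a1 3 (by decide), a1 4 (by decide)]
  · intro p hp q hq
    rw [hfirst, ane 6 (by decide), f6 p hp q hq, w8', a5 6 (by decide), a5 4 (by decide),
      a4 6 (by decide), a4 4 (by decide), a1 6 (by decide), a1 4 (by decide)]
  · intro p
    rw [hfirst]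
    have : s6.a 5 = s.a 5 := by
      rw [a6 5 (by decide), a5 5 (by decide), a4 5 (by decide), a1 5 (by decide)]
    simp [Store.setA, this]

/-- The effect of a round of the selection. -/
structure Selects (n t : ℕ) (s s' : Store) : Prop where
  frame : ∀ j, j ≠ 9 → s'.a j = s.a j
  chosen : ∀ p, s'.a 9 p p = if p = s.first n (n - t - 1) then
    (1 - (1 - s.a 8 (n - t - 1) (n - t - 1))) *
      (1 - ∑ q ∈ Finset.range n, s.a 9 q q * s.a 4 (s.first n (n - t - 1)) q)
    else s.a 9 p p

theorem run_select (s : Store) (t : ℕ) : Selects n t s (St.select.run n (s.setV 3 t)) := by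
  set s1 := (s.setV 3 t).setV 9 (n - t - 1) with hs1
  set u := s.first n (n - t - 1) with hu
  have hrun : St.select.run n (s.setV 3 t) = (s1.setV 8 u).setA 9 u u
      ((1 - (1 - s.a 8 (n - t - 1) (n - t - 1))) *
        (1 - ∑ q ∈ Finset.range n, s.a 9 q q * s.a 4 u q)) := by
    have e1 : (s.setV 3 t).setV 9 ((Ex.sub (Ex.sub Ex.size (Ex.var 3)) (Ex.const 1)).eval n
        (s.setV 3 t)) = s1 := by
      simp [hs1, Ex.eval, Store.setV]
    simp only [St.select, St.run]
    rw [e1, eval_first _ (by decide) (by decide)]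
    have e2 : s1.first n (s1.v 9) = u := by
      simp [hu, hs1, Store.setV, Store.first]
    rw [e2]
    rfl
  rw [hrun]
  refine ⟨?_, ?_⟩
  · intro j hj
    simp [Store.setA, Store.setV, hs1, hj]
  · intro p
    simp [Store.setA, Store.setV, hs1, hu]

theorem run_verify (s : Store) : ∃ s', St.verify.run n s = s' ∧ s'.a = s.a ∧
    s'.v 19 = 1 - (∑ p ∈ Finset.range n,
      ((∑ q ∈ Finset.range n, s.a 9 q q * s.a 2 q p) - 1 +
        (1 - ∑ q ∈ Finset.range n, s.a 9 q q * s.a 2 q p)) +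
      ∑ p ∈ Finset.range n, s.a 9 p p * (1 - s.a 1 p p)) := by
  refine ⟨_, rfl, rfl, ?_⟩
  simp [St.verify, St.run, Ex.eval, Ex.not, Ex.dominators, Store.setV]

theorem run_output (s : Store) : ∃ s', St.output.run n s = s' ∧
    (∀ w ≠ 0, s'.v w = s.v w) ∧ (∀ j ≠ 1, s'.a j = s.a j) ∧
    (∀ p < n, s'.a 1 p p = s.a 9 p p) ∧ ∀ p, n ≤ p → s'.a 1 p p = s.a 1 p p := by
  refine run_each_store_diag _ ?_
  intro i _ s' h0 hv ha _
  simp [Ex.eval, h0, ha]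

end Calc

/-! ### Correctness of elimination and selection -/

namespace Calc

variable {n : ℕ}

theorem run_each_of_step {x : ℕ} {p : St} {R : ℕ → Store → Store → Prop}
    (h : ∀ s t, R t s (p.run n (s.setV x t))) (s : Store) :
    ∃ E : ℕ → Store, E 0 = s ∧ E n = (St.each x p).run n s ∧ ∀ t, R t (E t) (E (t + 1)) :=
  ⟨fun t => iter (fun i s' => p.run n (s'.setV x i)) t s, rfl, rfl, fun t => h _ t⟩

/-- The rounds of the elimination. -/
structure Elimination (n : ℕ) (E : ℕ → Store) : Prop where
  step : ∀ t, Eliminates n t (E t) (E (t + 1))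
  dead : ∀ p, (E 0).a 5 p p = 0
  count : ∀ p < n, ∀ q < n, (E 0).a 6 p q =
    ∑ k ∈ Finset.range n, (E 0).a 4 q k * (1 - (E 0).a 4 p k)

namespace Elimination

variable {E : ℕ → Store}

theorem frame (h : Elimination n E) (t j : ℕ) (h3 : j ≠ 3) (h5 : j ≠ 5) (h6 : j ≠ 6) (h7 : j ≠ 7)
    (h8 : j ≠ 8) : (E t).a j = (E 0).a j := by
  induction t with
  | zero => rfl
  | succ t ih => rw [(h.step t).frame j h3 h5 h6 h7 h8, ih]

theorem mark_eq (h : Elimination n E) {t m : ℕ} (htm : t + 1 ≤ m) (p : ℕ) :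
    (E m).a 7 t p = (E (t + 1)).a 7 t p := by
  induction m, htm using Nat.le_induction with
  | base => rfl
  | succ m hm ih => rw [(h.step m).mark_ne t p (by omega), ih]

theorem pivot_eq (h : Elimination n E) {t m : ℕ} (htm : t + 1 ≤ m) :
    (E m).a 8 t t = (E (t + 1)).a 8 t t := by
  induction m, htm using Nat.le_induction with
  | base => rfl
  | succ m hm ih => rw [(h.step m).pivot_ne t (by omega), ih]

theorem dead_eq (h : Elimination n E) (t p : ℕ) : ((∃ l < t, (E (l + 1)).first n l = p) →
    (E t).a 5 p p = 1) ∧ ((∀ l < t, (E (l + 1)).first n l ≠ p) → (E t).a 5 p p = 0) := by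
  induction t with
  | zero =>
    refine ⟨fun ⟨l, hl, _⟩ => by omega, fun _ => h.dead p⟩
  | succ t ih =>
    rw [(h.step t).dead]
    split_ifs with hp
    · refine ⟨fun _ => rfl, fun h' => absurd hp.symm (h' t (by omega))⟩
    · refine ⟨fun ⟨l, hl, hlp⟩ => ih.1 ⟨l, ?_, hlp⟩, fun h' => ih.2 fun l hl => h' l (by omega)⟩
      rcases Nat.lt_succ_iff_lt_or_eq.1 hl with h' | rfl
      · exact h'
      · exact absurd hlp.symm hp

variable {H : SimpleGraph (Fin n)}

/-- By induction array `6` counts live private neighbors, so the marks of a round are exactly the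
live simplicial vertices. By Dirac's theorem there is one, so the pivot is a genuine vertex. -/
theorem correct (h : Elimination n E) (hH : H.IsChordalGraph)
    (hone : ∀ a b : Fin n, a = b ∨ H.Adj a b → (E 0).a 4 a b = 1)
    (hzero : ∀ a b : Fin n, a ≠ b → ¬ H.Adj a b → (E 0).a 4 a b = 0) (t : ℕ) (ht : t ≤ n) :
    (∀ l < t, ∃ u : Fin n, (E (l + 1)).first n l = u ∧ (∀ i < l, (E (i + 1)).first n i ≠ u) ∧
      H.SimplicialIn (Finset.univ.filter fun v : Fin n => ∀ i < l, (E (i + 1)).first n i ≠ v) u) ∧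
    ∀ p < n, ∀ q < n, (E t).a 6 p q = ∑ k ∈ Finset.range n,
      (1 - (E t).a 5 k k) * ((E 0).a 4 q k * (1 - (E 0).a 4 p k)) := by
  have hadj : ∀ a b : Fin n, (E 0).a 4 a b ≠ 0 → a ≠ b → H.Adj a b := by
    intro a b hab hne
    by_contra hcon
    exact hab (hzero a b hne hcon)
  induction t with
  | zero =>
    refine ⟨fun l hl => by omega, fun p hp q hq => ?_⟩
    rw [h.count p hp q hq]
    refine Finset.sum_congr rfl fun k _ => ?_
    rw [h.dead, Nat.sub_zero, one_mul]
  | succ t ih =>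
    obtain ⟨ih1, ih2⟩ := ih (by omega)
    set A : Finset (Fin n) :=
      Finset.univ.filter fun v : Fin n => ∀ i < t, (E (i + 1)).first n i ≠ v with hA
    have memA : ∀ v : Fin n, v ∈ A ↔ (E t).a 5 v v = 0 := by
      intro v
      simp only [hA, Finset.mem_filter, Finset.mem_univ, true_and]
      constructor
      · exact (h.dead_eq t v).2
      · intro h0 i hi hiv
        rw [(h.dead_eq t v).1 ⟨i, hi, hiv⟩] at h0
        omega
    -- Fewer than `n` pivots cannot exhaust the `n` vertices.
    have hne : A.Nonempty := by
      by_contra hcon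
      rw [Finset.not_nonempty_iff_eq_empty] at hcon
      have hsub : (Finset.univ : Finset (Fin n)).image (fun v => v.val) ⊆
          (Finset.range t).image fun i => (E (i + 1)).first n i := by
        intro p hp
        obtain ⟨v, -, rfl⟩ := Finset.mem_image.1 hp
        have hv : v ∉ A := by simp [hcon]
        simp only [hA, Finset.mem_filter, Finset.mem_univ, true_and] at hv
        push Not at hv
        obtain ⟨i, hi, hiv⟩ := hv
        exact Finset.mem_image.2 ⟨i, Finset.mem_range.2 hi, hiv⟩
      have h1 := Finset.card_le_card hsub
      rw [Finset.card_image_of_injective _ Fin.val_injective, Finset.card_univ,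
        Fintype.card_fin] at h1
      have h2 := (Finset.card_image_le (s := Finset.range t)
        (f := fun i => (E (i + 1)).first n i))
      rw [Finset.card_range] at h2
      omega
    have h4 : (E t).a 4 = (E 0).a 4 :=
      h.frame t 4 (by decide) (by decide) (by decide) (by decide) (by decide)
    have hmark : ∀ v : Fin n, (E (t + 1)).a 7 t v ≠ 0 ↔ v ∈ A ∧ H.SimplicialIn A v := by
      intro v
      rw [(h.step t).mark v v.2, h4, memA]
      have key : (1 - ((E t).a 5 v v + ∑ q ∈ Finset.range n,
          (1 - (E t).a 5 q q) * (E 0).a 4 v q * (E t).a 6 q v) ≠ 0) ↔ (E t).a 5 v v = 0 ∧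
          ∀ q : Fin n, (1 - (E t).a 5 q q) * (E 0).a 4 v q * (E t).a 6 q v = 0 := by
        have hz : (∑ q : Fin n, (1 - (E t).a 5 q q) * (E 0).a 4 v q * (E t).a 6 q v = 0) ↔
            ∀ q : Fin n, (1 - (E t).a 5 q q) * (E 0).a 4 v q * (E t).a 6 q v = 0 := by
          simp only [Finset.sum_eq_zero_iff, Finset.mem_univ, true_implies]
        rw [Finset.sum_range, ← hz]
        omega
      rw [key]
      refine and_congr_right fun _ => ?_
      constructor
      · intro hq a ha b hb hva hvb hab
        have h1 := hq a
        rw [(memA a).1 ha, hone v a (Or.inr hva), Nat.sub_zero, one_mul, one_mul,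
          ih2 a a.2 v v.2, Finset.sum_eq_zero_iff] at h1
        have h2 := h1 b (Finset.mem_range.2 b.2)
        rw [(memA b).1 hb, hone v b (Or.inr hvb), Nat.sub_zero, one_mul, one_mul] at h2
        exact hadj a b (by omega) hab
      · intro hs q
        by_cases hqA : q ∈ A
        · by_cases hvq : (E 0).a 4 v q = 0
          · rw [hvq, mul_zero, zero_mul]
          · rw [ih2 q q.2 v v.2, Finset.sum_eq_zero, mul_zero]
            intro k hk
            obtain ⟨k, rfl⟩ : ∃ k' : Fin n, k = k' := ⟨⟨k, Finset.mem_range.1 hk⟩, rfl⟩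
            by_cases hkA : k ∈ A
            · by_cases hvk : (E 0).a 4 v k = 0
              · rw [hvk, zero_mul, mul_zero]
              · suffices hqk : (E 0).a 4 q k = 1 by rw [hqk, Nat.sub_self, mul_zero, mul_zero]
                by_cases hqv : v = q
                · subst hqv
                  by_cases hvk' : v = k
                  · exact hone _ _ (Or.inl hvk')
                  · exact hone _ _ (Or.inr (hadj _ _ hvk hvk'))
                · by_cases hvk' : v = k
                  · subst hvk'
                    exact hone _ _ (Or.inr (hadj _ _ hvq hqv).symm)
                  · by_cases hqk : q = k
                    · exact hone _ _ (Or.inl hqk)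
                    · exact hone _ _ (Or.inr (hs q hqA k hkA (hadj _ _ hvq hqv)
                        (hadj _ _ hvk hvk') hqk))
            · have : 1 - (E t).a 5 k k = 0 := by
                rw [memA] at hkA
                omega
              rw [this, zero_mul]
        · have : 1 - (E t).a 5 q q = 0 := by
            rw [memA] at hqA
            omega
          rw [this, zero_mul, zero_mul]
    obtain ⟨v0, hv0, hv0s⟩ := hH.exists_simplicialIn hne
    have hfirst := first_spec (n := n) (fun k => (E (t + 1)).a 7 t k)
      ⟨v0, v0.2, (hmark v0).2 ⟨hv0, hv0s⟩⟩
    obtain ⟨u, hu⟩ : ∃ u : Fin n, (E (t + 1)).first n t = u := ⟨⟨_, hfirst.1⟩, rfl⟩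
    have hum : (E (t + 1)).a 7 t u ≠ 0 := hu ▸ hfirst.2
    obtain ⟨huA, hus⟩ := (hmark u).1 hum
    refine ⟨fun l hl => ?_, fun p hp q hq => ?_⟩
    · rcases Nat.lt_succ_iff_lt_or_eq.1 hl with hl | rfl
      · exact ih1 l hl
      · refine ⟨u, hu, ?_, hus⟩
        simpa only [hA, Finset.mem_filter, Finset.mem_univ, true_and] using huA
    · rw [(h.step t).count p hp q hq, hu, h4, ih2 p hp q hq]
      refine Nat.sub_eq_of_eq_add ?_
      -- The two sums differ only in the term of `u`, which is live before the round and dead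
      -- afterwards.
      have hsplit : ∀ k ∈ Finset.range n,
          (1 - (E t).a 5 k k) * ((E 0).a 4 q k * (1 - (E 0).a 4 p k)) =
          (1 - (E (t + 1)).a 5 k k) * ((E 0).a 4 q k * (1 - (E 0).a 4 p k)) +
            if k = u then (E 0).a 4 q k * (1 - (E 0).a 4 p k) else 0 := by
        intro k _
        rw [(h.step t).dead, hu]
        split_ifs with hk
        · subst hk
          rw [(memA u).1 huA]
          simp
        · rw [add_zero]
      rw [Finset.sum_congr rfl hsplit, Finset.sum_add_distrib, Finset.sum_ite_eq',
        if_pos (Finset.mem_range.2 u.2)]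

end Elimination

/-- On chordal graphs, elimination and selection find a maximum weight independent set. -/
theorem select_correct {H : SimpleGraph (Fin n)} (hn : 0 < n) (hH : H.IsChordalGraph) {s : Store}
    (hone : ∀ a b : Fin n, a = b ∨ H.Adj a b → s.a 4 a b = 1)
    (hzero : ∀ a b : Fin n, a ≠ b → ¬ H.Adj a b → s.a 4 a b = 0)
    (h5 : ∀ p, s.a 5 p p = 0) (h9 : ∀ p, s.a 9 p p = 0)
    (h6 : ∀ p < n, ∀ q < n, s.a 6 p q = ∑ k ∈ Finset.range n, s.a 4 q k * (1 - s.a 4 p k))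
    {X : Finset (Fin n)} (hX : ∀ v : Fin n, v ∈ X ↔
      ((St.each 3 .select).run n ((St.each 3 .eliminate).run n s)).a 9 v v = 1) :
    (∀ a ∈ X, ∀ b ∈ X, ¬ H.Adj a b) ∧ (∀ a ∈ X, 0 < s.a 3 a a) ∧
      ∀ J : Finset (Fin n), (∀ a ∈ J, ∀ b ∈ J, ¬ H.Adj a b) →
        ∑ v ∈ J, s.a 3 v v ≤ ∑ v ∈ X, s.a 3 v v := by
  obtain ⟨E, rfl, hEn, hE⟩ := run_each_of_step (n := n) (x := 3) run_eliminate s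
  obtain ⟨F, hF0, hFn, hF⟩ := run_each_of_step (n := n) (x := 3) run_select (E n)
  rw [← hEn, ← hFn] at hX
  have hel : Elimination n E := ⟨hE, h5, h6⟩
  have hcor := (hel.correct hH hone hzero n le_rfl).1
  have hFframe : ∀ i j, j ≠ 9 → (F i).a j = (E n).a j := by
    intro i j hj
    induction i with
    | zero => rw [hF0]
    | succ i ih => rw [(hF i).frame j hj, ih]
  -- The remainder only makes the sequence total; for `t < n` it changes nothing.
  set u : ℕ → Fin n := fun t => ⟨(E (t + 1)).first n t % n, Nat.mod_lt _ hn⟩ with hu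
  have huv : ∀ t < n, (E (t + 1)).first n t = (u t : ℕ) := by
    intro t ht
    obtain ⟨w, hw, -⟩ := hcor t ht
    simp only [hu, hw, Nat.mod_eq_of_lt w.2]
  have hne : ∀ t < n, ∀ i < t, u i ≠ u t := by
    intro t ht i hi heq
    obtain ⟨w, hw, hw', -⟩ := hcor t ht
    refine hw' i hi ?_
    rw [← hw, huv t ht, huv i (by omega), heq]
  have hE4 : ∀ t, (E t).a 4 = (E 0).a 4 := fun t =>
    hel.frame t 4 (by decide) (by decide) (by decide) (by decide) (by decide)
  have hsel : ∀ t < n, ∀ p, (F (n - t)).a 9 p p = if p = u t then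
      (1 - (1 - (E t).a 3 (u t) (u t))) *
        (1 - ∑ q : Fin n, (F (n - (t + 1))).a 9 q q * (E 0).a 4 (u t) q)
      else (F (n - (t + 1))).a 9 p p := by
    intro t ht p
    obtain ⟨i, hi, hi'⟩ : ∃ i, n - (t + 1) = i ∧ n - t = i + 1 := ⟨_, rfl, by omega⟩
    have hit : n - i - 1 = t := by omega
    have hfirst : (F i).first n t = u t := by
      rw [← huv t ht]
      refine Store.first_congr ?_
      rw [hFframe i 7 (by decide)]
      funext q
      exact hel.mark_eq ht q
    rw [hi, hi', (hF i).chosen, hit, hfirst, hFframe i 8 (by decide), hFframe i 4 (by decide),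
      hel.pivot_eq ht, (hE t).pivot, huv t ht, hE4, Finset.sum_range]
  -- After `i` rounds of selection only the last `i` pivots can be marked, and marks are `0` or `1`.
  have hsupp : ∀ i ≤ n, ∀ p, (F i).a 9 p p ≠ 0 → (F i).a 9 p p = 1 ∧
      ∃ t, n - i ≤ t ∧ t < n ∧ p = u t := by
    intro i
    induction i with
    | zero =>
      intro _ p hp
      rw [hF0, hel.frame n 9 (by decide) (by decide) (by decide) (by decide) (by decide)] at hp
      exact absurd (h9 p) hp
    | succ i ih =>
      intro hi p hp
      have := hsel (n - (i + 1)) (by omega) p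
      rw [show n - (n - (i + 1)) = i + 1 by omega,
        show n - (n - (i + 1) + 1) = i by omega] at this
      rw [this] at hp ⊢
      split_ifs at hp ⊢ with hpu
      · refine ⟨le_antisymm ?_ (Nat.one_le_iff_ne_zero.2 hp), n - (i + 1), le_rfl, by omega, hpu⟩
        exact (Nat.mul_le_mul (Nat.sub_le 1 _) (Nat.sub_le 1 _)).trans (by simp)
      · obtain ⟨h1, t, h2, h3, h4⟩ := ih (by omega) p hp
        exact ⟨h1, t, by omega, h3, h4⟩
  have hmain := SimpleGraph.maxWeight_of_elimination (H := H) (h := fun a b => (E 0).a 4 a b)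
    hone hzero (N := n) (u := u)
    (A := fun t => Finset.univ.filter fun v => ∀ l < t, u l ≠ v)
    (fun t v => by simp) (fun t ht => by simpa using hne t ht)
    (by
      rw [Finset.filter_eq_empty_iff]
      intro v _ hv
      have hinj : Function.Injective fun i : Fin n => u i := by
        intro i k hik
        by_contra hcon
        rcases lt_or_gt_of_ne hcon with h | h
        · exact hne k k.2 i h hik
        · exact hne i i.2 k h hik.symm
      obtain ⟨i, hi⟩ := (Finite.injective_iff_surjective.1 hinj) v
      exact hv i i.2 hi)
    (fun t ht => by
      obtain ⟨w, hw, hw', hw''⟩ := hcor t ht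
      have hwu : w = u t := by
        rw [Fin.ext_iff, ← hw, huv t ht]
      rw [hwu] at hw''
      convert hw'' using 3 with v
      refine forall_congr' fun hl => ?_
      rw [huv _ (by omega), Ne, Ne, Fin.ext_iff])
    (r := fun t v => (E t).a 3 v v)
    (fun t ht v => by
      rw [(hE t).weight v v.2, huv t ht, hE4])
    -- Selection runs backwards, so the set belonging to elimination round `t` is found after `n -
    -- t` rounds.
    (X := fun t => Finset.univ.filter fun v : Fin n => (F (n - t)).a 9 v v ≠ 0)
    (by
      rw [Finset.filter_eq_empty_iff]
      intro v _ hv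
      obtain ⟨-, t, h1, h2, -⟩ := hsupp (n - n) (by omega) v hv
      omega)
    (by
      intro t ht v
      simp only [Finset.mem_filter, Finset.mem_univ, true_and]
      have hut : (F (n - (t + 1))).a 9 (u t) (u t) = 0 := by
        by_contra hcon
        obtain ⟨-, l, h1, h2, h3⟩ := hsupp _ (by omega) _ hcon
        exact hne l h2 t (by omega) (Fin.ext h3)
      rw [hsel t ht]
      by_cases hv : v = u t
      · subst hv
        rw [if_pos rfl, hut]
        simp only [ne_eq, not_true_eq_false, true_and, false_or]
        rw [Nat.mul_eq_zero, not_or]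
        refine and_congr (by omega) ?_
        have hs : (¬ 1 - ∑ q : Fin n, (F (n - (t + 1))).a 9 q q * (E 0).a 4 (u t) q = 0) ↔
            ∑ q : Fin n, (F (n - (t + 1))).a 9 q q * (E 0).a 4 (u t) q = 0 := by omega
        rw [hs, Finset.sum_eq_zero_iff]
        simp only [Finset.mem_univ, true_implies, Nat.mul_eq_zero]
        exact forall_congr' fun z => or_iff_not_imp_left
      · rw [if_neg fun h => hv (Fin.ext h)]
        simp [hv])
  have hX0 : X = Finset.univ.filter fun v : Fin n => (F (n - 0)).a 9 v v ≠ 0 := by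
    ext v
    rw [hX]
    simp only [Nat.sub_zero, Finset.mem_filter, Finset.mem_univ, true_and]
    exact ⟨fun h => by omega, fun h => (hsupp n le_rfl v h).1⟩
  rw [hX0]
  exact hmain

end Calc

/-! ### From the input to the solved instance -/

namespace WED

open SimpleGraph Calc

variable {n : ℕ}

theorem input_mem_adj (G : SimpleGraph (Fin n)) (w : Fin n → ℕ∞) (p q : Fin n) :
    (G.Adj p q → (input G w).mem (n * p + q) = 1) ∧
      (¬ G.Adj p q → (input G w).mem (n * p + q) = 0) := by
  constructor
  · intro h
    exact if_pos ⟨p, q, rfl, h⟩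
  · intro h
    have h1 := mul_add_lt_mul p.2 q.2
    refine (if_neg ?_).trans (dif_neg fun h' => by omega)
    rintro ⟨i, j, hij, hadj⟩
    obtain ⟨hp, hq⟩ := mul_add_inj q.2 j.2 hij
    rw [← Fin.ext hp, ← Fin.ext hq] at hadj
    exact h hadj

theorem input_mem_weight (G : SimpleGraph (Fin n)) (w : Fin n → ℕ∞) (p : Fin n) :
    (input G w).mem (n * n + p) = codeWeight (w p) := by
  refine (if_neg ?_).trans ?_
  · rintro ⟨i, j, hij, -⟩
    have := mul_add_lt_mul i.2 j.2
    omega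
  · rw [dif_pos ⟨by omega, by omega⟩]
    congr 2
    exact Fin.ext (by simp)

theorem input_mem_zero (G : SimpleGraph (Fin n)) (w : Fin n → ℕ∞) {a : ℕ} (ha : n * n + n ≤ a) :
    (input G w).mem a = 0 := by
  refine (if_neg ?_).trans (dif_neg fun h => by omega)
  rintro ⟨i, j, hij, -⟩
  have := mul_add_lt_mul i.2 j.2
  omega

/-- The calculation starts with the adjacency matrix and the weights. -/
noncomputable def initial (G : SimpleGraph (Fin n)) (w : Fin n → ℕ∞) : Store where
  v _ := 0
  a j p q := if j = 0 ∨ j = 1 then (input G w).mem (addr n j p q) else 0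

theorem initial_adj (G : SimpleGraph (Fin n)) (w : Fin n → ℕ∞) (p q : Fin n) :
    (initial G w).a 0 p q = (input G w).mem (n * p + q) := by
  simp [initial, addr]

theorem initial_weight (G : SimpleGraph (Fin n)) (w : Fin n → ℕ∞) (p : Fin n) :
    (initial G w).a 1 p p = codeWeight (w p) := by
  rw [← input_mem_weight G w]
  simp [initial, addr]

theorem rep_initial (G : SimpleGraph (Fin n)) (w : Fin n → ℕ∞) :
    Rep n (input G w) (initial G w) where
  size := rfl
  var x _ := rfl
  arr j p q hv := by
    simp only [initial]
    split_ifs with hj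
    · rfl
    · rw [not_or] at hj
      refine input_mem_zero G w ?_
      rw [addr, if_neg hj.1, if_neg hj.2]
      omega

theorem codeWeight_le (w : Fin n → ℕ∞) (v : Fin n) :
    codeWeight (w v) ≤ maxFiniteWeight w + 1 := by
  have h1 : codeWeight (w v) ≤ (w v).toNat + 1 := by
    induction w v using ENat.recTopCoe with
    | top => exact Nat.zero_le _
    | coe m => exact le_rfl
  have h2 : (w v).toNat ≤ maxFiniteWeight w :=
    Finset.le_sup (f := fun v => (w v).toNat) (Finset.mem_univ v)
  omega

theorem bounded_initial (hn : 0 < n) (G : SimpleGraph (Fin n)) (w : Fin n → ℕ∞) :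
    Bounded n (n + maxFiniteWeight w + 2) (initial G w) where
  lt_size _ _ := hn
  le_size _ _ _ := Nat.zero_le _
  var_le _ _ _ := Nat.zero_le _
  arr_le j p q hv := by
    rcases hv with ⟨rfl, hp, hq⟩ | ⟨rfl, hp, rfl⟩ | ⟨hj, -⟩
    · have h := initial_adj G w ⟨p, hp⟩ ⟨q, hq⟩
      have h' := input_mem_adj G w ⟨p, hp⟩ ⟨q, hq⟩
      simp only at h h'
      rw [h]
      by_cases hadj : G.Adj ⟨p, hp⟩ ⟨q, hq⟩
      · rw [h'.1 hadj]
        exact Nat.one_le_pow _ _ (by omega)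
      · rw [h'.2 hadj]
        exact Nat.zero_le _
    · have h := initial_weight G w ⟨q, hp⟩
      simp only at h
      rw [h]
      have := codeWeight_le w ⟨q, hp⟩
      simp only [arrExp, pow_one]
      omega
    · have : ¬ (j = 0 ∨ j = 1) := by omega
      simp [initial, this]

/-- The arrays after the preparation. -/
structure Prepared (G : SimpleGraph (Fin n)) (w : Fin n → ℕ∞) (s : Store) : Prop where
  weight : ∀ v : Fin n, s.a 1 v v = codeWeight (w v)
  nbhd_one : ∀ p q : Fin n, p = q ∨ G.Adj p q → s.a 2 p q = 1
  nbhd_zero : ∀ p q : Fin n, p ≠ q → ¬ G.Adj p q → s.a 2 p q = 0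
  residual : ∀ v : Fin n, s.a 3 v v = (1 - (1 - codeWeight (w v))) *
    ((1 + ∑ z, codeWeight (w z)) * (G.closedNbhd v).card + 1 - codeWeight (w v))
  square_one : ∀ p q : Fin n, p = q ∨ G.square.Adj p q → s.a 4 p q = 1
  square_zero : ∀ p q : Fin n, p ≠ q → ¬ G.square.Adj p q → s.a 4 p q = 0
  count : ∀ p < n, ∀ q < n, s.a 6 p q = ∑ k ∈ Finset.range n, s.a 4 q k * (1 - s.a 4 p k)
  dead : ∀ p, s.a 5 p p = 0
  chosen : ∀ p, s.a 9 p p = 0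

theorem prepared_run (G : SimpleGraph (Fin n)) (w : Fin n → ℕ∞) :
    Prepared G w (St.prepare.run n (initial G w)) := by
  obtain ⟨s1, e1, v1, a1, f1⟩ := run_closedAdj (n := n) (initial G w)
  have one1 : ∀ p q : Fin n, p = q ∨ G.Adj p q → s1.a 2 p q = 1 := by
    intro p q h
    rw [f1 p p.2 q q.2, initial_adj]
    rcases h with rfl | h
    · rw [(input_mem_adj G w p p).2 (G.loopless.irrefl p)]
      simp
    · rw [(input_mem_adj G w p q).1 h]
      have := Fin.val_ne_of_ne h.ne
      omega
  have zero1 : ∀ p q : Fin n, p ≠ q → ¬ G.Adj p q → s1.a 2 p q = 0 := by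
    intro p q hne h
    rw [f1 p p.2 q q.2, initial_adj, (input_mem_adj G w p q).2 h]
    have := Fin.val_ne_of_ne hne
    omega
  have wt1 : ∀ v : Fin n, s1.a 1 v v = codeWeight (w v) := by
    intro v
    rw [a1 1 (by decide), initial_weight]
  set s2 := s1.setV 16 (1 + ∑ z : Fin n, codeWeight (w z)) with hs2
  have e2 : St.bigWeight.run n s1 = s2 := by
    simp only [St.bigWeight, St.run, Ex.eval, hs2]
    rw [Finset.sum_range]
    congr 2
    refine Finset.sum_congr rfl fun z _ => ?_
    simp only [Store.setV, Function.update_self]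
    exact wt1 z
  obtain ⟨s3, e3, v3, a3, f3, -⟩ := run_initWeight (n := n) s2
  obtain ⟨s4, e4, v4, a4, f4⟩ := run_squareAdj (n := n) s3
  obtain ⟨s5, e5, v5, a5, f5⟩ := run_initCount (n := n) s4
  have hrun : St.prepare.run n (initial G w) = s5 := by
    simp only [St.prepare, St.run, e1, e2, e3, e4, e5]
  rw [hrun]
  have a21 : s2.a = s1.a := rfl
  have h2 : s5.a 2 = s1.a 2 := by
    rw [a5 2 (by decide), a4 2 (by decide), a3 2 (by decide), a21]
  have h4 : ∀ p q : Fin n, s5.a 4 p q = 1 - (1 - ∑ k : Fin n, s1.a 2 p k * s1.a 2 q k) := by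
    intro p q
    rw [a5 4 (by decide), f4 p p.2 q q.2, a3 2 (by decide), a21, Finset.sum_range]
  have hclose : ∀ p q : Fin n, ∑ k : Fin n, s1.a 2 p k * s1.a 2 q k ≠ 0 ↔ G.Close p q := by
    intro p q
    rw [Ne, Finset.sum_eq_zero_iff]
    simp only [Finset.mem_univ, true_implies, not_forall, Nat.mul_eq_zero, not_or]
    refine exists_congr fun k => ?_
    have key : ∀ p : Fin n, ¬ s1.a 2 p k = 0 ↔ (k = p ∨ G.Adj k p) := by
      intro p
      rw [eq_comm (a := k), G.adj_comm]
      by_cases h : p = k ∨ G.Adj p k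
      · simp only [one1 p k h, h]
        decide
      · simp only [h, iff_false, not_not]
        rw [not_or] at h
        exact zero1 p k h.1 h.2
    rw [key, key]
  have zero : ∀ j, 5 ≤ j → j ≠ 6 → ∀ p q, s5.a j p q = 0 := by
    intro j hj hj' p q
    rw [a5 j hj', a4 j (by omega), a3 j (by omega), a21, a1 j (by omega)]
    have : ¬ (j = 0 ∨ j = 1) := by omega
    simp [initial, this]
  refine ⟨?_, ?_, ?_, ?_, ?_, ?_, ?_, fun p => zero 5 (by decide) (by decide) p p,
    fun p => zero 9 (by decide) (by decide) p p⟩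
  · intro v
    rw [a5 1 (by decide), a4 1 (by decide), a3 1 (by decide), a21, wt1]
  · rw [h2]
    exact one1
  · rw [h2]
    exact zero1
  · intro v
    have hdeg : ∑ q ∈ Finset.range n, s1.a 2 v q = (G.closedNbhd v).card := by
      classical
      rw [Finset.sum_range, closedNbhd, Finset.card_filter]
      refine Finset.sum_congr rfl fun q _ => ?_
      split_ifs with h
      · exact one1 v q (h.imp Eq.symm id)
      · rw [not_or] at h
        exact zero1 v q (Ne.symm h.1) h.2
    have hM : s2.v 16 = 1 + ∑ z, codeWeight (w z) := by simp [hs2, Store.setV]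
    rw [a5 3 (by decide), a4 3 (by decide), f3 v v.2, a21, wt1, hdeg, hM]
  · intro p q h
    have : G.Close p q := by
      rcases h with rfl | h
      · exact .refl _
      · exact h.2
    rw [← hclose] at this
    rw [h4]
    omega
  · intro p q hne h
    have : ¬ G.Close p q := fun h' => h ⟨hne, h'⟩
    rw [← hclose, not_not] at this
    rw [h4, this]
  · intro p hp q hq
    rw [f5 p hp q hq, a5 4 (by decide)]

/-- The calculation solves the instance. -/
theorem run_main (hn : 0 < n) {G : SimpleGraph (Fin n)} (w : Fin n → ℕ∞)
    (hG : G.IsChordalGraph) (hgem : extendedGem.InducedFree G) {X : Finset (Fin n)}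
    (hX : ∀ v : Fin n, v ∈ X ↔ (St.main.run n (initial G w)).a 1 v v = 1) :
    ((St.main.run n (initial G w)).v 19 = 1 ∧ G.IsMinFiniteWeightEDS w X) ∨
      ((St.main.run n (initial G w)).v 19 = 0 ∧ ¬ G.HasFiniteWeightEDS w) := by
  have hpre := prepared_run G w
  set s1 := St.prepare.run n (initial G w) with hs1
  obtain ⟨E, hE0, hEn, hE⟩ := run_each_of_step (n := n) (x := 3) run_eliminate s1
  obtain ⟨F, hF0, hFn, hF⟩ := run_each_of_step (n := n) (x := 3) run_select (E n)
  obtain ⟨s4, e4, a4, f4⟩ := run_verify (n := n) (F n)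
  obtain ⟨s5, e5, v5, a5, f5, -⟩ := run_output (n := n) s4
  have hrun : St.main.run n (initial G w) = s5 := by
    simp only [St.main, St.run, ← hs1]
    rw [← e5, ← e4, hFn, hEn]
    rfl
  have hFa : ∀ j, j ≠ 9 → j ≠ 3 → j ≠ 5 → j ≠ 6 → j ≠ 7 → j ≠ 8 → (F n).a j = s1.a j := by
    intro j h9 h3 h5 h6 h7 h8
    have hF' : ∀ i, (F i).a j = (E n).a j := by
      intro i
      induction i with
      | zero => rw [hF0]
      | succ i ih => rw [(hF i).frame j h9, ih]
    have hE' : ∀ i, (E i).a j = s1.a j := by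
      intro i
      induction i with
      | zero => rw [hE0]
      | succ i ih => rw [(hE i).frame j h3 h5 h6 h7 h8, ih]
    rw [hF', hE']
  rw [hrun] at hX ⊢
  have hX9 : ∀ v : Fin n, v ∈ X ↔ (F n).a 9 v v = 1 := by
    intro v
    rw [hX, f5 v v.2, a4]
  -- The static bound with exponent `0` is used here, as it holds even if the square is not chordal.
  have hle : ∀ v : Fin n, (F n).a 9 v v ≤ 1 := by
    intro v
    have hb := bounded_initial hn G w
    have hok := St.main_ok
    simp only [St.main, St.ok, Bool.and_eq_true] at hok
    have hb1 := hb.run (by omega) St.prepare _ hok.1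
    have hb2 := hb1.run (by omega) (.each 3 .eliminate) _ (by decide)
    have hb3 := hb2.run (by omega) (.each 3 .select) _ (by decide)
    rw [← hs1, ← hEn, ← hFn] at hb3
    simpa [arrExp] using hb3.arr_le 9 v v (Or.inr (Or.inr ⟨by decide, by decide, by omega, by omega⟩))
  have h2 : (F n).a 2 = s1.a 2 :=
    hFa 2 (by decide) (by decide) (by decide) (by decide) (by decide) (by decide)
  have h1 : (F n).a 1 = s1.a 1 :=
    hFa 1 (by decide) (by decide) (by decide) (by decide) (by decide) (by decide)
  have hdom : ∀ p : Fin n, ∑ q ∈ Finset.range n, (F n).a 9 q q * (F n).a 2 q p = 1 ↔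
      ∃! d, d ∈ X ∧ (d = p ∨ G.Adj d p) := by
    classical
    intro p
    rw [Fintype.existsUnique_iff_card_one, Finset.card_filter, Finset.sum_range]
    refine Eq.congr (Finset.sum_congr rfl fun q _ => ?_) rfl
    rw [h2]
    by_cases hq : q ∈ X
    · rw [(hX9 q).1 hq, one_mul]
      by_cases hqp : q = p ∨ G.Adj q p
      · rw [if_pos ⟨hq, hqp⟩, hpre.nbhd_one q p hqp]
      · rw [if_neg fun h => hqp h.2]
        rw [not_or] at hqp
        exact hpre.nbhd_zero q p hqp.1 hqp.2
    · rw [if_neg fun h => hq h.1]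
      rw [hX9] at hq
      have := hle q
      rw [show (F n).a 9 q q = 0 by omega, zero_mul]
  have hv19 : s5.v 19 = 1 ∨ s5.v 19 = 0 := by
    rw [v5 19 (by decide), f4]
    omega
  have hgood : s5.v 19 = 1 ↔ G.IsEfficientDominatingSet X ∧ ∑ v ∈ X, w v ≠ ⊤ := by
    have hsplit : ∀ a b : ℕ, 1 - (a + b) = 1 ↔ a = 0 ∧ b = 0 := by omega
    have hterm : ∀ a : ℕ, a - 1 + (1 - a) = 0 ↔ a = 1 := by omega
    rw [v5 19 (by decide), f4, hsplit, Finset.sum_range, Finset.sum_range, Finset.sum_eq_zero_iff,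
      Finset.sum_eq_zero_iff]
    simp only [Finset.mem_univ, true_implies]
    refine and_congr (forall_congr' fun p => (hterm _).trans (hdom p)) ?_
    rw [ENat.sum_ne_top]
    refine forall_congr' fun v => ?_
    rw [h1, hpre.weight, hX9, Nat.mul_eq_zero]
    have h3 := hle v
    have h4 : w v ≠ ⊤ ↔ codeWeight (w v) ≠ 0 := not_congr codeWeight_eq_zero_iff.symm
    rw [h4]
    omega
  -- Chordality of the square is available only when a solution exists; otherwise soundness of the
  -- check suffices.
  by_cases hfin : G.HasFiniteWeightEDS w
  · left
    obtain ⟨D, hD, hDf⟩ := hfin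
    obtain ⟨i1, i2, i3⟩ := select_correct hn (hG.square hgem hD) hpre.square_one
      hpre.square_zero hpre.dead hpre.chosen hpre.count (X := X) (by
        intro v
        rw [hX9, hFn, hEn])
    have hmin : G.IsMinFiniteWeightEDS w X := by
      refine isMinFiniteWeightEDS_of_maxWeight (w := w) (M := 1 + ∑ z, codeWeight (w z))
        (c := fun v : Fin n => s1.a 3 v v) (by omega) ?_ ?_ ⟨D, hD, hDf⟩ i1 i2 i3
      · intro v hv
        simp only [hpre.residual v]
        rw [codeWeight_eq_zero_iff.2 hv]
        simp
      · intro v hv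
        simp only [hpre.residual v]
        have hc : codeWeight (w v) ≠ 0 := fun h => hv (codeWeight_eq_zero_iff.1 h)
        have hle1 : codeWeight (w v) ≤ ∑ z, codeWeight (w z) :=
          Finset.single_le_sum (f := fun z => codeWeight (w z)) (fun _ _ => Nat.zero_le _)
            (Finset.mem_univ v)
        have hcard : 1 ≤ (G.closedNbhd v).card :=
          Finset.card_pos.2 ⟨v, mem_closedNbhd.2 (Or.inl rfl)⟩
        have hmul := Nat.mul_le_mul_left (1 + ∑ z, codeWeight (w z)) hcard
        rw [show 1 - (1 - codeWeight (w v)) = 1 by omega, one_mul]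
        omega
    exact ⟨hgood.2 ⟨hmin.1, hmin.2.1⟩, hmin⟩
  · right
    refine ⟨hv19.resolve_left fun h => hfin ⟨X, hgood.1 h⟩, hfin⟩

/-- The program for the machine. -/
def program : RAM.Prog :=
  -- For the empty graph the empty set is a solution of weight zero. Otherwise the verdict is
  -- variable `19`, held in register `20`.
  .ite (.eq (.reg 0) (.const 0)) (.assign 0 (.copy (.const 1)))
    (.seq (St.main.compile 40) (.assign 0 (.copy (.reg 20))))

theorem program_post {G : SimpleGraph (Fin n)} (w : Fin n → ℕ∞)
    (hG : G.IsChordalGraph) (hgem : extendedGem.InducedFree G) :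
    RAM.Post ((n + maxFiniteWeight w + 2) ^ 30) program (input G w)
      (St.main.weight * (n + 1) ^ 3 + 2) (Solves G w) := by
  have h1P : n + maxFiniteWeight w + 2 ≤ (n + maxFiniteWeight w + 2) ^ 30 :=
    Nat.le_self_pow (by omega) _
  rcases Nat.eq_zero_or_pos n with rfl | hn
  · refine ⟨_, _, .ite_true rfl (.assign _ _ _ ?_), by omega, ?_⟩
    · simp only [RAM.Rhs.val, RAM.Operand.val]
      omega
    · refine Or.inl ⟨by simp [RAM.Rhs.val, RAM.Operand.val], fun v => v.elim0, ?_, fun D' _ => ?_⟩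
      · rw [Finset.sum_eq_zero fun (v : Fin 0) _ => v.elim0]
        exact ENat.zero_ne_top
      · rw [Finset.sum_eq_zero fun (v : Fin 0) _ => v.elim0]
        exact zero_le
  · have hP : n + 2 ≤ n + maxFiniteWeight w + 2 := by omega
    have hb := bounded_initial hn G w
    obtain ⟨t, s, h1, h2, h3, -⟩ := St.compile_post hP St.main 40 _ _ le_rfl St.main_ok hb
      (rep_initial G w)
    have hcost := h2.trans St.main.cost_le
    rw [St.main_depth] at hcost
    have h20 := h3.var 19 (by decide)
    have hX : ∀ v : Fin n, v ∈ outputSet n s ↔ (St.main.run n (initial G w)).a 1 v v = 1 := by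
      intro v
      rw [← h3.arr 1 v v (Or.inr (Or.inl ⟨rfl, v.2, rfl⟩))]
      simp [outputSet, addr]
    have hmain := run_main hn w hG hgem hX
    have hreg : (RAM.Rhs.copy (.reg 20)).val s = (St.main.run n (initial G w)).v 19 := h20
    refine ⟨_, _, .ite_false ?_ (.seq h1 (.assign _ _ _ ?_)), by omega, ?_⟩
    · exact fun h : n = 0 => by omega
    · rw [hreg]
      rcases hmain with h | h <;> rw [h.1] <;> omega
    · have e := (Function.update_self 0 ((RAM.Rhs.copy (.reg 20)).val s) s.reg).trans hreg
      exact hmain.imp (fun h => ⟨e.trans h.1, h.2⟩) fun h => ⟨e.trans h.1, h.2⟩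

end WED

theorem corollary2 :
    WED.SolvableInTime (fun _ G => G.IsChordalGraph ∧ SimpleGraph.extendedGem.InducedFree G)
      (fun n => n ^ 3) := by
  refine ⟨WED.program, 30, fun n => Calc.St.main.weight * (n + 1) ^ 3 + 2, ?_, ?_⟩
  · refine Asymptotics.IsBigO.of_bound (8 * Calc.St.main.weight + 2) ?_
    filter_upwards [Filter.eventually_ge_atTop 1] with n hn
    have h1 : (n + 1) ^ 3 ≤ 8 * n ^ 3 := by
      calc (n + 1) ^ 3 ≤ (2 * n) ^ 3 := Nat.pow_le_pow_left (by omega) 3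
        _ = 8 * n ^ 3 := by ring
    have h2 : 1 ≤ n ^ 3 := Nat.one_le_pow _ _ hn
    have h3 : Calc.St.main.weight * (n + 1) ^ 3 + 2 ≤ (8 * Calc.St.main.weight + 2) * n ^ 3 := by
      have := Nat.mul_le_mul_left Calc.St.main.weight h1
      rw [add_mul, mul_comm 8, mul_assoc]
      omega
    rw [Real.norm_natCast, Real.norm_natCast]
    exact_mod_cast h3
  · rintro n G w ⟨hG, hgem⟩
    obtain ⟨t, s, h1, h2, h3⟩ := WED.program_post w hG hgem
    exact ⟨t, s, h1, h2, h3⟩
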